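/- Let $(P,\le_P)$ be a finite $(3+1)$-free poset, i.e. no induced subposet of $P$ is the disjoint union of a $3$-chain and a $1$-chain. All positions are cells $(i,j)$ with $i,j\ge 1$ (row $i$, column $j$, matrix convention). **Arrays and tableaux.** A *$P$-array* is an indexing $\{A_{i,j}\}$ of the elements of $P$ (each element used once) such that if $A_{i,j}$ is defined and $j>1$, then $A_{i,j-1}$ is defined and $A_{i,j-1}<_P A_{i,j}$. It is a *$P$-tableau* if moreover, whenever $A_{i,j}$ is defined and $i>1$, $A_{i-1,j}$ is defined and $A_{i-1,j}\not>_P A_{i,j}$. Its weight $\mathbf{wt}(A)$ has $i$th part the number of entries in row $i$. A *two-row $P$-tableau* is a $P$-tableau $T$ with $\mathbf{wt}(T)_i=0$ for all $i>2$. **The $r$ alignment.** Let $a_1<_P\dots<_P a_m$ and $b_1<_P\dots<_P b_n$ be rows $r$ and $r+1$ of a $P$-array $A$. Put $a_k$ in row $r$ and $b_k$ in row $r+1$, in columns $C(b_k)=k$ and $C(a_k)=1+\max(\{C(b_i): b_i<_P a_k\}\cup\{C(a_i): i<k\})$, with $\max\emptyset=0$. As long as there is an entry $x$, in some column $c$,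 such that column $c+1$ is nonempty and contains no $y>_P x$, move the rightmost such $x$ to column $c+1$. The final placement is the *$r$ alignment* of $A$. **The $P$-array crystal.** If every column of the $r$ alignment with an entry in row $r$ also has one in row $r+1$, then $f_r(A)=0$. Otherwise let $p$ be minimal such that $a_p$ shares no column with an entry of row $r+1$, and let $t\ge 0$ be minimal such that no $b_i\not>_P a_{p+t}$ lies one column to the right of $a_{p+t}$; $f_r(A)$ is obtained by moving $a_p,\dots,a_{p+t}$ to row $r+1$ and every $b_i$ sharing a column with one of them to row $r$. Similarly $e_r(A)=0$ if every column with an entry in row $r+1$ has one in row $r$; otherwise let $p$ be maximal such that $b_p$ shares no column with an entry of row $r$, let $t\ge0$ be minimal such that no $a_i\not>_P b_{p+t}$ lies one column to the right of $b_{p+t}$, and move $b_p,\dots,b_{p+t}$ to row $r$ and every $a_i$ sharing a column with one of them to row $r+1$. The *$P$-array crystal* is the graph on all $P$-arrays with edges given by the operators $e_r,f_r$, $r\ge1$. **The diagram crystal.** A *diagram* is a finite set $D$ of cells; $\mathbf{wt}(D)_i$ is the number of its cells in row $i$. The *$r$-pairs* of $D$ are formed iteratively: unpaired cells $x$ in row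 $r$ and $y$ in row $r+1$, with $x$ weakly left of $y$, form a pair when every other cell of rows $r,r+1$ in a column weakly between them is already paired. $f_r$ moves the leftmost cell of row $r$ that is not $r$-paired down to row $r+1$ in the same column, and $e_r$ moves the rightmost cell of row $r+1$ that is not $r$-paired up to row $r$ (the result is $0$ if there is no such cell). The *diagram crystal* is the graph on all diagrams with edges given by these operators. For a two-row $P$-tableau $T$, $\mathbb D(T)$ is the image of the $1$ alignment of $T$, and $\mathcal D(T)$ is the set of diagrams in the connected component of $\mathbb D(T)$. **Fillings.** For $D\in\mathcal D(T)$ the *diagram filling* $L_{D,T}:P\to D$ is built column by column from left to right, the entries of column $c$ of the $1$ alignment of $T$ being mapped to the cells of column $c$ of $D$. A single entry goes to the unique cell. If column $c$ has two entries $x_1,x_2$, in rows $1,2$ of $T$, use the first applicable rule: (1) if $y$ is the element mapped to the topmost cell $(r,c-1)$ of column $c-1$ and exactly one $x_i$ is $>_P y$, map that $x_i$ to $(s,c)$ with $s\le r$ maximal such that $(s,c)\in D$, and the other entry to the other cell; (2) the same with the lowest cell $(r,c-1)$ of column $c-1$; (3) map $x_1$ to the upper and $x_2$ to the lower cell. For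 a filling $L$, $\mathrm{array}(L)=\{A_{i,j}\}$, where $L(A_{i,j})$ is the $j$th cell from the left in row $i$ of the image of $L$. Let $\mathrm{DFA}(P,T)=\{\mathrm{array}(L_{D,T}): D\in\mathcal D(T)\}$, and let $\mathrm{DFA}(P)$ be the union of these sets over all two-row $P$-tableaux $T$. **Theorem.** For every two-row $P$-tableau $T$ and $D\in\mathcal D(T)$, $L_{D,T}$ is a bijection from $P$ onto $D$ and $\mathrm{array}(L_{D,T})$ is a $P$-array. The map $$\varphi:\ \{(T,D): T\text{ a two-row }P\text{-tableau},\ D\in\mathcal D(T)\}\to \mathrm{DFA}(P),\qquad (T,D)\mapsto \mathrm{array}(L_{D,T}),$$ is a bijection, and $\mathbf{wt}(D)=\mathbf{wt}(\varphi(T,D))$. Moreover, for each two-row $P$-tableau $T$, $\mathrm{DFA}(P,T)$ is a connected subset of the $P$-array crystal, i.e. the subgraph induced on it is connected. -/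

import Mathlib

/-! Conventions.  Rows, columns and crystal colours are numbered from `0`, and positions are
written in matrix convention: the pair `(i, j)` is the cell in row `i` and column `j`, a larger
row index is lower in the picture and a larger column index is further to the right. -/

/-- `P` is `(a+b)`-free: the disjoint union of an `a`-chain and a `b`-chain does not embed in `P`
as an induced subposet. -/
def SumFree (a b : ℕ) (P : Type*) [PartialOrder P] : Prop :=
  IsEmpty ((Fin a ⊕ Fin b) ↪o P)

section Arrays

variable {P : Type*} [PartialOrder P] [Fintype P]

/-- A placement `A : P → ℕ × ℕ` of all elements of `P` on the grid (`A x = (i, j)` means that the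
entry `A_{i,j}` is `x`) is a `P`-array if no position is used twice and each entry outside the
first column has a smaller entry immediately to its left. -/
def IsPArray (A : P → ℕ × ℕ) : Prop :=
  Function.Injective A ∧ ∀ x i j, A x = (i, j + 1) → ∃ y, A y = (i, j) ∧ y < x

/-- A `P`-tableau is a `P`-array such that each entry outside the first row has an entry
immediately above it, which is not greater. -/
def IsPTableau (A : P → ℕ × ℕ) : Prop :=
  IsPArray A ∧ ∀ x i j, A x = (i + 1, j) → ∃ y, A y = (i, j) ∧ ¬ x < y

open Classical in
/-- The weight: the number of entries in row `i`. -/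
noncomputable def arrayWt (A : P → ℕ × ℕ) (i : ℕ) : ℕ :=
  (Finset.univ.filter fun x => (A x).1 = i).card

/-- A `P`-tableau all of whose rows after the first two are empty. -/
def IsTwoRowTableau (T : P → ℕ × ℕ) : Prop :=
  IsPTableau T ∧ ∀ i, 2 ≤ i → arrayWt T i = 0

/-! ### The `r` alignment

The entries of rows `r` and `r + 1` are the chains `a_0 < a_1 < ⋯` and `b_0 < b_1 < ⋯`.  All maps
from these entries to `{r, r+1} × columns` that occur keep the row of every entry, so only the
column is recorded, as a function on `P` whose values outside the two rows are irrelevant. -/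

/-- `x` is an entry of row `r` or of row `r + 1`. -/
def InRows (A : P → ℕ × ℕ) (r : ℕ) (x : P) : Prop :=
  (A x).1 = r ∨ (A x).1 = r + 1

open Classical in
/-- The column in the `r` pre-alignment: `b_k` goes to column `k`, and `a_k` goes to the first
column that is to the right of every `b_i < a_k` and of every `a_i` with `i < k`. -/
noncomputable def preAlign (A : P → ℕ × ℕ) (r : ℕ) (x : P) : ℕ :=
  if (A x).1 = r then
    max
      ((Finset.univ.filter fun y => (A y).1 = r + 1 ∧ y < x).sup fun y => (A y).2 + 1)
      ((Finset.univ.filter fun y => (A y).1 = r ∧ (A y).2 < (A x).2).attach.sup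
        fun y => preAlign A r y.1 + 1)
  else (A x).2
termination_by (A x).2
decreasing_by
  have h := y.2
  simp only [Finset.mem_filter] at h
  exact h.2.2

/-- The entry `x` can be shifted: the column to its right is nonempty and has no entry `> x`. -/
def Movable (A : P → ℕ × ℕ) (r : ℕ) (C : P → ℕ) (x : P) : Prop :=
  InRows A r x ∧ (∃ z, InRows A r z ∧ C z = C x + 1) ∧
    ∀ y, InRows A r y → C y = C x + 1 → ¬ x < y

/-- `x` is a rightmost entry that can be shifted. -/
def RightmostMovable (A : P → ℕ × ℕ) (r : ℕ) (C : P → ℕ) (x : P) : Prop :=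
  Movable A r C x ∧ ∀ y, Movable A r C y → C y ≤ C x

open Classical in
/-- Shift the rightmost entry that can be shifted one column to the right, if there is one. -/
noncomputable def alignStep (A : P → ℕ × ℕ) (r : ℕ) (C : P → ℕ) : P → ℕ :=
  if h : ∃ x, RightmostMovable A r C x then
    Function.update C h.choose (C h.choose + 1)
  else C

/-- Iterating `alignStep`, one reaches a stage at which no entry can be shifted. -/
theorem exists_alignStep_stable (A : P → ℕ × ℕ) (r : ℕ) (C : P → ℕ) :
    ∃ k, ∀ x, ¬ Movable A r ((alignStep A r)^[k] C) x := by
  classical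
  by_contra hcon
  push Not at hcon
  have step : ∀ C' : P → ℕ, (∃ x, Movable A r C' x) →
      ∃ x, Movable A r C' x ∧ alignStep A r C' = Function.update C' x (C' x + 1) := by
    intro C' hx
    have h : ∃ x, RightmostMovable A r C' x := by
      obtain ⟨x, hx⟩ := hx
      obtain ⟨m, hm, hmax⟩ := Finset.exists_max_image
        (Finset.univ.filter fun y => Movable A r C' y) C' ⟨x, by simpa using hx⟩
      exact ⟨m, by simpa using hm, fun y hy => hmax y (by simpa using hy)⟩
    exact ⟨h.choose, h.choose_spec.1, by simp [alignStep, h]⟩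
  set d := Finset.univ.sup C with hd
  have key : ∀ k, (∀ x, (alignStep A r)^[k] C x ≤ d) ∧
      k ≤ ∑ x, (alignStep A r)^[k] C x := by
    intro k
    induction k with
    | zero => exact ⟨fun x => Finset.le_sup (Finset.mem_univ x), Nat.zero_le _⟩
    | succ k ih =>
      obtain ⟨x, hx, he⟩ := step _ (hcon k)
      rw [Function.iterate_succ_apply', he]
      obtain ⟨-, ⟨z, -, hz⟩, -⟩ := hx
      refine ⟨fun y => ?_, ?_⟩
      · by_cases hy : y = x
        · subst hy
          have := ih.1 z
          simp only [Function.update_self]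
          omega
        · simpa [Function.update_of_ne hy] using ih.1 y
      · refine Nat.succ_le_of_lt (lt_of_le_of_lt ih.2 (Finset.sum_lt_sum ?_ ⟨x, by simp, by simp⟩))
        intro y _
        by_cases hy : y = x
        · subst hy
          simp
        · simp [Function.update_of_ne hy]
  have h1 := (key (Fintype.card P * d + 1)).2
  have h2 := Finset.sum_le_card_nsmul Finset.univ _ d
    fun x _ => (key (Fintype.card P * d + 1)).1 x
  simp only [Finset.card_univ, smul_eq_mul] at h2
  omega

open Classical in
/-- The column of `x` in the `r` alignment: start with the pre-alignment and shift until no entry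
can be shifted any more. -/
noncomputable def align (A : P → ℕ × ℕ) (r : ℕ) : P → ℕ :=
  (alignStep A r)^[Nat.find (exists_alignStep_stable A r (preAlign A r))] (preAlign A r)

/-! ### The crystal on `P`-arrays -/

open Classical in
/-- The placement in which row `i` consists of the `x` with `κ x = i`, in increasing order. -/
noncomputable def ofRows (κ : P → ℕ) (x : P) : ℕ × ℕ :=
  (κ x, (Finset.univ.filter fun y => κ y = κ x ∧ y < x).card)

/-- `x` is an entry of row `s` that shares its column in the `r` alignment with no entry of
row `s'`.  Used with `{s, s'} = {r, r + 1}`. -/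
def Unshared (A : P → ℕ × ℕ) (r s s' : ℕ) (x : P) : Prop :=
  (A x).1 = s ∧ ∀ y, (A y).1 = s' → align A r y ≠ align A r x

/-- The entry `x` of row `s` is such that one column to its right in the `r` alignment there is
no entry of row `s'` that fails to be greater than `x`. -/
def RunEnd (A : P → ℕ × ℕ) (r s s' : ℕ) (x : P) : Prop :=
  (A x).1 = s ∧ ∀ y, (A y).1 = s' → align A r y = align A r x + 1 → x < y

/-- `z` is the first entry of row `s`, from the entry `p` of that row on, that is a `RunEnd`. -/
def FirstRunEnd (A : P → ℕ × ℕ) (r s s' : ℕ) (p z : P) : Prop :=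
  RunEnd A r s s' z ∧ (A p).2 ≤ (A z).2 ∧
    ∀ w, RunEnd A r s s' w → (A p).2 ≤ (A w).2 → (A z).2 ≤ (A w).2

/-- The entry `x` changes rows when the entries from `p` to `z` of row `s` are moved to row `s'`,
and the entries of row `s'` that share a column with one of them are moved to row `s`. -/
def InSwap (A : P → ℕ × ℕ) (r s s' : ℕ) (p z x : P) : Prop :=
  ((A x).1 = s ∧ (A p).2 ≤ (A x).2 ∧ (A x).2 ≤ (A z).2) ∨
  ((A x).1 = s' ∧ ∃ w, (A w).1 = s ∧ (A p).2 ≤ (A w).2 ∧ (A w).2 ≤ (A z).2 ∧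
    align A r x = align A r w)

/-- `p` is the leftmost entry of row `r` that shares no column with an entry of row `r + 1`. -/
def LowerStart (A : P → ℕ × ℕ) (r : ℕ) (p : P) : Prop :=
  Unshared A r r (r + 1) p ∧ ∀ w, Unshared A r r (r + 1) w → (A p).2 ≤ (A w).2

/-- `p` is the rightmost entry of row `r + 1` that shares no column with an entry of row `r`. -/
def RaiseStart (A : P → ℕ × ℕ) (r : ℕ) (p : P) : Prop :=
  Unshared A r (r + 1) r p ∧ ∀ w, Unshared A r (r + 1) r w → (A w).2 ≤ (A p).2

open Classical in
/-- The lowering operator `f_r`; `none` plays the role of `0`. -/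
noncomputable def arrayLower (r : ℕ) (A : P → ℕ × ℕ) : Option (P → ℕ × ℕ) :=
  if ∃ p, Unshared A r r (r + 1) p then
    some (ofRows fun x =>
      if ∃ p z, LowerStart A r p ∧ FirstRunEnd A r r (r + 1) p z ∧ InSwap A r r (r + 1) p z x
      then (if (A x).1 = r then r + 1 else r) else (A x).1)
  else none

open Classical in
/-- The raising operator `e_r`; `none` plays the role of `0`. -/
noncomputable def arrayRaise (r : ℕ) (A : P → ℕ × ℕ) : Option (P → ℕ × ℕ) :=
  if ∃ p, Unshared A r (r + 1) r p then
    some (ofRows fun x =>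
      if ∃ p z, RaiseStart A r p ∧ FirstRunEnd A r (r + 1) r p z ∧ InSwap A r (r + 1) r p z x
      then (if (A x).1 = r then r + 1 else r) else (A x).1)
  else none

variable (P) in
/-- The underlying undirected graph of the crystal on `P`-arrays. -/
def arrayCrystal : SimpleGraph {A : P → ℕ × ℕ // IsPArray A} :=
  SimpleGraph.fromRel fun A B =>
    ∃ r, arrayLower r A.1 = some B.1 ∨ arrayRaise r A.1 = some B.1

end Arrays

/-! ### The diagram crystal -/

/-- A diagram is a finite set of cells. -/
abbrev Diagram := Finset (ℕ × ℕ)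

/-- The weight: the number of cells in row `i`. -/
def diagramWt (D : Diagram) (i : ℕ) : ℕ :=
  (D.filter fun z => z.1 = i).card

/-- The cell `z` belongs to one of the pairs in `S`. -/
def IsPaired (S : Set ((ℕ × ℕ) × (ℕ × ℕ))) (z : ℕ × ℕ) : Prop :=
  ∃ w, (z, w) ∈ S ∨ (w, z) ∈ S

/-- Given the set `S` of pairs formed so far, the set of pairs of unpaired cells `x`, `y` of `D` in
rows `r` and `r + 1`, with `x` weakly left of `y`, such that all other cells in these two rows in
columns weakly between `x` and `y` are already paired. -/
def newPairs (D : Diagram) (r : ℕ) (S : Set ((ℕ × ℕ) × (ℕ × ℕ))) :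
    Set ((ℕ × ℕ) × (ℕ × ℕ)) :=
  {q | q.1 ∈ D ∧ q.2 ∈ D ∧ q.1.1 = r ∧ q.2.1 = r + 1 ∧ q.1.2 ≤ q.2.2 ∧
    ¬ IsPaired S q.1 ∧ ¬ IsPaired S q.2 ∧
    ∀ z ∈ D, (z.1 = r ∨ z.1 = r + 1) → q.1.2 ≤ z.2 → z.2 ≤ q.2.2 → z ≠ q.1 → z ≠ q.2 →
      IsPaired S z}

/-- The set of `r`-pairs of `D`, built by iteration from the empty set. -/
def rPairs (D : Diagram) (r : ℕ) : Set ((ℕ × ℕ) × (ℕ × ℕ)) :=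
  ⋃ k : ℕ, (fun S => S ∪ newPairs D r S)^[k] ∅

open Classical in
/-- The columns of the cells in row `s` of `D` that are not `r`-paired. -/
noncomputable def unpairedCols (D : Diagram) (r s : ℕ) : Finset ℕ :=
  (D.filter fun z => z.1 = s ∧ ¬ IsPaired (rPairs D r) z).image Prod.snd

open Classical in
/-- The lowering operator `f_r` moves the leftmost cell in row `r` that is not `r`-paired to row
`r + 1`; `none` plays the role of `0`. -/
noncomputable def diagramLower (r : ℕ) (D : Diagram) : Option Diagram :=
  if h : (unpairedCols D r r).Nonempty then
    some (insert (r + 1, (unpairedCols D r r).min' h) (D.erase (r, (unpairedCols D r r).min' h)))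
  else none

open Classical in
/-- The raising operator `e_r` moves the rightmost cell in row `r + 1` that is not `r`-paired to
row `r`; `none` plays the role of `0`. -/
noncomputable def diagramRaise (r : ℕ) (D : Diagram) : Option Diagram :=
  if h : (unpairedCols D r (r + 1)).Nonempty then
    some (insert (r, (unpairedCols D r (r + 1)).max' h)
      (D.erase (r + 1, (unpairedCols D r (r + 1)).max' h)))
  else none

/-- The underlying undirected graph of the diagram crystal. -/
def diagramCrystal : SimpleGraph Diagram :=
  SimpleGraph.fromRel fun D E => ∃ r, diagramLower r D = some E ∨ diagramRaise r D = some E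

/-! ### Diagram fillings -/

/-- The row of the topmost cell in column `c` of `D`. -/
noncomputable def topRow (D : Diagram) (c : ℕ) : ℕ := sInf {s | (s, c) ∈ D}

/-- The row of the lowest cell in column `c` of `D`. -/
noncomputable def botRow (D : Diagram) (c : ℕ) : ℕ := sSup {s | (s, c) ∈ D}

/-- The maximal `s ≤ r` with `(s, c) ∈ D`. -/
noncomputable def rowAbove (D : Diagram) (c r : ℕ) : ℕ := sSup {s | s ≤ r ∧ (s, c) ∈ D}

/-- The row of the cell in column `c` of `D` that remains when the one in row `s` is removed. -/
noncomputable def otherRow (D : Diagram) (c s : ℕ) : ℕ := sInf {s' | s' ≠ s ∧ (s', c) ∈ D}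

section Fillings

variable {P : Type*} [PartialOrder P] [Fintype P]

open Classical in
/-- The diagram of a two-row tableau `T`: the image of the alignment of its two rows. -/
noncomputable def tableauDiagram (T : P → ℕ × ℕ) : Diagram :=
  Finset.univ.image fun x => ((T x).1, align T 0 x)

/-- The set of diagrams in the connected component of the diagram of `T`. -/
def componentDiagrams (T : P → ℕ × ℕ) : Set Diagram :=
  {D | diagramCrystal.Reachable (tableauDiagram T) D}

/-- With `ρ` giving the rows of the entries already placed in column `c`, the entry `y` in the
cell `(r, c)` is such that exactly one entry in the next column of the alignment is greater
than `y`. -/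
def RuleWitness (T : P → ℕ × ℕ) (ρ : P → ℕ) (c r : ℕ) (y : P) : Prop :=
  align T 0 y = c ∧ ρ y = r ∧ ∃! x, align T 0 x = c + 1 ∧ y < x

open Classical in
/-- The row of the entry `x` of column `c + 1` when that column, with two entries, is filled by the
rule for the entry in the cell `(r, c)`: the entry greater than it goes to the lowest cell weakly
above row `r`, the other entry to the remaining cell. -/
noncomputable def ruleRow (T : P → ℕ × ℕ) (D : Diagram) (ρ : P → ℕ) (c r : ℕ) (x : P) : ℕ :=
  if ∃ y, RuleWitness T ρ c r y ∧ y < x then rowAbove D (c + 1) r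
  else otherRow D (c + 1) (rowAbove D (c + 1) r)

/-- The row of the entry `x` of column `c` by the default rule: the entry in the first row of `T`
goes to the upper cell, the entry in the second row of `T` goes to the lower cell. -/
noncomputable def defaultRow (T : P → ℕ × ℕ) (D : Diagram) (c : ℕ) (x : P) : ℕ :=
  if (T x).1 = 0 then topRow D c else botRow D c

open Classical in
/-- The rows of the entries of column `c` in the filling of `D` with respect to `T`, column by
column from left to right.  The cell of a single entry is the unique cell in its column. -/
noncomputable def fillRow (T : P → ℕ × ℕ) (D : Diagram) : ℕ → P → ℕ
  | 0, x => if ∃! z : P, align T 0 z = 0 then topRow D 0 else defaultRow T D 0 x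
  | c + 1, x =>
    if ∃! z : P, align T 0 z = c + 1 then topRow D (c + 1)
    else if ∃ y, RuleWitness T (fillRow T D c) c (topRow D c) y then
      ruleRow T D (fillRow T D c) c (topRow D c) x
    else if ∃ y, RuleWitness T (fillRow T D c) c (botRow D c) y then
      ruleRow T D (fillRow T D c) c (botRow D c) x
    else defaultRow T D (c + 1) x

/-- The diagram filling of `D` with respect to the two-row tableau `T`. -/
noncomputable def filling (T : P → ℕ × ℕ) (D : Diagram) (x : P) : ℕ × ℕ :=
  (fillRow T D (align T 0 x) x, align T 0 x)

open Classical in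
/-- The array of `L : P → ℕ × ℕ`: the entry at position `(i, j)` is the element that `L` sends to
the cell in row `i` of the image of `L` that has exactly `j` cells of that row to its left. -/
noncomputable def array (L : P → ℕ × ℕ) (x : P) : ℕ × ℕ :=
  ((L x).1,
    ((Finset.univ.image L).filter fun z => z.1 = (L x).1 ∧ z.2 < (L x).2).card)

variable (P) in
/-- The set of diagram fillings. -/
def diagramFillings : Set (P → ℕ × ℕ) :=
  {L | ∃ T, IsTwoRowTableau T ∧ ∃ D ∈ componentDiagrams T, L = filling T D}

/-- The set of diagram fillings for a fixed two-row tableau `T`. -/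
def diagramFillingsOf (T : P → ℕ × ℕ) : Set (P → ℕ × ℕ) :=
  {L | ∃ D ∈ componentDiagrams T, L = filling T D}

variable (P) in
/-- The set of arrays of diagram fillings. -/
def fillingArrays : Set (P → ℕ × ℕ) := array '' diagramFillings P

/-- The set of arrays of diagram fillings for a fixed two-row tableau `T`. -/
def fillingArraysOf (T : P → ℕ × ℕ) : Set (P → ℕ × ℕ) := array '' diagramFillingsOf T

end Fillings

/-!
Fix a two-row tableau `T` with its alignment `C = align T 0`.  In `C` the first row of `T` occupies
an initial segment of the columns and does not move, while each entry of the second row sits as far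
to the right as it can (`TableauAlignment`).

*Diagrams.*  A move of the diagram crystal can be expressed by counting cells, in a form that is
symmetric in its two ends (`CrystalMove`).  From this it follows that every diagram in the component
of `tableauDiagram T` is `Compatible` with `T`: its columns have the sizes of those of `C`, it has
no three cells with strictly increasing rows and weakly increasing columns (`NoLongDescent`), and
there is a path from left to right through its columns that never goes down (`HasPath`).

*Fillings.*  For such a diagram `D` the filling has a closed recursive description (`upperRow`,
`filling_eq`): the entry of the first row of `T` takes the top cell of its column, except in a
column that is loose (`LooseAt`), where it takes the lowest cell weakly above the row of its
predecessor in the first row.  With `(3+1)`-freeness in the form `SumFree.lt_or_lt`, this shows that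
every row of the filling is a chain and that no entry is below an entry of the row above that is
weakly to its left (`ChainFilling`).  Hence the array of the filling is a `P`-array, of the same
weight as `D`.

*Operators.*  `array` does not intertwine the raising operators in general.  It does, however, for
the smallest `r` with `e_r D ≠ 0` (`arrayRaise_filling_of_first`), and `e_r D = 0` always implies
that `e_r` is `0` on the array (`arrayRaise_filling_eq_none`).  When `e_r` moves the cell
`(r + 1, c)` of `D`, the effect on the filling is that the entries of the rows `r` and `r + 1` in
the columns from `c` to some `e` change rows (`upperRow_raise`).  The only obstruction is that
column `c` is loose and the preceding entry of the first row lies in row `r`.  This is impossible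
for `r = 0`, since `(0, c)` is not in `D`, and for `r > 0` it yields three cells excluded by
`NoLongDescent`, because `e_{r-1} D = 0` forces a cell of row `r - 1` weakly to the left of that
entry.  On the side of the arrays, the alignment of
the rows `r` and `r + 1` is controlled by properties that persist through the shifting process
(`RunStage`): every entry of row `r + 1` up to column `e` ends in the column given by its position
in the row, each entry of that row to the right of column `e` shares its column with one of row
`r`, and so the array operator moves exactly the same entries.

*Conclusion.*  The only diagram of the component on which all `e_r` vanish is `tableauDiagram T`,
whose array is `T` itself (`eq_tableauDiagram`, `array_filling_tableauDiagram`).  Since raising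
lowers the sum of the row indices, every diagram of the component is joined to `tableauDiagram T` by
the first applicable raising operators (`componentDiagrams_induction`).  These operators are also
determined by the array, so that they join the arrays within `fillingArraysOf T`, which is therefore
connected, and `T` can be read off the array by applying them as long as possible
(`tableau_eq_of_array_filling_eq`).  Given `T`, the diagram is recovered from the rows of the
entries.
-/

/-! ### The pairing of two rows of a diagram -/

/-- The state of the pairing process in which `S` has been reached: the pairs are disjoint, and
every cell in the column interval of a pair belongs to a pair nested in it. -/
structure NestedPairs (D : Diagram) (r : ℕ) (S : Set ((ℕ × ℕ) × (ℕ × ℕ))) : Prop where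
  left_mem : ∀ q ∈ S, q.1 ∈ D ∧ q.1.1 = r
  right_mem : ∀ q ∈ S, q.2 ∈ D ∧ q.2.1 = r + 1
  le : ∀ q ∈ S, q.1.2 ≤ q.2.2
  nested : ∀ q ∈ S, ∀ z ∈ D, (z.1 = r ∨ z.1 = r + 1) → q.1.2 ≤ z.2 → z.2 ≤ q.2.2 →
    ∃ q' ∈ S, (z = q'.1 ∨ z = q'.2) ∧ q.1.2 ≤ q'.1.2 ∧ q'.2.2 ≤ q.2.2
  left_inj : ∀ q ∈ S, ∀ q' ∈ S, q.1 = q'.1 → q = q'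
  right_inj : ∀ q ∈ S, ∀ q' ∈ S, q.2 = q'.2 → q = q'

theorem NestedPairs.step {D : Diagram} {r : ℕ} {S : Set ((ℕ × ℕ) × (ℕ × ℕ))}
    (h : NestedPairs D r S) : NestedPairs D r (S ∪ newPairs D r S) := by
  have pl : ∀ q ∈ S, IsPaired S q.1 := fun q hq => ⟨q.2, Or.inl hq⟩
  have pr : ∀ q ∈ S, IsPaired S q.2 := fun q hq => ⟨q.1, Or.inr hq⟩
  refine ⟨?_, ?_, ?_, ?_, ?_, ?_⟩
  · rintro q (hq | hq)
    · exact h.left_mem q hq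
    · exact ⟨hq.1, hq.2.2.1⟩
  · rintro q (hq | hq)
    · exact h.right_mem q hq
    · exact ⟨hq.2.1, hq.2.2.2.1⟩
  · rintro q (hq | hq)
    · exact h.le q hq
    · exact hq.2.2.2.2.1
  · rintro q (hq | hq) z hz hr h1 h2
    · obtain ⟨q', hq', h3⟩ := h.nested q hq z hz hr h1 h2
      exact ⟨q', Or.inl hq', h3⟩
    · have hq0 := hq
      obtain ⟨hx, hy, hxr, hyr, hle, hpx, hpy, hall⟩ := hq
      by_cases hzx : z = q.1
      · exact ⟨q, Or.inr hq0, Or.inl hzx, le_rfl, le_rfl⟩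
      by_cases hzy : z = q.2
      · exact ⟨q, Or.inr hq0, Or.inr hzy, le_rfl, le_rfl⟩
      obtain ⟨w, hw⟩ := hall z hz hr h1 h2 hzx hzy
      -- A pair of `S` at `z` that sticks out of the interval would enclose an end of `q`.
      have key : ∀ q' ∈ S, (z = q'.1 ∨ z = q'.2) → q.1.2 ≤ q'.1.2 ∧ q'.2.2 ≤ q.2.2 := by
        intro q' hq' hz'
        have hle' := h.le q' hq'
        constructor
        · by_contra hlt
          obtain ⟨q'', hq'', hor, -⟩ := h.nested q' hq' q.1 hx (Or.inl hxr) (by omega)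
            (by rcases hz' with rfl | rfl <;> omega)
          rcases hor with e | e
          · exact hpx (e ▸ pl q'' hq'')
          · exact hpx (e ▸ pr q'' hq'')
        · by_contra hlt
          obtain ⟨q'', hq'', hor, -⟩ := h.nested q' hq' q.2 hy (Or.inr hyr)
            (by rcases hz' with rfl | rfl <;> omega) (by omega)
          rcases hor with e | e
          · exact hpy (e ▸ pl q'' hq'')
          · exact hpy (e ▸ pr q'' hq'')
      rcases hw with hw | hw
      · exact ⟨_, Or.inl hw, Or.inl rfl, key _ hw (Or.inl rfl)⟩
      · exact ⟨_, Or.inl hw, Or.inr rfl, key _ hw (Or.inr rfl)⟩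
  · rintro q (hq | hq) q' (hq' | hq') he
    · exact h.left_inj q hq q' hq' he
    · exact absurd (he ▸ pl q hq) hq'.2.2.2.2.2.1
    · exact absurd (he ▸ pl q' hq') hq.2.2.2.2.2.1
    · by_contra hne
      have hne2 : q.2 ≠ q'.2 := fun e => hne (Prod.ext he e)
      obtain ⟨hx, hy, hxr, hyr, hle, hpx, hpy, hall⟩ := hq
      obtain ⟨hx', hy', hxr', hyr', hle', hpx', hpy', hall'⟩ := hq'
      rcases le_total q.2.2 q'.2.2 with hl | hl
      · refine hpy (hall' q.2 hy (Or.inr hyr) (he ▸ hle) hl (fun e => ?_) hne2)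
        rw [e] at hyr; omega
      · refine hpy' (hall q'.2 hy' (Or.inr hyr') (he ▸ hle') hl (fun e => ?_) hne2.symm)
        rw [e] at hyr'; omega
  · rintro q (hq | hq) q' (hq' | hq') he
    · exact h.right_inj q hq q' hq' he
    · exact absurd (he ▸ pr q hq) hq'.2.2.2.2.2.2.1
    · exact absurd (he ▸ pr q' hq') hq.2.2.2.2.2.2.1
    · by_contra hne
      have hne2 : q.1 ≠ q'.1 := fun e => hne (Prod.ext e he)
      obtain ⟨hx, hy, hxr, hyr, hle, hpx, hpy, hall⟩ := hq
      obtain ⟨hx', hy', hxr', hyr', hle', hpx', hpy', hall'⟩ := hq'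
      rcases le_total q.1.2 q'.1.2 with hl | hl
      · refine hpx' (hall q'.1 hx' (Or.inl hxr') hl (he ▸ hle') hne2.symm (fun e => ?_))
        rw [e] at hxr'; omega
      · refine hpx (hall' q.1 hx (Or.inl hxr) hl (he ▸ hle) hne2 (fun e => ?_))
        rw [e] at hxr; omega

theorem nestedPairs_iterate (D : Diagram) (r k : ℕ) :
    NestedPairs D r ((fun S => S ∪ newPairs D r S)^[k] ∅) := by
  induction k with
  | zero => constructor <;> simp
  | succ k ih =>
    rw [Function.iterate_succ_apply']
    exact ih.step

theorem monotone_iterate_newPairs (D : Diagram) (r : ℕ) :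
    Monotone fun k => (fun S => S ∪ newPairs D r S)^[k] (∅ : Set ((ℕ × ℕ) × (ℕ × ℕ))) := by
  refine monotone_nat_of_le_succ fun k => ?_
  simp only [Function.iterate_succ_apply']
  exact Set.subset_union_left

theorem nestedPairs_rPairs (D : Diagram) (r : ℕ) : NestedPairs D r (rPairs D r) := by
  have hm := monotone_iterate_newPairs D r
  have two : ∀ q ∈ rPairs D r, ∀ q' ∈ rPairs D r, ∃ k,
      q ∈ (fun S => S ∪ newPairs D r S)^[k] ∅ ∧ q' ∈ (fun S => S ∪ newPairs D r S)^[k] ∅ := by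
    intro q hq q' hq'
    obtain ⟨i, hi⟩ := Set.mem_iUnion.1 hq
    obtain ⟨j, hj⟩ := Set.mem_iUnion.1 hq'
    exact ⟨max i j, hm (le_max_left i j) hi, hm (le_max_right i j) hj⟩
  refine ⟨fun q hq => ?_, fun q hq => ?_, fun q hq => ?_, fun q hq z hz hr h1 h2 => ?_,
    fun q hq q' hq' he => ?_, fun q hq q' hq' he => ?_⟩
  · obtain ⟨k, hk⟩ := Set.mem_iUnion.1 hq
    exact (nestedPairs_iterate D r k).left_mem q hk
  · obtain ⟨k, hk⟩ := Set.mem_iUnion.1 hq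
    exact (nestedPairs_iterate D r k).right_mem q hk
  · obtain ⟨k, hk⟩ := Set.mem_iUnion.1 hq
    exact (nestedPairs_iterate D r k).le q hk
  · obtain ⟨k, hk⟩ := Set.mem_iUnion.1 hq
    obtain ⟨q', hq', h3⟩ := (nestedPairs_iterate D r k).nested q hk z hz hr h1 h2
    exact ⟨q', Set.mem_iUnion.2 ⟨k, hq'⟩, h3⟩
  · obtain ⟨k, hk, hk'⟩ := two q hq q' hq'
    exact (nestedPairs_iterate D r k).left_inj q hk q' hk' he
  · obtain ⟨k, hk, hk'⟩ := two q hq q' hq'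
    exact (nestedPairs_iterate D r k).right_inj q hk q' hk' he

/-- The pairing process is saturated: unpaired cells of row `r` are strictly to the right of
unpaired cells of row `r + 1`. -/
theorem lt_of_not_isPaired {D : Diagram} {r : ℕ} : ∀ {i j : ℕ}, (r, i) ∈ D → (r + 1, j) ∈ D →
    ¬ IsPaired (rPairs D r) (r, i) → ¬ IsPaired (rPairs D r) (r + 1, j) → j < i := by
  suffices H : ∀ n i j, j - i = n → (r, i) ∈ D → (r + 1, j) ∈ D →
      ¬ IsPaired (rPairs D r) (r, i) → ¬ IsPaired (rPairs D r) (r + 1, j) → j < i from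
    fun {i j} => H _ i j rfl
  intro n
  induction n using Nat.strong_induction_on with
  | _ n ih =>
  intro i j hn hi hj hpi hpj
  by_contra hij
  push Not at hij
  by_cases hz : ∀ z ∈ D, (z.1 = r ∨ z.1 = r + 1) → i ≤ z.2 → z.2 ≤ j → z ≠ (r, i) →
      z ≠ (r + 1, j) → IsPaired (rPairs D r) z
  · -- Finitely many cells lie in between, so they are all paired at some finite stage.
    have hm := monotone_iterate_newPairs D r
    have hk : ∀ z, ∃ k, IsPaired (rPairs D r) z →
        IsPaired ((fun S => S ∪ newPairs D r S)^[k] ∅) z := by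
      intro z
      by_cases h : IsPaired (rPairs D r) z
      · obtain ⟨w, hw | hw⟩ := h
        · obtain ⟨k, hk⟩ := Set.mem_iUnion.1 hw
          exact ⟨k, fun _ => ⟨w, Or.inl hk⟩⟩
        · obtain ⟨k, hk⟩ := Set.mem_iUnion.1 hw
          exact ⟨k, fun _ => ⟨w, Or.inr hk⟩⟩
      · exact ⟨0, fun h' => absurd h' h⟩
    choose k hk using hk
    have mono : ∀ {a b : ℕ} {z}, a ≤ b → IsPaired ((fun S => S ∪ newPairs D r S)^[a] ∅) z →
        IsPaired ((fun S => S ∪ newPairs D r S)^[b] ∅) z := by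
      rintro a b z hab ⟨w, hw | hw⟩
      · exact ⟨w, Or.inl (hm hab hw)⟩
      · exact ⟨w, Or.inr (hm hab hw)⟩
    have up : ∀ {a : ℕ} {z}, IsPaired ((fun S => S ∪ newPairs D r S)^[a] ∅) z →
        IsPaired (rPairs D r) z := by
      rintro a z ⟨w, hw | hw⟩
      · exact ⟨w, Or.inl (Set.mem_iUnion.2 ⟨a, hw⟩)⟩
      · exact ⟨w, Or.inr (Set.mem_iUnion.2 ⟨a, hw⟩)⟩
    have hnew : ((r, i), (r + 1, j)) ∈
        newPairs D r ((fun S => S ∪ newPairs D r S)^[D.sup k] ∅) :=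
      ⟨hi, hj, rfl, rfl, hij, fun h => hpi (up h), fun h => hpj (up h),
        fun z hzD hr h1 h2 h3 h4 => mono (Finset.le_sup hzD) (hk z (hz z hzD hr h1 h2 h3 h4))⟩
    have hin : ((r, i), (r + 1, j)) ∈ rPairs D r :=
      Set.mem_iUnion.2 ⟨D.sup k + 1, by
        rw [Function.iterate_succ_apply']
        exact Or.inr hnew⟩
    exact hpi ⟨_, Or.inl hin⟩
  · push Not at hz
    obtain ⟨⟨s, k⟩, hzD, hr | hr, h1, h2, h3, h4, h5⟩ := hz
    · simp only at hr h1 h2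
      subst hr
      have : i ≠ k := fun e => h3 (by rw [e])
      have := ih (j - k) (by omega) k j rfl hzD hj h5 hpj
      omega
    · simp only at hr h1 h2
      subst hr
      have : k ≠ j := fun e => h4 (by rw [e])
      have := ih (k - i) (by omega) i k rfl hi hzD hpi h5
      omega

/-- The number of cells of `D` in row `s` in the columns `i ≤ c < k`. -/
def rowCount (D : Diagram) (s i k : ℕ) : ℕ :=
  ((Finset.Ico i k).filter fun c => (s, c) ∈ D).card

theorem rowCount_succ {D : Diagram} {s i k : ℕ} (hik : i ≤ k) :
    rowCount D s i (k + 1) = rowCount D s i k + if (s, k) ∈ D then 1 else 0 := by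
  unfold rowCount
  rw [← Finset.insert_Ico_right_eq_Ico_add_one hik, Finset.filter_insert]
  split_ifs with h
  · rw [Finset.card_insert_of_notMem (by simp)]
  · simp

theorem rowCount_add {D : Diagram} {s i j k : ℕ} (hij : i ≤ j) (hjk : j ≤ k) :
    rowCount D s i j + rowCount D s j k = rowCount D s i k := by
  unfold rowCount
  rw [← Finset.Ico_union_Ico_eq_Ico hij hjk, Finset.filter_union, Finset.card_union_of_disjoint]
  exact Finset.disjoint_filter_filter (Finset.Ico_disjoint_Ico_consecutive i j k)

theorem rowCount_mono {D : Diagram} {s i j k : ℕ} (hjk : j ≤ k) :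
    rowCount D s i j ≤ rowCount D s i k :=
  Finset.card_le_card (Finset.filter_subset_filter _ (Finset.Ico_subset_Ico_right hjk))

theorem rowCount_self {D : Diagram} {s i : ℕ} : rowCount D s i i = 0 := by
  simp [rowCount]

theorem rowCount_le {D : Diagram} {s i k : ℕ} : rowCount D s i k ≤ k - i :=
  (Finset.card_filter_le _ _).trans (by simp)

theorem rowCount_congr {D E : Diagram} {s i k : ℕ}
    (h : ∀ c, i ≤ c → c < k → ((s, c) ∈ D ↔ (s, c) ∈ E)) :
    rowCount D s i k = rowCount E s i k := by
  unfold rowCount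
  congr 1
  refine Finset.filter_congr fun c hc => ?_
  rw [Finset.mem_Ico] at hc
  exact h c hc.1 hc.2

theorem rowCount_pos_iff {D : Diagram} {s i k : ℕ} :
    0 < rowCount D s i k ↔ ∃ c, i ≤ c ∧ c < k ∧ (s, c) ∈ D := by
  unfold rowCount
  rw [Finset.card_pos]
  constructor
  · rintro ⟨c, hc⟩
    simp only [Finset.mem_filter, Finset.mem_Ico] at hc
    exact ⟨c, hc.1.1, hc.1.2, hc.2⟩
  · rintro ⟨c, h1, h2, h3⟩
    exact ⟨c, by simp [h1, h2, h3]⟩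

theorem mem_of_rowCount_eq {D : Diagram} {s i k c : ℕ} (h : k - i ≤ rowCount D s i k)
    (hi : i ≤ c) (hk : c < k) : (s, c) ∈ D := by
  unfold rowCount at h
  have h2 := Finset.filter_card_eq (s := Finset.Ico i k) (p := fun c => (s, c) ∈ D)
    (le_antisymm (Finset.card_filter_le _ _) (by simpa using h))
  exact h2 c (by simp [hi, hk])

theorem rowCount_eq_of_forall {D : Diagram} {s i k : ℕ}
    (h : ∀ c, i ≤ c → c < k → (s, c) ∈ D) : rowCount D s i k = k - i := by
  unfold rowCount
  rw [Finset.filter_true_of_mem]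
  · simp
  · intro c hc
    rw [Finset.mem_Ico] at hc
    exact h c hc.1 hc.2

theorem rowCount_le_of_pairs {D : Diagram} {r i k : ℕ}
    (h : ∀ c, i ≤ c → c < k → (r, c) ∈ D → ∃ d, i ≤ d ∧ d < k ∧
      ((r, c), (r + 1, d)) ∈ rPairs D r) :
    rowCount D r i k ≤ rowCount D (r + 1) i k := by
  classical
  have hP := nestedPairs_rPairs D r
  refine Finset.card_le_card_of_forall_subsingleton
    (fun c d => ((r, c), (r + 1, d)) ∈ rPairs D r) ?_ ?_
  · intro c hc
    simp only [Finset.mem_filter, Finset.mem_Ico] at hc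
    obtain ⟨d, h1, h2, h3⟩ := h c hc.1.1 hc.1.2 hc.2
    exact ⟨d, by simp [h1, h2, (hP.right_mem _ h3).1], h3⟩
  · intro d _ c hc c' hc'
    have := hP.right_inj _ hc.2 _ hc'.2 rfl
    simpa using this

theorem rowCount_le_of_pairs' {D : Diagram} {r i k : ℕ}
    (h : ∀ d, i ≤ d → d < k → (r + 1, d) ∈ D → ∃ c, i ≤ c ∧ c < k ∧
      ((r, c), (r + 1, d)) ∈ rPairs D r) :
    rowCount D (r + 1) i k ≤ rowCount D r i k := by
  classical
  have hP := nestedPairs_rPairs D r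
  refine Finset.card_le_card_of_forall_subsingleton
    (fun d c => ((r, c), (r + 1, d)) ∈ rPairs D r) ?_ ?_
  · intro c hc
    simp only [Finset.mem_filter, Finset.mem_Ico] at hc
    obtain ⟨d, h1, h2, h3⟩ := h c hc.1.1 hc.1.2 hc.2
    exact ⟨d, by simp [h1, h2, (hP.left_mem _ h3).1], h3⟩
  · intro d _ c hc c' hc'
    have := hP.left_inj _ hc.2 _ hc'.2 rfl
    simpa using this

theorem IsPaired.exists_right {D : Diagram} {r c : ℕ} (h : IsPaired (rPairs D r) (r, c)) :
    ∃ d, c ≤ d ∧ ((r, c), (r + 1, d)) ∈ rPairs D r := by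
  have hP := nestedPairs_rPairs D r
  obtain ⟨⟨s, d⟩, hw | hw⟩ := h
  · have h1 := hP.right_mem _ hw
    have h2 := hP.le _ hw
    simp only at h1 h2
    obtain rfl := h1.2
    exact ⟨d, h2, hw⟩
  · have h1 := hP.right_mem _ hw
    simp at h1

theorem IsPaired.exists_left {D : Diagram} {r d : ℕ} (h : IsPaired (rPairs D r) (r + 1, d)) :
    ∃ c, c ≤ d ∧ ((r, c), (r + 1, d)) ∈ rPairs D r := by
  have hP := nestedPairs_rPairs D r
  obtain ⟨⟨s, c⟩, hw | hw⟩ := h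
  · have h1 := hP.left_mem _ hw
    simp at h1
  · have h1 := hP.left_mem _ hw
    have h2 := hP.le _ hw
    simp only at h1 h2
    obtain rfl := h1.2
    exact ⟨c, h2, hw⟩

/-- No pair encloses the column of an unpaired cell. -/
theorem not_straddle {D : Diagram} {r s k c d : ℕ} (hs : s = r ∨ s = r + 1) (hk : (s, k) ∈ D)
    (hu : ¬ IsPaired (rPairs D r) (s, k)) (hq : ((r, c), (r + 1, d)) ∈ rPairs D r) :
    k < c ∨ d < k := by
  by_contra hcon
  push Not at hcon
  obtain ⟨q', hq', h | h, -⟩ := (nestedPairs_rPairs D r).nested _ hq (s, k) hk hs hcon.1 hcon.2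
  · exact hu ⟨q'.2, Or.inl (h ▸ hq')⟩
  · exact hu ⟨q'.1, Or.inr (h ▸ hq')⟩

/-! ### Moves in the diagram crystal -/

/-- `E` arises from `D` by moving the cell `(r, c)` down, and the two rows are such that this is
the move made by `f_r` in `D` and by `e_r` in `E`: expressed by counting cells, the condition is
symmetric in `D` and `E`. -/
structure CrystalMove (D E : Diagram) (r c : ℕ) : Prop where
  mem : (r, c) ∈ D
  notMem : (r + 1, c) ∉ D
  eq : ∀ z, z ∈ E ↔ z = (r + 1, c) ∨ (z ∈ D ∧ z ≠ (r, c))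
  left : ∀ i ≤ c, rowCount D r i c ≤ rowCount D (r + 1) i c
  right : ∀ k, rowCount D (r + 1) (c + 1) k ≤ rowCount D r (c + 1) k

theorem CrystalMove.mem_iff {D E : Diagram} {r c : ℕ} (h : CrystalMove D E r c) (z : ℕ × ℕ) :
    z ∈ D ↔ z = (r, c) ∨ (z ∈ E ∧ z ≠ (r + 1, c)) := by
  rw [h.eq]
  by_cases h1 : z = (r, c)
  · simp [h1, h.mem]
  · by_cases h2 : z = (r + 1, c)
    · simp [h2, h.notMem]
    · simp [h1, h2]

theorem CrystalMove.mem_iff_of_ne {D E : Diagram} {r c : ℕ} (h : CrystalMove D E r c)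
    {s d : ℕ} (hd : d ≠ c) : (s, d) ∈ E ↔ (s, d) ∈ D := by
  rw [h.eq]
  simp [hd]

theorem CrystalMove.rowCount_left {D E : Diagram} {r c : ℕ} (h : CrystalMove D E r c)
    {s i k : ℕ} (hk : k ≤ c) : rowCount E s i k = rowCount D s i k :=
  rowCount_congr fun _ _ _ => h.mem_iff_of_ne (by omega)

theorem CrystalMove.rowCount_right {D E : Diagram} {r c : ℕ} (h : CrystalMove D E r c)
    {s i k : ℕ} (hi : c < i) : rowCount E s i k = rowCount D s i k :=
  rowCount_congr fun _ _ _ => h.mem_iff_of_ne (by omega)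

theorem mem_unpairedCols {D : Diagram} {r s c : ℕ} :
    c ∈ unpairedCols D r s ↔ (s, c) ∈ D ∧ ¬ IsPaired (rPairs D r) (s, c) := by
  unfold unpairedCols
  simp only [Finset.mem_image, Finset.mem_filter, Prod.exists, exists_eq_right]
  constructor
  · rintro ⟨a, h1, rfl, h2⟩
    exact ⟨h1, h2⟩
  · rintro ⟨h1, h2⟩
    exact ⟨s, h1, rfl, h2⟩

theorem rowCount_le_left {D : Diagram} {r s c i : ℕ} (hs : s = r ∨ s = r + 1) (hc : (s, c) ∈ D)
    (hu : ¬ IsPaired (rPairs D r) (s, c))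
    (hp : ∀ j < c, (r, j) ∈ D → IsPaired (rPairs D r) (r, j)) :
    rowCount D r i c ≤ rowCount D (r + 1) i c := by
  refine rowCount_le_of_pairs fun j h1 h2 h3 => ?_
  obtain ⟨d, h4, h5⟩ := (hp j h2 h3).exists_right
  exact ⟨d, by omega, by have := not_straddle hs hc hu h5; omega, h5⟩

theorem rowCount_le_right {D : Diagram} {r s c k : ℕ} (hs : s = r ∨ s = r + 1) (hc : (s, c) ∈ D)
    (hu : ¬ IsPaired (rPairs D r) (s, c))
    (hp : ∀ j, c < j → (r + 1, j) ∈ D → IsPaired (rPairs D r) (r + 1, j)) :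
    rowCount D (r + 1) (c + 1) k ≤ rowCount D r (c + 1) k := by
  refine rowCount_le_of_pairs' fun j h1 h2 h3 => ?_
  obtain ⟨d, h4, h5⟩ := (hp j (by omega) h3).exists_left
  have := not_straddle hs hc hu h5
  exact ⟨d, by omega, by omega, h5⟩

theorem crystalMove_of_diagramLower {D E : Diagram} {r : ℕ} (h : diagramLower r D = some E) :
    ∃ c, CrystalMove D E r c := by
  unfold diagramLower at h
  split_ifs at h with hne
  set c := (unpairedCols D r r).min' hne with hc
  obtain ⟨h1, h2⟩ := mem_unpairedCols.1 ((unpairedCols D r r).min'_mem hne)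
  rw [← hc] at h1 h2
  have hE := (Option.some.inj h).symm
  refine ⟨c, h1, fun h3 => ?_, fun z => by simp [hE, and_comm], fun i _ => ?_, fun k => ?_⟩
  · by_cases h4 : IsPaired (rPairs D r) (r + 1, c)
    · obtain ⟨d, h5, h6⟩ := h4.exists_left
      have := not_straddle (Or.inl rfl) h1 h2 h6
      omega
    · exact lt_irrefl _ (lt_of_not_isPaired h1 h3 h2 h4)
  · refine rowCount_le_left (Or.inl rfl) h1 h2 fun j hj hD => ?_
    by_contra hcon
    have := (unpairedCols D r r).min'_le j (mem_unpairedCols.2 ⟨hD, hcon⟩)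
    omega
  · refine rowCount_le_right (Or.inl rfl) h1 h2 fun j hj hD => ?_
    by_contra hcon
    have := lt_of_not_isPaired h1 hD h2 hcon
    omega

theorem crystalMove_of_diagramRaise {D E : Diagram} {r : ℕ} (h : diagramRaise r D = some E) :
    ∃ c, CrystalMove E D r c := by
  unfold diagramRaise at h
  split_ifs at h with hne
  set c := (unpairedCols D r (r + 1)).max' hne with hc
  obtain ⟨h1, h2⟩ := mem_unpairedCols.1 ((unpairedCols D r (r + 1)).max'_mem hne)
  rw [← hc] at h1 h2
  have hE := (Option.some.inj h).symm
  have hno : (r, c) ∉ D := by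
    intro h3
    by_cases h4 : IsPaired (rPairs D r) (r, c)
    · obtain ⟨d, h5, h6⟩ := h4.exists_right
      have := not_straddle (Or.inr rfl) h1 h2 h6
      omega
    · exact lt_irrefl _ (lt_of_not_isPaired h3 h1 h4 h2)
  have hmem : ∀ s d, d ≠ c → ((s, d) ∈ E ↔ (s, d) ∈ D) := by
    intro s d hd
    simp [hE, hd]
  refine ⟨c, by simp [hE], by simp [hE], fun z => ?_, fun i _ => ?_, fun k => ?_⟩
  · rw [hE]
    by_cases h3 : z = (r + 1, c)
    · simp [h3, h1]
    · by_cases h4 : z = (r, c)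
      · simp [h4, hno]
      · simp [h3, h4]
  · rw [rowCount_congr fun d _ hd => hmem r d (by omega),
      rowCount_congr fun d _ hd => hmem (r + 1) d (by omega)]
    refine rowCount_le_left (Or.inr rfl) h1 h2 fun j hj hD => ?_
    by_contra hcon
    have := lt_of_not_isPaired hD h1 hcon h2
    omega
  · rw [rowCount_congr fun d hd _ => hmem r d (by omega),
      rowCount_congr fun d hd _ => hmem (r + 1) d (by omega)]
    refine rowCount_le_right (Or.inr rfl) h1 h2 fun j hj hD => ?_
    by_contra hcon
    have := (unpairedCols D r (r + 1)).le_max' j (mem_unpairedCols.2 ⟨hD, hcon⟩)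
    omega

theorem rowCount_le_of_diagramRaise_eq_none {D : Diagram} {r : ℕ} (h : diagramRaise r D = none)
    (k : ℕ) : rowCount D (r + 1) 0 k ≤ rowCount D r 0 k := by
  unfold diagramRaise at h
  split_ifs at h with hne
  refine rowCount_le_of_pairs' fun d _ hd hD => ?_
  have hp : IsPaired (rPairs D r) (r + 1, d) := by
    by_contra hcon
    exact hne ⟨d, mem_unpairedCols.2 ⟨hD, hcon⟩⟩
  obtain ⟨c, h1, h2⟩ := hp.exists_left
  exact ⟨c, by omega, by omega, h2⟩

/-- No three cells with strictly increasing rows and weakly increasing columns. -/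
def NoLongDescent (D : Diagram) : Prop :=
  ∀ r₁ r₂ r₃ c₁ c₂ c₃, (r₁, c₁) ∈ D → (r₂, c₂) ∈ D → (r₃, c₃) ∈ D → r₁ < r₂ → r₂ < r₃ →
    c₁ ≤ c₂ → c₂ ≤ c₃ → False

theorem CrystalMove.exists_left {D E : Diagram} {r c i : ℕ} (h : CrystalMove D E r c)
    (hi : i < c) (hD : (r, i) ∈ D) : ∃ j, i ≤ j ∧ j < c ∧ (r + 1, j) ∈ D := by
  have h1 := h.left i hi.le
  exact rowCount_pos_iff.1 (lt_of_lt_of_le (rowCount_pos_iff.2 ⟨i, le_rfl, hi, hD⟩) h1)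

theorem CrystalMove.exists_right {D E : Diagram} {r c k : ℕ} (h : CrystalMove D E r c)
    (hk : c < k) (hD : (r + 1, k) ∈ D) : ∃ j, c < j ∧ j ≤ k ∧ (r, j) ∈ D := by
  have h1 := h.right (k + 1)
  obtain ⟨j, h2, h3, h4⟩ := rowCount_pos_iff.1
    (lt_of_lt_of_le (rowCount_pos_iff.2 ⟨k, by omega, by omega, hD⟩) h1)
  exact ⟨j, by omega, by omega, h4⟩

theorem CrystalMove.noLongDescent {D E : Diagram} {r c : ℕ} (h : CrystalMove D E r c)
    (hD : NoLongDescent D) : NoLongDescent E := by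
  intro r₁ r₂ r₃ c₁ c₂ c₃ h1 h2 h3 h12 h23 k12 k23
  have hm := h.mem
  rw [h.eq] at h1 h2 h3
  simp only [Prod.mk.injEq, ne_eq] at h1 h2 h3
  rcases h1 with ⟨rfl, rfl⟩ | ⟨h1, h1'⟩
  · exact hD _ _ _ _ _ _ hm (h2.resolve_left (by omega)).1 (h3.resolve_left (by omega)).1
      (by omega) h23 k12 k23
  rcases h2 with ⟨rfl, rfl⟩ | ⟨h2, h2'⟩
  · have h3' := (h3.resolve_left (by omega)).1
    by_cases hr : r₁ = r
    · subst hr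
      obtain ⟨j, hj1, hj2, hj3⟩ := h.exists_left (lt_of_le_of_ne k12 fun e => h1' ⟨rfl, e⟩) h1
      exact hD _ _ _ _ _ _ h1 hj3 h3' (by omega) h23 hj1 (by omega)
    · exact hD _ _ _ _ _ _ h1 hm h3' (by omega) (by omega) k12 k23
  rcases h3 with ⟨rfl, rfl⟩ | ⟨h3, -⟩
  · by_cases hr : r₂ = r
    · subst hr
      obtain ⟨j, hj1, hj2, hj3⟩ := h.exists_left (lt_of_le_of_ne k23 fun e => h2' ⟨rfl, e⟩) h2
      exact hD _ _ _ _ _ _ h1 h2 hj3 h12 (by omega) k12 hj1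
    · exact hD _ _ _ _ _ _ h1 h2 hm h12 (by omega) k12 k23
  exact hD _ _ _ _ _ _ h1 h2 h3 h12 h23 k12 k23

theorem CrystalMove.noLongDescent_symm {D E : Diagram} {r c : ℕ} (h : CrystalMove D E r c)
    (hE : NoLongDescent E) : NoLongDescent D := by
  intro r₁ r₂ r₃ c₁ c₂ c₃ h1 h2 h3 h12 h23 k12 k23
  have hm : (r + 1, c) ∈ E := (h.eq _).2 (Or.inl rfl)
  have lift : ∀ {s d}, (s, d) ∈ D → ¬ (s = r ∧ d = c) → (s, d) ∈ E := fun {s d} hz hne =>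
    (h.eq _).2 (Or.inr ⟨hz, by simpa using hne⟩)
  have key : ∀ {d}, (r + 1, d) ∈ D → c ≤ d → ∃ j, c ≤ j ∧ j ≤ d ∧ (r, j) ∈ E := by
    intro d hd hcd
    have hne : c ≠ d := fun e => h.notMem (e ▸ hd)
    obtain ⟨j, hj1, hj2, hj3⟩ := h.exists_right (lt_of_le_of_ne hcd hne) hd
    exact ⟨j, hj1.le, hj2, lift hj3 (by omega)⟩
  by_cases e1 : r₁ = r ∧ c₁ = c
  · obtain ⟨rfl, rfl⟩ := e1
    have h2' := lift h2 (by omega)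
    have h3' := lift h3 (by omega)
    by_cases hr : r₂ = r₁ + 1
    · subst hr
      obtain ⟨j, hj1, hj2, hj3⟩ := key h2 k12
      exact hE _ _ _ _ _ _ hj3 h2' h3' (by omega) h23 hj2 k23
    · exact hE _ _ _ _ _ _ hm h2' h3' (by omega) h23 k12 k23
  by_cases e2 : r₂ = r ∧ c₂ = c
  · obtain ⟨rfl, rfl⟩ := e2
    have h1' := lift h1 (by omega)
    have h3' := lift h3 (by omega)
    by_cases hr : r₃ = r₂ + 1
    · subst hr
      obtain ⟨j, hj1, hj2, hj3⟩ := key h3 k23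
      exact hE _ _ _ _ _ _ h1' hj3 h3' h12 h23 (by omega) hj2
    · exact hE _ _ _ _ _ _ h1' hm h3' (by omega) (by omega) k12 k23
  have h1' := lift h1 e1
  have h2' := lift h2 e2
  by_cases e3 : r₃ = r ∧ c₃ = c
  · obtain ⟨rfl, rfl⟩ := e3
    exact hE _ _ _ _ _ _ h1' h2' hm h12 (by omega) k12 k23
  exact hE _ _ _ _ _ _ h1' h2' (lift h3 e3) h12 h23 k12 k23

/-- A selection of a cell in each of the columns `0, …, m - 1`, the rows weakly decreasing from
left to right. -/
def HasPath (m : ℕ) (D : Diagram) : Prop :=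
  ∃ π : ℕ → ℕ, Antitone π ∧ ∀ c < m, (π c, c) ∈ D

theorem CrystalMove.hasPath {D E : Diagram} {r c m : ℕ} (h : CrystalMove D E r c)
    (hD : HasPath m D) : HasPath m E := by
  obtain ⟨π, hπ, hmem⟩ := hD
  by_cases hr : c < m ∧ π c = r
  · obtain ⟨hc, hr⟩ := hr
    refine ⟨fun j => if j ≤ c ∧ π j = r then r + 1 else π j, fun i j hij => ?_, fun j hj => ?_⟩
    · have h1 := hπ hij
      rcases le_total j c with hjc | hjc
      · have h2 := hπ hjc
        dsimp only
        split_ifs <;> omega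
      · have h2 := hπ hjc
        dsimp only
        split_ifs <;> omega
    · dsimp only
      split_ifs with hjr
      · rcases eq_or_lt_of_le hjr.1 with rfl | hlt
        · exact (h.eq _).2 (Or.inl rfl)
        · rw [h.mem_iff_of_ne hlt.ne]
          -- The path stays in row `r` from column `j` to column `c`.
          have h1 : rowCount D r j c = c - j := rowCount_eq_of_forall fun d h1 h2 => by
            have h3 := hπ h1
            have h4 := hπ h2.le
            have h5 := hmem d (by omega)
            rwa [show π d = r by omega] at h5
          exact mem_of_rowCount_eq (h1 ▸ h.left j hjr.1) le_rfl hlt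
      · refine (h.eq _).2 (Or.inr ⟨hmem j hj, fun e => hjr ?_⟩)
        simp only [Prod.mk.injEq] at e
        omega
  · refine ⟨π, hπ, fun j hj => (h.eq _).2 (Or.inr ⟨hmem j hj, fun e => hr ?_⟩)⟩
    simp only [Prod.mk.injEq] at e
    rw [← e.2]
    exact ⟨hj, e.1⟩

theorem CrystalMove.hasPath_symm {D E : Diagram} {r c m : ℕ} (h : CrystalMove D E r c)
    (hE : HasPath m E) : HasPath m D := by
  obtain ⟨π, hπ, hmem⟩ := hE
  by_cases hr : π c = r + 1
  · refine ⟨fun j => if c ≤ j ∧ π j = r + 1 then r else π j, fun i j hij => ?_, fun j hj => ?_⟩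
    · have h1 := hπ hij
      rcases le_total i c with hjc | hjc
      · have h2 := hπ hjc
        dsimp only
        split_ifs <;> omega
      · have h2 := hπ hjc
        dsimp only
        split_ifs <;> omega
    · dsimp only
      split_ifs with hjr
      · rcases eq_or_lt_of_le hjr.1 with rfl | hlt
        · exact h.mem
        · have h1 : rowCount D (r + 1) (c + 1) (j + 1) = j + 1 - (c + 1) :=
            rowCount_eq_of_forall fun d h1 h2 => by
              have h3 := hπ (show c ≤ d by omega)
              have h4 := hπ (show d ≤ j by omega)
              have h5 := hmem d (by omega)
              rwa [show π d = r + 1 by omega, h.mem_iff_of_ne (by omega)] at h5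
          exact mem_of_rowCount_eq (h1 ▸ h.right (j + 1)) (by omega) (by omega)
      · refine (h.mem_iff _).2 (Or.inr ⟨hmem j hj, fun e => hjr ?_⟩)
        simp only [Prod.mk.injEq] at e
        omega
  · refine ⟨π, hπ, fun j hj => (h.mem_iff _).2 (Or.inr ⟨hmem j hj, fun e => hr ?_⟩)⟩
    simp only [Prod.mk.injEq] at e
    rw [← e.2, e.1]

/-- The number of cells in column `c`. -/
def colCard (D : Diagram) (c : ℕ) : ℕ := (D.filter fun z => z.2 = c).card

theorem CrystalMove.colCard_eq {D E : Diagram} {r c : ℕ} (h : CrystalMove D E r c) (d : ℕ) :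
    colCard E d = colCard D d := by
  have hE : E = insert (r + 1, c) (D.erase (r, c)) := by
    ext z
    rw [h.eq]
    simp [and_comm]
  unfold colCard
  by_cases hd : c = d
  · subst hd
    rw [hE, Finset.filter_insert, if_pos rfl, Finset.card_insert_of_notMem (by simp [h.notMem]),
      Finset.filter_erase, Finset.card_erase_of_mem (by simp [h.mem])]
    have : 0 < (D.filter fun z => z.2 = c).card := Finset.card_pos.2 ⟨(r, c), by simp [h.mem]⟩
    omega
  · congr 1
    ext ⟨s, k⟩
    simp only [Finset.mem_filter]
    refine and_congr_left fun hk => ?_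
    have hk' : k = d := hk
    exact h.mem_iff_of_ne (by omega)

/-! ### Posets, arrays and alignments -/

section Alignments

variable {P : Type*} [PartialOrder P]

/-- The form in which `(3+1)`-freeness is used: for a `3`-chain `x < y < z`, every element is
below `z` or above `x`. -/
theorem SumFree.lt_or_lt (hP : SumFree 3 1 P) {x y z : P} (hxy : x < y) (hyz : y < z) (w : P) :
    w < z ∨ x < w := by
  by_contra hcon
  push Not at hcon
  obtain ⟨h1, h2⟩ := hcon
  have wx : ¬ w ≤ x := fun h => h1 (h.trans_lt (hxy.trans hyz))
  have wy : ¬ w ≤ y := fun h => h1 (h.trans_lt hyz)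
  have wz : ¬ w ≤ z := fun h => h.lt_or_eq.elim h1 fun e => h2 (e ▸ hxy.trans hyz)
  have xw : ¬ x ≤ w := fun h => h.lt_or_eq.elim h2 fun e => wx e.symm.le
  have yw : ¬ y ≤ w := fun h => h2 (hxy.trans_le h)
  have zw : ¬ z ≤ w := fun h => h2 ((hxy.trans hyz).trans_le h)
  have hmono : StrictMono ![x, y, z] := by
    rw [Fin.strictMono_iff_lt_succ]
    intro i
    fin_cases i
    · exact hxy
    · exact hyz
  have h3 : ∀ i, ¬ ![x, y, z] i ≤ w := by
    intro i
    fin_cases i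
    exacts [xw, yw, zw]
  have h4 : ∀ i, ¬ w ≤ ![x, y, z] i := by
    intro i
    fin_cases i
    exacts [wx, wy, wz]
  refine hP.false (OrderEmbedding.ofMapLEIff (Sum.elim ![x, y, z] fun _ => w) ?_)
  rintro (a | a) (b | b)
  · simp only [Sum.elim_inl, Sum.inl_le_inl_iff]
    exact hmono.le_iff_le
  · simpa using h3 a
  · simpa using h4 b
  · simp only [Sum.elim_inr, le_refl, Sum.inr_le_inr_iff, true_iff]
    exact (Subsingleton.elim a b).le

theorem IsPArray.exists_of_le {A : P → ℕ × ℕ} (hA : IsPArray A) {x : P} {k : ℕ}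
    (hk : k ≤ (A x).2) : ∃ y, A y = ((A x).1, k) ∧ y ≤ x := by
  suffices H : ∀ n x, (A x).2 = k + n → ∃ y, A y = ((A x).1, k) ∧ y ≤ x from
    H ((A x).2 - k) x (by omega)
  intro n
  induction n with
  | zero => exact fun x hx => ⟨x, Prod.ext rfl hx, le_rfl⟩
  | succ n ih =>
    intro x hx
    obtain ⟨y, hy, hyx⟩ := hA.2 x (A x).1 (k + n) (Prod.ext rfl hx)
    obtain ⟨z, hz, hzy⟩ := ih y (by rw [hy])
    exact ⟨z, by rw [hz, hy], hzy.trans hyx.le⟩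

theorem IsPArray.lt_of_lt {A : P → ℕ × ℕ} (hA : IsPArray A) {x y : P} (hr : (A x).1 = (A y).1)
    (h : (A x).2 < (A y).2) : x < y := by
  obtain ⟨z, hz, hzy⟩ := hA.exists_of_le h.le
  obtain rfl : z = x := hA.1 (by rw [hz, ← hr])
  exact hzy.lt_of_ne fun e => by rw [e] at h; exact h.false

theorem IsPArray.lt_iff {A : P → ℕ × ℕ} (hA : IsPArray A) {x y : P} (hr : (A x).1 = (A y).1) :
    (A x).2 < (A y).2 ↔ x < y := by
  refine ⟨hA.lt_of_lt hr, fun h => ?_⟩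
  rcases lt_trichotomy (A x).2 (A y).2 with h1 | h1 | h1
  · exact h1
  · exact absurd (hA.1 (Prod.ext hr h1)) h.ne
  · exact absurd (hA.lt_of_lt hr.symm h1) h.asymm

variable [Fintype P]

theorem preAlign_of_ne {A : P → ℕ × ℕ} {r : ℕ} {x : P} (h : (A x).1 ≠ r) :
    preAlign A r x = (A x).2 := by
  rw [preAlign, if_neg h]

theorem preAlign_le_iff {A : P → ℕ × ℕ} {r n : ℕ} {x : P} (h : (A x).1 = r) :
    preAlign A r x ≤ n ↔ (∀ y, (A y).1 = r + 1 → y < x → (A y).2 + 1 ≤ n) ∧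
      ∀ y, (A y).1 = r → (A y).2 < (A x).2 → preAlign A r y + 1 ≤ n := by
  rw [preAlign, if_pos h, max_le_iff, Finset.sup_le_iff, Finset.sup_le_iff]
  simp

theorem lt_preAlign_of_lt {A : P → ℕ × ℕ} {r : ℕ} {x y : P} (hx : (A x).1 = r)
    (hy : (A y).1 = r + 1) (h : y < x) : (A y).2 < preAlign A r x :=
  ((preAlign_le_iff hx).1 le_rfl).1 y hy h

theorem preAlign_lt_preAlign {A : P → ℕ × ℕ} {r : ℕ} {x y : P} (hx : (A x).1 = r)
    (hy : (A y).1 = r) (h : (A y).2 < (A x).2) : preAlign A r y < preAlign A r x :=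
  ((preAlign_le_iff hx).1 le_rfl).2 y hy h

/-- A property of placements that holds for the pre-alignment and survives the shift of any
movable entry holds for the alignment. -/
theorem align_induction {A : P → ℕ × ℕ} {r : ℕ} {Inv : (P → ℕ) → Prop}
    (h0 : Inv (preAlign A r))
    (hs : ∀ C C' x, Inv C → Movable A r C x → C' x = C x + 1 → (∀ y, y ≠ x → C' y = C y) →
      Inv C') : Inv (align A r) := by
  classical
  unfold align
  generalize Nat.find (exists_alignStep_stable A r (preAlign A r)) = k
  induction k with
  | zero => exact h0
  | succ k ih =>
    rw [Function.iterate_succ_apply']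
    generalize (alignStep A r)^[k] (preAlign A r) = C at ih ⊢
    unfold alignStep
    split_ifs with h
    · exact hs _ _ h.choose ih h.choose_spec.1 (by simp)
        fun y hy => Function.update_of_ne hy _ _
    · exact ih

theorem not_movable_align (A : P → ℕ × ℕ) (r : ℕ) (x : P) : ¬ Movable A r (align A r) x := by
  classical
  exact Nat.find_spec (exists_alignStep_stable A r (preAlign A r)) x

/-- What the alignment `C` of a two-row tableau `T` looks like: the first row occupies an initial
segment of the columns, and each entry of the second row is as far to the right as the first
row and the other entries of the second row permit. -/
structure TableauAlignment (T : P → ℕ × ℕ) (C : P → ℕ) : Prop where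
  row_le : ∀ x, (T x).1 ≤ 1
  lt_iff : ∀ x y, (T x).1 = (T y).1 → (C x < C y ↔ x < y)
  inj : ∀ x y, (T x).1 = (T y).1 → C x = C y → x = y
  exists_upper : ∀ x, ∀ c ≤ C x, ∃ a, (T a).1 = 0 ∧ C a = c
  not_lt : ∀ b a, (T b).1 = 1 → (T a).1 = 0 → C a ≤ C b → ¬ b < a
  lt_or : ∀ b a, (T b).1 = 1 → (T a).1 = 0 → C a = C b + 1 →
    b < a ∨ ∃ b', (T b').1 = 1 ∧ C b' = C b + 1

theorem IsTwoRowTableau.row_le {T : P → ℕ × ℕ} (hT : IsTwoRowTableau T) (x : P) :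
    (T x).1 ≤ 1 := by
  by_contra hcon
  have := hT.2 (T x).1 (by omega)
  rw [arrayWt, Finset.card_eq_zero] at this
  simpa using congrArg (x ∈ ·) this

theorem preAlign_tableau {T : P → ℕ × ℕ} (hT : IsTwoRowTableau T) (x : P) :
    preAlign T 0 x = (T x).2 := by
  have hA := hT.1.1
  by_cases hx : (T x).1 = 0
  swap
  · exact preAlign_of_ne hx
  suffices H : ∀ n x, (T x).1 = 0 → (T x).2 = n → preAlign T 0 x = n from H _ x hx rfl
  intro n
  induction n using Nat.strong_induction_on with
  | _ n ih =>
  intro x hx hn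
  refine le_antisymm ((preAlign_le_iff hx).2 ⟨fun y hy hyx => ?_, fun y hy hyx => ?_⟩) ?_
  · by_contra hcon
    obtain ⟨a, ha, hya⟩ := hT.1.2 y 0 (T y).2 (Prod.ext (by rw [hy]) rfl)
    refine hya (hyx.trans_le ?_)
    obtain ⟨z, hz, hza⟩ := hA.exists_of_le (x := a) (k := (T x).2) (by rw [ha]; omega)
    obtain rfl : z = x := hA.1 (by rw [hz, ha]; exact Prod.ext hx.symm rfl)
    exact hza
  · rw [ih _ (by omega) y hy rfl]
    omega
  · rcases n with _ | n
    · exact Nat.zero_le _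
    · obtain ⟨y, hy, -⟩ := hA.2 x 0 n (Prod.ext hx hn)
      have h1 := preAlign_lt_preAlign hx (by rw [hy]) (by rw [hy]; simp; omega)
      rw [ih n (by omega) y (by rw [hy]) (by rw [hy])] at h1
      exact h1

theorem IsTwoRowTableau.tableauAlignment {T : P → ℕ × ℕ} (hT : IsTwoRowTableau T) :
    TableauAlignment T (align T 0) := by
  classical
  have hA := hT.1.1
  have hrow := hT.row_le
  have inRows : ∀ x, InRows T 0 x := fun x => by
    have := hrow x
    unfold InRows
    omega
  -- The upper row does not move, and the lower row stays weakly to the left of entries of the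
  -- upper row that are not greater.
  have inv : (∀ x, (T x).1 = 0 → align T 0 x = (T x).2) ∧
      (∀ x y, (T x).1 = 1 → (T y).1 = 1 → x < y → align T 0 x < align T 0 y) ∧
      ∀ x, (T x).1 = 1 → ∃ a, (T a).1 = 0 ∧ align T 0 a = align T 0 x ∧ ¬ x < a := by
    refine align_induction (Inv := fun C => (∀ x, (T x).1 = 0 → C x = (T x).2) ∧
      (∀ x y, (T x).1 = 1 → (T y).1 = 1 → x < y → C x < C y) ∧
      ∀ x, (T x).1 = 1 → ∃ a, (T a).1 = 0 ∧ C a = C x ∧ ¬ x < a) ?_ ?_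
    · simp only [preAlign_tableau hT]
      refine ⟨fun _ _ => trivial, fun x y hx hy h => (hA.lt_iff (hx.trans hy.symm)).2 h,
        fun x hx => ?_⟩
      obtain ⟨a, ha, hxa⟩ := hT.1.2 x 0 (T x).2 (Prod.ext (by rw [hx]) rfl)
      exact ⟨a, by rw [ha], by rw [ha], hxa⟩
    · rintro C C' x ⟨h1, h2, h3⟩ ⟨-, ⟨z, -, hz⟩, hno⟩ hx' hne'
      have hno' : ∀ y, C y = C x + 1 → ¬ x < y := fun y => hno y (inRows y)
      obtain ⟨a, ha, haz⟩ : ∃ a, (T a).1 = 0 ∧ C a = C x + 1 := by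
        by_cases hz0 : (T z).1 = 0
        · exact ⟨z, hz0, hz⟩
        · obtain ⟨a, ha, haz, -⟩ := h3 z (by have := hrow z; omega)
          exact ⟨a, ha, haz.trans hz⟩
      have hx : (T x).1 = 1 := by
        by_contra hx
        have hx0 : (T x).1 = 0 := by have := hrow x; omega
        refine hno' a haz (hA.lt_of_lt (hx0.trans ha.symm) ?_)
        rw [← h1 a ha, ← h1 x hx0]
        omega
      refine ⟨fun y hy => ?_, fun y w hy hw hyw => ?_, fun y hy => ?_⟩
      · have : y ≠ x := fun e => by rw [e] at hy; omega
        rw [hne' y this]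
        exact h1 y hy
      · have h4 := h2 y w hy hw hyw
        by_cases hyx : y = x
        · subst hyx
          have := hno' w
          rw [hne' w hyw.ne', hx']
          by_contra hcon
          exact this (by omega) hyw
        · rw [hne' y hyx]
          by_cases hwx : w = x
          · subst hwx
            omega
          · rwa [hne' w hwx]
      · by_cases hyx : y = x
        · subst hyx
          refine ⟨a, ha, ?_, hno' a haz⟩
          rw [hne' a fun e => by rw [e] at ha; omega, haz, hx']
        · obtain ⟨b, hb, hby, hyb⟩ := h3 y hy
          refine ⟨b, hb, ?_, hyb⟩
          rw [hne' b fun e => by rw [e] at hb; omega, hne' y hyx, hby]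
  obtain ⟨h1, h2, h3⟩ := inv
  have hcase : ∀ x, (T x).1 = 0 ∨ (T x).1 = 1 := fun x => by have := hrow x; omega
  have hmono : ∀ x y, (T x).1 = (T y).1 → x < y → align T 0 x < align T 0 y := by
    intro x y hxy h
    rcases hcase x with hx | hx
    · rw [h1 x hx, h1 y (hxy ▸ hx)]
      exact (hA.lt_iff hxy).2 h
    · exact h2 x y hx (hxy ▸ hx) h
  have htotal : ∀ x y, (T x).1 = (T y).1 → x < y ∨ x = y ∨ y < x := by
    intro x y hxy
    rcases lt_trichotomy (T x).2 (T y).2 with h | h | h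
    · exact Or.inl (hA.lt_of_lt hxy h)
    · exact Or.inr (Or.inl (hA.1 (Prod.ext hxy h)))
    · exact Or.inr (Or.inr (hA.lt_of_lt hxy.symm h))
  have hinj : ∀ x y, (T x).1 = (T y).1 → align T 0 x = align T 0 y → x = y := by
    intro x y hxy he
    rcases htotal x y hxy with h | h | h
    · exact absurd (hmono x y hxy h) (by omega)
    · exact h
    · exact absurd (hmono y x hxy.symm h) (by omega)
  refine ⟨hrow, fun x y hxy => ⟨fun h => ?_, hmono x y hxy⟩, hinj, fun x c hc => ?_,
    fun b a hb ha hab hba => ?_, fun b a hb ha hab => ?_⟩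
  · rcases htotal x y hxy with h' | h' | h'
    · exact h'
    · exact absurd h (by rw [h']; exact lt_irrefl _)
    · exact absurd (hmono y x hxy.symm h') (by omega)
  · obtain ⟨a, ha, hca⟩ : ∃ a, (T a).1 = 0 ∧ c ≤ (T a).2 := by
      rcases hcase x with hx | hx
      · exact ⟨x, hx, by rwa [← h1 x hx]⟩
      · obtain ⟨a, ha, hax, -⟩ := h3 x hx
        exact ⟨a, ha, by rw [← h1 a ha, hax]; exact hc⟩
    obtain ⟨y, hy, -⟩ := hA.exists_of_le hca
    have hy0 : (T y).1 = 0 := by rw [hy, ha]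
    exact ⟨y, hy0, by rw [h1 y hy0, hy]⟩
  · obtain ⟨a', ha', hab', hba'⟩ := h3 b hb
    refine hba' (hba.trans_le ?_)
    rcases htotal a a' (ha.trans ha'.symm) with h | h | h
    · exact h.le
    · exact h.le
    · have := hmono a' a (ha'.trans ha.symm) h
      omega
  · have := not_movable_align T 0 b
    unfold Movable at this
    push Not at this
    obtain ⟨y, -, hy, hby⟩ := this (inRows b) ⟨a, inRows a, hab⟩
    rcases hcase y with hy0 | hy1
    · obtain rfl := hinj y a (hy0.trans ha.symm) (hy.trans hab.symm)
      exact Or.inl hby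
    · exact Or.inr ⟨y, hy1, hy⟩

end Alignments

/-! ### Columns with one or two cells -/

/-- Column `c` of `D` consists of the single cell `(s, c)`. -/
def OneCell (D : Diagram) (c s : ℕ) : Prop := ∀ s', (s', c) ∈ D ↔ s' = s

/-- Column `c` of `D` consists of the cells `(s, c)` and `(t, c)`, where `s < t`. -/
def TwoCells (D : Diagram) (c s t : ℕ) : Prop := s < t ∧ ∀ s', (s', c) ∈ D ↔ s' = s ∨ s' = t

theorem exists_oneCell {D : Diagram} {c : ℕ} (h : colCard D c = 1) : ∃ s, OneCell D c s := by
  obtain ⟨z, hz⟩ := Finset.card_eq_one.1 h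
  have hz' : ∀ w, w ∈ D ∧ w.2 = c ↔ w = z := fun w => by
    simpa using congrArg (w ∈ ·) hz
  refine ⟨z.1, fun s' => ⟨fun h => by rw [← (hz' (s', c)).1 ⟨h, rfl⟩], ?_⟩⟩
  rintro rfl
  obtain ⟨h1, h2⟩ := (hz' z).2 rfl
  rwa [← h2]

theorem exists_twoCells {D : Diagram} {c : ℕ} (h : colCard D c = 2) :
    ∃ s t, TwoCells D c s t := by
  obtain ⟨z, w, hne, hz⟩ := Finset.card_eq_two.1 h
  have hz' : ∀ v, v ∈ D ∧ v.2 = c ↔ v = z ∨ v = w := fun v => by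
    simpa using congrArg (v ∈ ·) hz
  obtain ⟨h1, h2⟩ := (hz' z).2 (Or.inl rfl)
  obtain ⟨h3, h4⟩ := (hz' w).2 (Or.inr rfl)
  obtain ⟨a, c'⟩ := z
  obtain ⟨b, c''⟩ := w
  simp only at h2 h4
  subst h2 h4
  have key : ∀ s', (s', c'') ∈ D ↔ s' = a ∨ s' = b := fun s' => by
    simpa using hz' (s', c'')
  rcases lt_trichotomy a b with hab | hab | hab
  · exact ⟨a, b, hab, key⟩
  · exact absurd (by rw [hab]) hne
  · exact ⟨b, a, hab, fun s' => (key s').trans or_comm⟩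

theorem OneCell.topRow_eq {D : Diagram} {c s : ℕ} (h : OneCell D c s) : topRow D c = s := by
  have : {s' | (s', c) ∈ D} = {s} := by
    ext s'
    exact h s'
  rw [topRow, this, csInf_singleton]

theorem OneCell.botRow_eq {D : Diagram} {c s : ℕ} (h : OneCell D c s) : botRow D c = s := by
  have : {s' | (s', c) ∈ D} = {s} := by
    ext s'
    exact h s'
  rw [botRow, this, csSup_singleton]

theorem TwoCells.topRow_eq {D : Diagram} {c s t : ℕ} (h : TwoCells D c s t) :
    topRow D c = s := by
  have : {s' | (s', c) ∈ D} = {s, t} := by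
    ext s'
    exact h.2 s'
  rw [topRow, this, csInf_pair, inf_eq_left.2 h.1.le]

theorem TwoCells.botRow_eq {D : Diagram} {c s t : ℕ} (h : TwoCells D c s t) :
    botRow D c = t := by
  have : {s' | (s', c) ∈ D} = {s, t} := by
    ext s'
    exact h.2 s'
  rw [botRow, this, csSup_pair, sup_eq_right.2 h.1.le]

theorem TwoCells.otherRow_top {D : Diagram} {c s t : ℕ} (h : TwoCells D c s t) :
    otherRow D c s = t := by
  have : {s' | s' ≠ s ∧ (s', c) ∈ D} = {t} := by
    ext s'
    have := h.1
    simp only [Set.mem_ofPred_eq, h.2, Set.mem_singleton_iff]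
    omega
  rw [otherRow, this, csInf_singleton]

theorem TwoCells.otherRow_bot {D : Diagram} {c s t : ℕ} (h : TwoCells D c s t) :
    otherRow D c t = s := by
  have : {s' | s' ≠ t ∧ (s', c) ∈ D} = {s} := by
    ext s'
    have := h.1
    simp only [Set.mem_ofPred_eq, h.2, Set.mem_singleton_iff]
    omega
  rw [otherRow, this, csInf_singleton]

theorem TwoCells.rowAbove_eq {D : Diagram} {c s t r : ℕ} (h : TwoCells D c s t) (hs : s ≤ r) :
    rowAbove D c r = if t ≤ r then t else s := by
  have h1 := h.1
  split_ifs with ht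
  · have : {s' | s' ≤ r ∧ (s', c) ∈ D} = {s, t} := by
      ext s'
      simp only [Set.mem_ofPred_eq, h.2, Set.mem_insert_iff, Set.mem_singleton_iff]
      omega
    rw [rowAbove, this, csSup_pair, sup_eq_right.2 h.1.le]
  · have : {s' | s' ≤ r ∧ (s', c) ∈ D} = {s} := by
      ext s'
      simp only [Set.mem_ofPred_eq, h.2, Set.mem_singleton_iff]
      omega
    rw [rowAbove, this, csSup_singleton]

theorem TwoCells.le_of_noLongDescent {D : Diagram} {c s t r : ℕ} (h : TwoCells D (c + 1) s t)
    (hD : NoLongDescent D) (hr : (r, c) ∈ D) : s ≤ r := by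
  by_contra hcon
  exact hD r s t c (c + 1) (c + 1) hr ((h.2 s).2 (Or.inl rfl)) ((h.2 t).2 (Or.inr rfl))
    (by omega) h.1 (by omega) le_rfl

theorem TwoCells.ge_of_noLongDescent {D : Diagram} {c s t r : ℕ} (h : TwoCells D c s t)
    (hD : NoLongDescent D) (hr : (r, c + 1) ∈ D) : r ≤ t := by
  by_contra hcon
  exact hD s t r c c (c + 1) ((h.2 s).2 (Or.inl rfl)) ((h.2 t).2 (Or.inr rfl)) hr h.1
    (by omega) le_rfl (by omega)

section Fillings

theorem ne_of_row {P : Type*} {T : P → ℕ × ℕ} {a b : P} (ha : (T a).1 = 0) (hb : (T b).1 = 1) :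
    a ≠ b := fun e => by rw [e] at ha; omega

variable {P : Type*} [PartialOrder P]

/-! ### Relations between the columns of a two-row tableau -/

theorem TableauAlignment.cases {T : P → ℕ × ℕ} {C : P → ℕ} (h : TableauAlignment T C) (x : P) :
    (T x).1 = 0 ∨ (T x).1 = 1 := by
  have := h.row_le x
  omega

theorem TableauAlignment.column_cases {T : P → ℕ × ℕ} {C : P → ℕ} (h : TableauAlignment T C)
    {a : P} (ha : (T a).1 = 0) : (∀ x, C x = C a → x = a) ∨
      ∃ b, (T b).1 = 1 ∧ C b = C a ∧ ∀ x, C x = C a → x = a ∨ x = b := by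
  by_cases hb : ∃ b, (T b).1 = 1 ∧ C b = C a
  · obtain ⟨b, hb, hba⟩ := hb
    refine Or.inr ⟨b, hb, hba, fun x hx => ?_⟩
    rcases h.cases x with hx0 | hx1
    · exact Or.inl (h.inj x a (hx0.trans ha.symm) hx)
    · exact Or.inr (h.inj x b (hx1.trans hb.symm) (hx.trans hba.symm))
  · refine Or.inl fun x hx => ?_
    rcases h.cases x with hx0 | hx1
    · exact h.inj x a (hx0.trans ha.symm) hx
    · exact absurd ⟨x, hx1, hx⟩ hb

/-- An entry of the first row is below the entries of the second row that are two or more columns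
to the right. -/
theorem TableauAlignment.lt_of_add_two_le {T : P → ℕ × ℕ} {C : P → ℕ}
    (h : TableauAlignment T C) (hP : SumFree 3 1 P) {a b : P} (ha : (T a).1 = 0)
    (hb : (T b).1 = 1) (hab : C a + 2 ≤ C b) : a < b := by
  obtain ⟨a₁, ha₁, h1⟩ := h.exists_upper b (C a + 1) (by omega)
  obtain ⟨a₂, ha₂, h2⟩ := h.exists_upper b (C b) le_rfl
  have h3 := (h.lt_iff a a₁ (ha.trans ha₁.symm)).1 (by omega)
  have h4 := (h.lt_iff a₁ a₂ (ha₁.trans ha₂.symm)).1 (by omega)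
  exact (hP.lt_or_lt h3 h4 b).resolve_left (h.not_lt b a₂ hb ha₂ h2.le)

/-- Column `d` has two entries, and that of the second row of `T` is not greater than the entry
of the first row in the column before. -/
def LooseAt (T : P → ℕ × ℕ) (C : P → ℕ) (d : ℕ) : Prop :=
  ∃ a b, (T a).1 = 0 ∧ (T b).1 = 1 ∧ C a + 1 = d ∧ C b = d ∧ ¬ a < b

theorem TableauAlignment.not_looseAt {T : P → ℕ × ℕ} {C : P → ℕ} (h : TableauAlignment T C)
    (hP : SumFree 3 1 P) {a b : P} (hb : (T b).1 = 1) (ha : (T a).1 = 0) (hab : C b < C a)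
    (hlt : ¬ b < a) : ¬ LooseAt T C (C b) := by
  rintro ⟨a', b', ha', hb', h1, h2, h3⟩
  obtain rfl := h.inj b' b (hb'.trans hb.symm) h2
  obtain ⟨a₀, ha₀, h4⟩ := h.exists_upper b' (C b') le_rfl
  have h5 := (h.lt_iff a' a₀ (ha'.trans ha₀.symm)).1 (by omega)
  have h6 := (h.lt_iff a₀ a (ha₀.trans ha.symm)).1 (by omega)
  exact (hP.lt_or_lt h5 h6 b').elim hlt h3

theorem TableauAlignment.not_looseAt_of_lt {T : P → ℕ × ℕ} {C : P → ℕ}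
    (h : TableauAlignment T C) {a b : P} (hb : (T b).1 = 1) (ha : (T a).1 = 0)
    (hab : C b ≤ C a) (hlt : a < b) : ¬ LooseAt T C (C b) := by
  rintro ⟨a', b', ha', hb', h1, h2, h3⟩
  obtain rfl := h.inj b' b (hb'.trans hb.symm) h2
  exact h3 (((h.lt_iff a' a (ha'.trans ha.symm)).1 (by omega)).trans hlt)

variable [Fintype P]

/-! ### A closed description of the diagram filling -/

/-- The properties of the diagrams in the component of the diagram of `T` that are used: the
number of cells in each column is that of the alignment of `T`, and there are two conditions on
the positions of cells in weakly increasing columns. -/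
structure Compatible (T : P → ℕ × ℕ) (D : Diagram) : Prop where
  colCard_eq : ∀ c, colCard D c = Nat.card {x // align T 0 x = c}
  noLongDescent : NoLongDescent D
  hasPath : ∀ m, (∀ c < m, ∃ x, align T 0 x = c) → HasPath m D

theorem Compatible.exists_oneCell {T : P → ℕ × ℕ} {D : Diagram} (hD : Compatible T D) {a : P}
    (ha : ∀ x, align T 0 x = align T 0 a → x = a) : ∃ s, OneCell D (align T 0 a) s := by
  apply _root_.exists_oneCell
  rw [hD.colCard_eq, Nat.card_eq_one_iff_unique]
  exact ⟨⟨fun x y => Subtype.ext ((ha _ x.2).trans (ha _ y.2).symm)⟩, ⟨⟨a, rfl⟩⟩⟩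

theorem Compatible.exists_twoCells {T : P → ℕ × ℕ} {D : Diagram} (hD : Compatible T D) {a b : P}
    (hab : a ≠ b) (hb : align T 0 b = align T 0 a)
    (h : ∀ x, align T 0 x = align T 0 a → x = a ∨ x = b) :
    ∃ s t, TwoCells D (align T 0 a) s t := by
  classical
  apply _root_.exists_twoCells
  rw [hD.colCard_eq, Nat.card_eq_fintype_card, Fintype.card_subtype, Finset.card_eq_two]
  refine ⟨a, b, hab, ?_⟩
  ext x
  simp only [Finset.mem_filter, Finset.mem_univ, true_and, Finset.mem_insert,
    Finset.mem_singleton]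
  refine ⟨h x, ?_⟩
  rintro (rfl | rfl)
  exacts [rfl, hb]

open Classical in
/-- The row in which the filling of `D` puts the entry of the first row of `T` in column `c`. -/
noncomputable def upperRow (T : P → ℕ × ℕ) (D : Diagram) : ℕ → ℕ
  | 0 => topRow D 0
  | c + 1 =>
    if LooseAt T (align T 0) (c + 1) then rowAbove D (c + 1) (upperRow T D c)
    else topRow D (c + 1)

/-- The row in which the filling of `D` puts `x`. -/
noncomputable def rowOf (T : P → ℕ × ℕ) (D : Diagram) (x : P) : ℕ :=
  if (T x).1 = 0 then upperRow T D (align T 0 x)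
  else otherRow D (align T 0 x) (upperRow T D (align T 0 x))

theorem rowOf_upper {T : P → ℕ × ℕ} {D : Diagram} {a : P} (ha : (T a).1 = 0) :
    rowOf T D a = upperRow T D (align T 0 a) := if_pos ha

theorem rowOf_lower {T : P → ℕ × ℕ} {D : Diagram} {b : P} (hb : (T b).1 = 1) :
    rowOf T D b = otherRow D (align T 0 b) (upperRow T D (align T 0 b)) :=
  if_neg (by omega)

theorem upperRow_of_not_looseAt {T : P → ℕ × ℕ} {D : Diagram} {c : ℕ}
    (h : ¬ LooseAt T (align T 0) c) : upperRow T D c = topRow D c := by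
  cases c with
  | zero => rfl
  | succ c => rw [upperRow, if_neg h]

theorem upperRow_of_looseAt {T : P → ℕ × ℕ} {D : Diagram} {c : ℕ}
    (h : LooseAt T (align T 0) (c + 1)) :
    upperRow T D (c + 1) = rowAbove D (c + 1) (upperRow T D c) := by
  rw [upperRow, if_pos h]

theorem upperRow_mem {T : P → ℕ × ℕ} {D : Diagram} (hT : TableauAlignment T (align T 0))
    (hD : Compatible T D) {a : P} (ha : (T a).1 = 0) :
    (upperRow T D (align T 0 a), align T 0 a) ∈ D := by
  suffices H : ∀ c a, (T a).1 = 0 → align T 0 a = c → (upperRow T D c, c) ∈ D from H _ a ha rfl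
  clear ha a
  intro c
  induction c with
  | zero =>
    intro a ha hc
    rcases hT.column_cases ha with h | ⟨b, hb, hba, h⟩
    · obtain ⟨s, hs⟩ := hD.exists_oneCell h
      rw [hc] at hs
      rw [upperRow, hs.topRow_eq]
      exact (hs s).2 rfl
    · obtain ⟨s, t, hs⟩ := hD.exists_twoCells (ne_of_row ha hb) hba h
      rw [hc] at hs
      rw [upperRow, hs.topRow_eq]
      exact (hs.2 s).2 (Or.inl rfl)
  | succ c ih =>
    intro a ha hc
    rcases hT.column_cases ha with h | ⟨b, hb, hba, h⟩
    · obtain ⟨s, hs⟩ := hD.exists_oneCell h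
      rw [hc] at hs
      rw [upperRow_of_not_looseAt, hs.topRow_eq]
      · exact (hs s).2 rfl
      · rintro ⟨a', b, ha', hb, h1, h2, h3⟩
        exact ne_of_row ha hb (h b (h2.trans hc.symm)).symm
    · obtain ⟨s, t, hs⟩ := hD.exists_twoCells (ne_of_row ha hb) hba h
      rw [hc] at hs
      by_cases hl : LooseAt T (align T 0) (c + 1)
      · obtain ⟨a', ha', hc'⟩ := hT.exists_upper a c (by omega)
        have h1 := ih a' ha' hc'
        rw [upperRow_of_looseAt hl, hs.rowAbove_eq (hs.le_of_noLongDescent hD.noLongDescent h1)]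
        split_ifs
        · exact (hs.2 t).2 (Or.inr rfl)
        · exact (hs.2 s).2 (Or.inl rfl)
      · rw [upperRow_of_not_looseAt hl, hs.topRow_eq]
        exact (hs.2 s).2 (Or.inl rfl)

/-- What is known of the rows of the two entries `a`, `b` of a column. -/
theorem exists_twoCells_rowOf {T : P → ℕ × ℕ} {D : Diagram}
    (hT : TableauAlignment T (align T 0)) (hD : Compatible T D) {a b : P} (ha : (T a).1 = 0)
    (hb : (T b).1 = 1) (hab : align T 0 a = align T 0 b) : ∃ s t, TwoCells D (align T 0 b) s t ∧
      (rowOf T D a = s ∧ rowOf T D b = t ∨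
        LooseAt T (align T 0) (align T 0 b) ∧ rowOf T D a = t ∧ rowOf T D b = s) := by
  obtain ⟨s, t, hs⟩ := hD.exists_twoCells (ne_of_row ha hb) hab.symm fun x hx => by
    rcases hT.cases x with h | h
    · exact Or.inl (hT.inj x a (h.trans ha.symm) hx)
    · exact Or.inr (hT.inj x b (h.trans hb.symm) (hx.trans hab))
  have hm := upperRow_mem hT hD ha
  rw [rowOf_upper ha, rowOf_lower hb]
  rw [hab] at hs hm ⊢
  refine ⟨s, t, hs, ?_⟩
  rcases (hs.2 _).1 hm with h | h
  · rw [h, hs.otherRow_top]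
    exact Or.inl ⟨rfl, rfl⟩
  · rw [h, hs.otherRow_bot]
    refine Or.inr ⟨?_, rfl, rfl⟩
    by_contra hl
    rw [upperRow_of_not_looseAt hl, hs.topRow_eq] at h
    exact hs.1.ne h

theorem rowOf_mem {T : P → ℕ × ℕ} {D : Diagram} (hT : TableauAlignment T (align T 0))
    (hD : Compatible T D) (x : P) : (rowOf T D x, align T 0 x) ∈ D := by
  rcases hT.cases x with hx | hx
  · rw [rowOf_upper hx]
    exact upperRow_mem hT hD hx
  · obtain ⟨a, ha, hax⟩ := hT.exists_upper x _ le_rfl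
    obtain ⟨s, t, hs, ⟨-, h⟩ | ⟨-, -, h⟩⟩ := exists_twoCells_rowOf hT hD ha hx hax
    · exact (hs.2 _).2 (Or.inr h)
    · exact (hs.2 _).2 (Or.inl h)

theorem rowOf_injective {T : P → ℕ × ℕ} {D : Diagram} (hT : TableauAlignment T (align T 0))
    (hD : Compatible T D) {x y : P} (hc : align T 0 x = align T 0 y)
    (hr : rowOf T D x = rowOf T D y) : x = y := by
  rcases hT.cases x with hx | hx <;> rcases hT.cases y with hy | hy
  · exact hT.inj x y (hx.trans hy.symm) hc
  · obtain ⟨s, t, hs, ⟨h1, h2⟩ | ⟨-, h1, h2⟩⟩ := exists_twoCells_rowOf hT hD hx hy hc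
    · have := hs.1; omega
    · have := hs.1; omega
  · obtain ⟨s, t, hs, ⟨h1, h2⟩ | ⟨-, h1, h2⟩⟩ := exists_twoCells_rowOf hT hD hy hx hc.symm
    · have := hs.1; omega
    · have := hs.1; omega
  · exact hT.inj x y (hx.trans hy.symm) hc

theorem exists_rowOf_eq {T : P → ℕ × ℕ} {D : Diagram} (hT : TableauAlignment T (align T 0))
    (hD : Compatible T D) {s c : ℕ} (h : (s, c) ∈ D) :
    ∃ x, align T 0 x = c ∧ rowOf T D x = s := by
  have h0 : colCard D c ≠ 0 := by
    rw [colCard, Finset.card_ne_zero]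
    exact ⟨(s, c), by simp [h]⟩
  rw [hD.colCard_eq, Nat.card_ne_zero] at h0
  obtain ⟨⟨x, rfl⟩⟩ := h0.1
  obtain ⟨a, ha, hax⟩ := hT.exists_upper x _ le_rfl
  rw [← hax] at h ⊢
  rcases hT.column_cases ha with h1 | ⟨b, hb, hba, h1⟩
  · obtain ⟨s', hs⟩ := hD.exists_oneCell h1
    have h2 := (hs _).1 (rowOf_mem hT hD a)
    exact ⟨a, rfl, h2.trans ((hs s).1 h).symm⟩
  · obtain ⟨s', t, hs, h2⟩ := exists_twoCells_rowOf hT hD ha hb hba.symm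
    rw [hba] at hs
    rcases (hs.2 s).1 h with rfl | rfl
    · rcases h2 with h2 | h2
      · exact ⟨a, rfl, h2.1⟩
      · exact ⟨b, hba, h2.2.2⟩
    · rcases h2 with h2 | h2
      · exact ⟨b, hba, h2.2⟩
      · exact ⟨a, rfl, h2.2.1⟩

/-- In a loose column, the entry of the first row of `T` is put into the lowest cell weakly above
the row of its predecessor in the first row. -/
theorem upperRow_le_of_looseAt {T : P → ℕ × ℕ} {D : Diagram}
    (hT : TableauAlignment T (align T 0)) (hD : Compatible T D) {c : ℕ}
    (h : LooseAt T (align T 0) (c + 1)) : upperRow T D (c + 1) ≤ upperRow T D c ∧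
      ∀ s, (s, c + 1) ∈ D → s ≤ upperRow T D c → s ≤ upperRow T D (c + 1) := by
  have h' := h
  obtain ⟨a', b, ha', hb, h1, h2, -⟩ := h'
  obtain ⟨a, ha, hab⟩ := hT.exists_upper b _ le_rfl
  obtain ⟨s, t, hs, -⟩ := exists_twoCells_rowOf hT hD ha hb hab
  rw [h2] at hs
  have hm := upperRow_mem hT hD ha'
  rw [show align T 0 a' = c by omega] at hm
  have hle := hs.le_of_noLongDescent hD.noLongDescent hm
  have hst := hs.1
  rw [upperRow_of_looseAt h, hs.rowAbove_eq hle]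
  constructor
  · split_ifs <;> omega
  · intro s' hs' hle'
    have := (hs.2 s').1 hs'
    split_ifs <;> omega

theorem upperRow_succ_le {T : P → ℕ × ℕ} {D : Diagram}
    (hT : TableauAlignment T (align T 0)) (hD : Compatible T D) {b : P} {c : ℕ}
    (hb : (T b).1 = 1) (hc : align T 0 b = c + 1) : upperRow T D (c + 1) ≤ upperRow T D c := by
  by_cases h : LooseAt T (align T 0) (c + 1)
  · exact (upperRow_le_of_looseAt hT hD h).1
  · obtain ⟨a, ha, hab⟩ := hT.exists_upper b _ le_rfl
    obtain ⟨a', ha', hab'⟩ := hT.exists_upper b c (by omega)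
    obtain ⟨s, t, hs, -⟩ := exists_twoCells_rowOf hT hD ha hb hab
    rw [hc] at hs
    have hm := upperRow_mem hT hD ha'
    rw [hab'] at hm
    rw [upperRow_of_not_looseAt h, hs.topRow_eq]
    exact hs.le_of_noLongDescent hD.noLongDescent hm

theorem upperRow_lt_of_not_looseAt {T : P → ℕ × ℕ} {D : Diagram}
    (hT : TableauAlignment T (align T 0)) (hD : Compatible T D) {b : P} (hb : (T b).1 = 1)
    (h : ¬ LooseAt T (align T 0) (align T 0 b)) :
    upperRow T D (align T 0 b) < rowOf T D b := by
  obtain ⟨a, ha, hab⟩ := hT.exists_upper b _ le_rfl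
  obtain ⟨s, t, hs, ⟨h1, h2⟩ | ⟨hl, -⟩⟩ := exists_twoCells_rowOf hT hD ha hb hab
  · rw [rowOf_upper ha, hab] at h1
    rw [h1, h2]
    exact hs.1
  · exact absurd hl h

/-- If an entry `b` of the second row of `T` is not below an entry `a` of the first row in a
column further to the right, then the filling keeps `b` in a row below that of `a` and below
that of the other entry in the column of `b`. -/
theorem upperRow_le_of_not_lt {T : P → ℕ × ℕ} {D : Diagram}
    (hT : TableauAlignment T (align T 0)) (hP : SumFree 3 1 P) (hD : Compatible T D) {a b : P}
    (hb : (T b).1 = 1) (ha : (T a).1 = 0) (hab : align T 0 b < align T 0 a) (hlt : ¬ b < a) :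
    upperRow T D (align T 0 a) ≤ upperRow T D (align T 0 b) ∧
      upperRow T D (align T 0 b) < rowOf T D b := by
  refine ⟨?_, upperRow_lt_of_not_looseAt hT hD hb (hT.not_looseAt hP hb ha hab hlt)⟩
  obtain ⟨n, hn⟩ := Nat.exists_eq_add_of_lt hab
  induction n generalizing b with
  | zero =>
    obtain h | ⟨b', hb', hc⟩ := hT.lt_or b a hb ha (by omega)
    · exact absurd h hlt
    · have := upperRow_succ_le hT hD hb' hc
      rwa [show align T 0 a = align T 0 b + 1 by omega]
  | succ n ih =>
    obtain ⟨a₁, ha₁, h1⟩ := hT.exists_upper a (align T 0 b + 1) (by omega)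
    have h2 := (hT.lt_iff a₁ a (ha₁.trans ha.symm)).1 (by omega)
    obtain h | ⟨b', hb', hc⟩ := hT.lt_or b a₁ hb ha₁ (by omega)
    · exact absurd (h.trans h2) hlt
    · have h3 := upperRow_succ_le hT hD hb' hc
      have h4 := (hT.lt_iff b b' (hb.trans hb'.symm)).1 (by omega)
      have h5 := ih hb' (by omega) (fun h => hlt (h4.trans h)) (by omega)
      rw [hc] at h5
      exact h5.trans h3

theorem upperRow_lt_rowOf_of_lt {T : P → ℕ × ℕ} {D : Diagram}
    (hT : TableauAlignment T (align T 0)) (hP : SumFree 3 1 P) (hD : Compatible T D) {a b : P}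
    (hb : (T b).1 = 1) (ha : (T a).1 = 0) (hab : align T 0 b ≤ align T 0 a) (hlt : a < b) :
    rowOf T D a < rowOf T D b := by
  rw [rowOf_upper ha]
  rcases hab.eq_or_lt with h | h
  · rw [← h]
    exact upperRow_lt_of_not_looseAt hT hD hb (hT.not_looseAt_of_lt hb ha hab hlt)
  · have := upperRow_le_of_not_lt hT hP hD hb ha h hlt.asymm
    omega

theorem not_lt_of_rowOf_eq_succ {T : P → ℕ × ℕ} {D : Diagram}
    (hT : TableauAlignment T (align T 0)) (hP : SumFree 3 1 P) (hD : Compatible T D) {u v : P}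
    (hr : rowOf T D v = rowOf T D u + 1) (hc : align T 0 u ≤ align T 0 v) : ¬ v < u := by
  intro hlt
  rcases hT.cases u with hu | hu <;> rcases hT.cases v with hv | hv
  · have := (hT.lt_iff v u (hv.trans hu.symm)).2 hlt
    omega
  · exact hT.not_lt v u hv hu hc hlt
  · have := upperRow_lt_rowOf_of_lt hT hP hD hu hv hc hlt
    omega
  · have := (hT.lt_iff v u (hv.trans hu.symm)).2 hlt
    omega

theorem lt_or_looseAt {T : P → ℕ × ℕ} {D : Diagram}
    (hT : TableauAlignment T (align T 0)) (hP : SumFree 3 1 P) (hD : Compatible T D) {u v : P}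
    (hr : rowOf T D u ≤ rowOf T D v) (hc : align T 0 u < align T 0 v) : u < v ∨
      (T u).1 = 0 ∧ (T v).1 = 1 ∧ align T 0 v = align T 0 u + 1 ∧
        LooseAt T (align T 0) (align T 0 v) := by
  rcases hT.cases u with hu | hu <;> rcases hT.cases v with hv | hv
  · exact Or.inl ((hT.lt_iff u v (hu.trans hv.symm)).1 hc)
  · by_cases h2 : align T 0 u + 2 ≤ align T 0 v
    · exact Or.inl (hT.lt_of_add_two_le hP hu hv h2)
    · by_cases hlt : u < v
      · exact Or.inl hlt
      · exact Or.inr ⟨hu, hv, by omega, u, v, hu, hv, by omega, rfl, hlt⟩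
  · refine Or.inl ?_
    by_contra hlt
    have := upperRow_le_of_not_lt hT hP hD hu hv hc hlt
    rw [rowOf_upper hv] at hr
    omega
  · exact Or.inl ((hT.lt_iff u v (hu.trans hv.symm)).1 hc)

/-- The rows of the filling are chains, increasing from left to right. -/
theorem lt_of_rowOf_eq {T : P → ℕ × ℕ} {D : Diagram}
    (hT : TableauAlignment T (align T 0)) (hP : SumFree 3 1 P) (hD : Compatible T D) {u v : P}
    (hr : rowOf T D u = rowOf T D v) (hc : align T 0 u < align T 0 v) : u < v := by
  obtain h | ⟨hu, hv, h1, h2⟩ := lt_or_looseAt hT hP hD hr.le hc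
  · exact h
  · obtain ⟨a, ha, hav⟩ := hT.exists_upper v _ le_rfl
    have hm := rowOf_mem hT hD v
    rw [h1] at h2 hm
    obtain ⟨h3, h4⟩ := upperRow_le_of_looseAt hT hD h2
    have h5 := h4 _ hm (by rw [← hr, rowOf_upper hu])
    have h6 : rowOf T D a = rowOf T D v := by
      rw [← hr, rowOf_upper hu] at h5 ⊢
      rw [rowOf_upper ha, hav, h1]
      omega
    exact absurd (rowOf_injective hT hD hav h6) (ne_of_row ha hv)

theorem looseAt_of_not_lt {T : P → ℕ × ℕ} {D : Diagram}
    (hT : TableauAlignment T (align T 0)) (hP : SumFree 3 1 P) (hD : Compatible T D) {u v : P}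
    (hr : rowOf T D v = rowOf T D u + 1) (hc : align T 0 v < align T 0 u) (hlt : ¬ v < u) :
    ((T v).1 = 0 ∧ (T u).1 = 1 ∧ align T 0 u = align T 0 v + 1 ∧
      LooseAt T (align T 0) (align T 0 u) ∧ upperRow T D (align T 0 u) = rowOf T D v) ∨
    ((T v).1 = 1 ∧ (rowOf T D u, align T 0 v) ∈ D) := by
  rcases hT.cases u with hu | hu <;> rcases hT.cases v with hv | hv
  · exact absurd ((hT.lt_iff v u (hv.trans hu.symm)).1 hc) hlt
  · have := upperRow_le_of_not_lt hT hP hD hv hu hc hlt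
    rw [rowOf_upper hu] at hr ⊢
    obtain ⟨a, ha, hav⟩ := hT.exists_upper v _ le_rfl
    refine Or.inr ⟨hv, ?_⟩
    have hm := upperRow_mem hT hD ha
    rw [hav] at hm
    rwa [show upperRow T D (align T 0 u) = upperRow T D (align T 0 v) by omega]
  · left
    have h1 : align T 0 u = align T 0 v + 1 := by
      by_contra hcon
      exact hlt (hT.lt_of_add_two_le hP hv hu (by omega))
    have hl : LooseAt T (align T 0) (align T 0 u) := ⟨v, u, hv, hu, h1.symm, rfl, hlt⟩
    refine ⟨hv, hu, h1, hl, ?_⟩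
    have hm := rowOf_mem hT hD u
    obtain ⟨a, ha, hau⟩ := hT.exists_upper u _ le_rfl
    have hne : rowOf T D a ≠ rowOf T D u := fun e => ne_of_row ha hu (rowOf_injective hT hD hau e)
    rw [rowOf_upper ha, hau] at hne
    rw [h1] at hl hm hne ⊢
    obtain ⟨h3, h4⟩ := upperRow_le_of_looseAt hT hD hl
    have h5 := h4 _ hm (by rw [rowOf_upper hv] at hr; omega)
    rw [rowOf_upper hv] at hr ⊢
    omega
  · exact absurd ((hT.lt_iff v u (hv.trans hu.symm)).1 hc) hlt

theorem ruleRow_eq {T : P → ℕ × ℕ} {D : Diagram} {ρ : P → ℕ} {c r : ℕ} {y x : P}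
    (hy : RuleWitness T ρ c r y) (hu : ∀ y', align T 0 y' = c → ρ y' = r → y' = y) :
    (y < x → ruleRow T D ρ c r x = rowAbove D (c + 1) r) ∧
      (¬ y < x → ruleRow T D ρ c r x = otherRow D (c + 1) (rowAbove D (c + 1) r)) := by
  constructor
  · intro h
    exact if_pos ⟨y, hy, h⟩
  · intro h
    refine if_neg ?_
    rintro ⟨y', hy', h'⟩
    rw [hu y' hy'.1 hy'.2.1] at h'
    exact h h'

theorem fillRow_eq_rowOf {T : P → ℕ × ℕ} {D : Diagram}
    (hT : TableauAlignment T (align T 0)) (hP : SumFree 3 1 P) (hD : Compatible T D) (x : P) :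
    fillRow T D (align T 0 x) x = rowOf T D x := by
  suffices H : ∀ c x, align T 0 x = c → fillRow T D c x = rowOf T D x from H _ x rfl
  clear x
  -- A column with a single entry, and the default rule.
  have single : ∀ c x, align T 0 x = c → (∃! z : P, align T 0 z = c) →
      topRow D c = rowOf T D x := by
    rintro c x rfl ⟨z, -, hz⟩
    obtain ⟨a, ha, hax⟩ := hT.exists_upper x _ le_rfl
    obtain rfl : a = x := (hz a hax).trans (hz x rfl).symm
    rw [rowOf_upper ha, upperRow_of_not_looseAt]
    rintro ⟨a', b, ha', hb, h1, h2, h3⟩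
    exact ne_of_row ha hb ((hz a hax).trans (hz b h2).symm)
  have default : ∀ c x, align T 0 x = c → ¬ LooseAt T (align T 0) c →
      (¬ ∃! z : P, align T 0 z = c) → defaultRow T D c x = rowOf T D x := by
    rintro c x rfl hl hne
    rcases hT.cases x with hx | hx
    · rw [defaultRow, if_pos hx, rowOf_upper hx, upperRow_of_not_looseAt hl]
    · obtain ⟨a, ha, hax⟩ := hT.exists_upper x _ le_rfl
      obtain ⟨s, t, hs, ⟨-, h⟩ | ⟨h, -⟩⟩ := exists_twoCells_rowOf hT hD ha hx hax
      · rw [defaultRow, if_neg (by omega), h, hs.botRow_eq]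
      · exact absurd h hl
  intro c
  induction c with
  | zero =>
    intro x hx
    rw [fillRow]
    split_ifs with h
    · exact single 0 x hx h
    · exact default 0 x hx (fun ⟨_, _, _, _, h1, _⟩ => by omega) h
  | succ c ih =>
    intro x hx
    rw [fillRow]
    by_cases hne : ∃! z : P, align T 0 z = c + 1
    · rw [if_pos hne]
      exact single _ x hx hne
    rw [if_neg hne]
    obtain ⟨a, ha, hac⟩ := hT.exists_upper x _ hx.ge
    obtain ⟨b, hb, hba, hab⟩ : ∃ b, (T b).1 = 1 ∧ align T 0 b = c + 1 ∧
        ∀ x, align T 0 x = c + 1 → x = a ∨ x = b := by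
      rcases hT.column_cases ha with h | h
      · exact absurd ⟨a, hac, fun y hy => h y (hy.trans hac.symm)⟩ hne
      · rwa [hac] at h
    obtain ⟨a₀, ha₀, hac₀⟩ := hT.exists_upper x c (by omega)
    have ha₀a : a₀ < a := (hT.lt_iff _ _ (ha₀.trans ha.symm)).1 (by omega)
    obtain ⟨s', t', hs', hrow'⟩ := exists_twoCells_rowOf hT hD ha hb (hac.trans hba.symm)
    rw [hba] at hs' hrow'
    have loose_iff : LooseAt T (align T 0) (c + 1) ↔ ¬ a₀ < b := by
      constructor
      · rintro ⟨a₁, b₁, ha₁, hb₁, h1, h2, h3⟩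
        rwa [← hT.inj a₁ a₀ (ha₁.trans ha₀.symm) (by omega),
          ← hT.inj b₁ b (hb₁.trans hb.symm) (by omega)]
      · exact fun h => ⟨a₀, b, ha₀, hb, by omega, hba, h⟩
    have wit_a : ∀ r, RuleWitness T (fillRow T D c) c r a₀ ↔
        rowOf T D a₀ = r ∧ LooseAt T (align T 0) (c + 1) := by
      intro r
      rw [RuleWitness, ih a₀ hac₀, loose_iff]
      refine ⟨fun ⟨_, h1, h2⟩ => ⟨h1, fun h => ?_⟩, fun ⟨h1, h2⟩ => ⟨hac₀, h1, a, ⟨hac, ha₀a⟩, ?_⟩⟩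
      · exact ne_of_row ha hb (h2.unique ⟨hac, ha₀a⟩ ⟨hba, h⟩)
      · rintro y ⟨hy, hy'⟩
        rcases hab y hy with rfl | rfl
        · rfl
        · exact absurd hy' h2
    -- The outcome when the rule applies to the entry of the first row of `T`.
    have rule_a : LooseAt T (align T 0) (c + 1) → ∀ r, rowOf T D a₀ = r →
        (∀ y', align T 0 y' = c → rowOf T D y' = r → y' = a₀) →
        ruleRow T D (fillRow T D c) c r x = rowOf T D x := by
      intro hl r hr hu
      have hw := (wit_a r).2 ⟨hr, hl⟩
      have h1 := ruleRow_eq (D := D) (x := x) hw fun y' hy' hy'' =>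
        hu y' hy' (by rwa [ih y' hy'] at hy'')
      have h2 := upperRow_of_looseAt (D := D) hl
      rw [rowOf_upper ha₀, hac₀] at hr
      rw [hr] at h2
      rcases hab x hx with rfl | rfl
      · rw [h1.1 ha₀a, rowOf_upper ha, hac, h2]
      · rw [h1.2 (loose_iff.1 hl), rowOf_lower hb, hba, h2]
    rcases hT.column_cases ha₀ with h0 | ⟨b₀, hb₀, hbc₀, h0⟩
    · -- The previous column has a single entry.
      obtain ⟨s, hs⟩ := hD.exists_oneCell h0
      have hra := (hs _).1 (rowOf_mem hT hD a₀)
      rw [hac₀] at hs h0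
      rw [hs.topRow_eq, hs.botRow_eq]
      have hw : (∃ y, RuleWitness T (fillRow T D c) c s y) ↔ LooseAt T (align T 0) (c + 1) := by
        constructor
        · rintro ⟨y, hy⟩
          rw [h0 y hy.1, wit_a] at hy
          exact hy.2
        · exact fun h => ⟨a₀, (wit_a s).2 ⟨hra, h⟩⟩
      by_cases hl : LooseAt T (align T 0) (c + 1)
      · rw [if_pos (hw.2 hl)]
        exact rule_a hl s hra fun y' hy' _ => h0 y' hy'
      · rw [if_neg (mt hw.1 hl), if_neg (mt hw.1 hl)]
        exact default _ x hx hl hne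
    · -- The previous column has two entries.
      rw [hac₀] at hbc₀ h0
      obtain ⟨s, t, hs, hrow⟩ := exists_twoCells_rowOf hT hD ha₀ hb₀ (hac₀.trans hbc₀.symm)
      rw [hbc₀] at hs hrow
      have hst := hs.1
      rw [hs.topRow_eq, hs.botRow_eq]
      have hb₀b : b₀ < b := (hT.lt_iff _ _ (hb₀.trans hb.symm)).1 (by omega)
      have wit_b : ∀ r, RuleWitness T (fillRow T D c) c r b₀ ↔
          rowOf T D b₀ = r ∧ ¬ b₀ < a := by
        intro r
        rw [RuleWitness, ih b₀ hbc₀]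
        refine ⟨fun ⟨_, h1, h2⟩ => ⟨h1, fun h => ?_⟩,
          fun ⟨h1, h2⟩ => ⟨hbc₀, h1, b, ⟨hba, hb₀b⟩, ?_⟩⟩
        · exact ne_of_row ha hb (h2.unique ⟨hac, h⟩ ⟨hba, hb₀b⟩)
        · rintro y ⟨hy, hy'⟩
          rcases hab y hy with rfl | rfl
          · exact absurd hy' h2
          · rfl
      have hw : ∀ r, (∃ y, RuleWitness T (fillRow T D c) c r y) ↔
          (rowOf T D a₀ = r ∧ LooseAt T (align T 0) (c + 1)) ∨
            (rowOf T D b₀ = r ∧ ¬ b₀ < a) := by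
        intro r
        rw [← wit_a, ← wit_b]
        constructor
        · rintro ⟨y, hy⟩
          rcases h0 y hy.1 with rfl | rfl
          · exact Or.inl hy
          · exact Or.inr hy
        · rintro (h | h)
          exacts [⟨_, h⟩, ⟨_, h⟩]
      have uniq : ∀ y', align T 0 y' = c → ∀ y'', align T 0 y'' = c →
          rowOf T D y' = rowOf T D y'' → y' = y'' :=
        fun y' h1 y'' h2 h3 => rowOf_injective hT hD (h1.trans h2.symm) h3
      have hba₀ : ¬ b₀ < a → ¬ LooseAt T (align T 0) c := fun h => by
        have := hT.not_looseAt hP hb₀ ha (by omega) h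
        rwa [hbc₀] at this
      by_cases hl : LooseAt T (align T 0) (c + 1)
      · rcases hrow with ⟨h1, h2⟩ | ⟨h3, h1, h2⟩
        · rw [if_pos ((hw s).2 (Or.inl ⟨h1, hl⟩))]
          exact rule_a hl s h1 fun y' hy' h => uniq y' hy' a₀ hac₀ (h.trans h1.symm)
        · rw [if_neg (mt (hw s).1 ?_), if_pos ((hw t).2 (Or.inl ⟨h1, hl⟩))]
          · exact rule_a hl t h1 fun y' hy' h => uniq y' hy' a₀ hac₀ (h.trans h1.symm)
          · rintro (⟨h4, -⟩ | ⟨-, h4⟩)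
            · omega
            · exact hba₀ h4 h3
      · by_cases hlt : b₀ < a
        · rw [if_neg (mt (hw s).1 (by tauto)), if_neg (mt (hw t).1 (by tauto))]
          exact default _ x hx hl hne
        · -- The rule applies to the entry of the second row, which is in the lowest cell.
          rcases hrow with ⟨h1, h2⟩ | ⟨h3, -⟩
          swap
          · exact absurd h3 (hba₀ hlt)
          rw [if_neg (mt (hw s).1 ?_), if_pos ((hw t).2 (Or.inr ⟨h2, hlt⟩))]
          swap
          · rintro (⟨-, h4⟩ | ⟨h4, -⟩)
            · exact hl h4
            · omega
          have h3 := ruleRow_eq (D := D) (x := x) ((wit_b t).2 ⟨h2, hlt⟩) fun y' hy' hy'' =>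
            uniq y' hy' b₀ hbc₀ (by rw [ih y' hy'] at hy''; exact hy''.trans h2.symm)
          have h4 := hs.ge_of_noLongDescent hD.noLongDescent ((hs'.2 t').2 (Or.inr rfl))
          have hst' := hs'.1
          rw [hs'.rowAbove_eq (by omega), if_pos h4, hs'.otherRow_bot] at h3
          rcases hrow' with ⟨h5, h6⟩ | ⟨h5, -⟩
          swap
          · exact absurd h5 hl
          rcases hab x hx with rfl | rfl
          · rw [h3.2 hlt, h5]
          · rw [h3.1 hb₀b, h6]

theorem filling_eq {T : P → ℕ × ℕ} {D : Diagram}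
    (hT : TableauAlignment T (align T 0)) (hP : SumFree 3 1 P) (hD : Compatible T D) :
    filling T D = fun x => (rowOf T D x, align T 0 x) := by
  funext x
  rw [filling, fillRow_eq_rowOf hT hP hD]

end Fillings

section Chains

theorem array_fst {P : Type*} [Fintype P] {ρ C : P → ℕ} (x : P) :
    (array (fun x => (ρ x, C x)) x).1 = ρ x := rfl

variable {P : Type*} [PartialOrder P]

/-! ### Arrays of fillings by chains -/

/-- The rows `ρ` and the columns `C` of a bijection from `P` onto `D` for which every row is a
chain, increasing from left to right, and no entry is below an entry of the row above that is
weakly to its left. -/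
structure ChainFilling (ρ C : P → ℕ) (D : Diagram) : Prop where
  mem : ∀ x, (ρ x, C x) ∈ D
  inj : ∀ {x y}, C x = C y → ρ x = ρ y → x = y
  surj : ∀ {s c}, (s, c) ∈ D → ∃ x, ρ x = s ∧ C x = c
  lt : ∀ {x y}, ρ x = ρ y → C x < C y → x < y
  not_lt : ∀ {u v}, ρ v = ρ u + 1 → C u ≤ C v → ¬ v < u

namespace ChainFilling

variable {ρ C : P → ℕ} {D : Diagram}

theorem lt_iff (h : ChainFilling ρ C D) {x y : P} (hr : ρ x = ρ y) : C x < C y ↔ x < y := by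
  refine ⟨h.lt hr, fun hxy => ?_⟩
  rcases lt_trichotomy (C x) (C y) with h1 | h1 | h1
  · exact h1
  · exact absurd (h.inj h1 hr) hxy.ne
  · exact absurd (h.lt hr.symm h1) hxy.asymm

theorem rowCount_succ_col (h : ChainFilling ρ C D) {x : P} {s : ℕ} (hx : ρ x = s) {i : ℕ}
    (hi : i ≤ C x) : rowCount D s i (C x + 1) = rowCount D s i (C x) + 1 := by
  rw [rowCount_succ hi, if_pos (hx ▸ h.mem x)]

theorem rowCount_lt (h : ChainFilling ρ C D) {x : P} {s k : ℕ} (hx : ρ x = s) (hk : C x < k) :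
    rowCount D s 0 (C x) < rowCount D s 0 k := by
  have h1 := h.rowCount_succ_col hx (Nat.zero_le _)
  have h2 := rowCount_mono (D := D) (s := s) (i := 0) (show C x + 1 ≤ k from hk)
  omega

variable [Fintype P]

theorem card_filter (h : ChainFilling ρ C D) (s i k : ℕ) :
    (Finset.univ.filter fun x => ρ x = s ∧ i ≤ C x ∧ C x < k).card = rowCount D s i k := by
  unfold rowCount
  refine Finset.card_bij (fun x _ => C x) ?_ ?_ ?_
  · intro x hx
    simp only [Finset.mem_filter, Finset.mem_univ, true_and, Finset.mem_Ico] at hx ⊢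
    exact ⟨hx.2, hx.1 ▸ h.mem x⟩
  · intro x hx y hy hxy
    simp only [Finset.mem_filter, Finset.mem_univ, true_and] at hx hy
    exact h.inj hxy (hx.1.trans hy.1.symm)
  · intro c hc
    simp only [Finset.mem_filter, Finset.mem_Ico] at hc
    obtain ⟨x, hx, hxc⟩ := h.surj hc.2
    exact ⟨x, by simp [hx, hxc, hc.1], hxc⟩

theorem image_eq (h : ChainFilling ρ C D) :
    (Finset.univ.image fun x => (ρ x, C x)) = D := by
  ext ⟨s, c⟩
  simp only [Finset.mem_image, Finset.mem_univ, true_and, Prod.mk.injEq]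
  exact ⟨fun ⟨x, h1, h2⟩ => h1 ▸ h2 ▸ h.mem x, h.surj⟩

theorem array_snd (h : ChainFilling ρ C D) (x : P) :
    (array (fun x => (ρ x, C x)) x).2 = rowCount D (ρ x) 0 (C x) := by
  classical
  have h1 : (array (fun x => (ρ x, C x)) x).2 =
      (D.filter fun z => z.1 = ρ x ∧ z.2 < C x).card := by
    rw [← h.image_eq]
    simp only [array]
  rw [h1, rowCount]
  symm
  refine Finset.card_bij (fun c _ => (ρ x, c)) ?_ ?_ ?_
  · intro c hc
    simp only [Finset.mem_filter, Finset.mem_Ico] at hc ⊢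
    exact ⟨hc.2, trivial, hc.1.2⟩
  · intro c _ c' _ he
    exact (Prod.ext_iff.1 he).2
  · rintro ⟨s, c⟩ hz
    simp only [Finset.mem_filter] at hz
    obtain ⟨hz, rfl, hc⟩ := hz
    exact ⟨c, by simp [hz, hc], rfl⟩

theorem array_snd_lt_iff (h : ChainFilling ρ C D) {x y : P} (hr : ρ x = ρ y) :
    (array (fun x => (ρ x, C x)) x).2 < (array (fun x => (ρ x, C x)) y).2 ↔ C x < C y := by
  rw [h.array_snd, h.array_snd, hr]
  constructor
  · intro h1
    by_contra h2
    have := rowCount_mono (D := D) (s := ρ y) (i := 0) (_root_.not_lt.1 h2)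
    omega
  · exact fun h1 => h.rowCount_lt hr h1

theorem array_eq_ofRows (h : ChainFilling ρ C D) :
    array (fun x => (ρ x, C x)) = ofRows ρ := by
  classical
  funext x
  refine Prod.ext rfl ?_
  rw [h.array_snd, ← h.card_filter, ofRows]
  congr 1
  ext y
  simp only [Finset.mem_filter, Finset.mem_univ, true_and, Nat.zero_le]
  exact and_congr_right fun hy => h.lt_iff hy

theorem isPArray (h : ChainFilling ρ C D) : IsPArray (array fun x => (ρ x, C x)) := by
  constructor
  · intro x y hxy
    have hr : ρ x = ρ y := congrArg Prod.fst hxy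
    have h2 := congrArg Prod.snd hxy
    refine h.inj ?_ hr
    have h3 := h.array_snd_lt_iff hr
    have h4 := h.array_snd_lt_iff hr.symm
    omega
  · intro x i j hx
    have hi : ρ x = i := congrArg Prod.fst hx
    have hj : rowCount D i 0 (C x) = j + 1 := by
      rw [← hi, ← h.array_snd, hx]
    -- The rightmost cell of the row to the left of that of `x`.
    obtain ⟨y, hy, hmax⟩ := Finset.exists_max_image
      (Finset.univ.filter fun y => ρ y = i ∧ 0 ≤ C y ∧ C y < C x) C
      (Finset.card_pos.1 (by rw [h.card_filter]; omega))
    simp only [Finset.mem_filter, Finset.mem_univ, true_and, Nat.zero_le] at hy hmax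
    refine ⟨y, Prod.ext hy.1 ?_, h.lt (hy.1.trans hi.symm) hy.2⟩
    rw [h.array_snd, hy.1]
    have h1 := h.rowCount_succ_col hy.1 (Nat.zero_le _)
    have h2 := rowCount_add (D := D) (s := i) (Nat.zero_le (C y + 1)) hy.2
    have h3 : rowCount D i (C y + 1) (C x) = 0 := by
      by_contra h0
      obtain ⟨c, h4, h5, h6⟩ := rowCount_pos_iff.1 (Nat.pos_of_ne_zero h0)
      obtain ⟨z, hz, rfl⟩ := h.surj h6
      have := hmax z ⟨hz, h5⟩
      omega
    simp only
    omega

theorem diagramWt_eq (h : ChainFilling ρ C D) (i : ℕ) :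
    diagramWt D i = arrayWt (array fun x => (ρ x, C x)) i := by
  classical
  rw [diagramWt, arrayWt, ← h.image_eq, Finset.filter_image, Finset.card_image_of_injective]
  · rfl
  · intro x y hxy
    simp only [Prod.mk.injEq] at hxy
    exact h.inj hxy.2 hxy.1

/-! ### The alignment of two rows of a filling

Below, `u` stands for entries of row `r` and `v` for entries of row `r + 1`. -/

theorem preAlign_lower (h : ChainFilling ρ C D) {r : ℕ} {v : P} (hv : ρ v = r + 1) :
    preAlign (array fun x => (ρ x, C x)) r v = rowCount D (r + 1) 0 (C v) := by
  rw [preAlign_of_ne (by rw [array_fst]; omega), h.array_snd, hv]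

theorem preAlign_upper_le (h : ChainFilling ρ C D) {r n : ℕ} {u : P} (hu : ρ u = r)
    (h1 : ∀ v, ρ v = r + 1 → v < u → C v < C u → rowCount D (r + 1) 0 (C v) + 1 ≤ n)
    (h2 : ∀ u', ρ u' = r → C u' < C u →
      preAlign (array fun x => (ρ x, C x)) r u' + 1 ≤ n) :
    preAlign (array fun x => (ρ x, C x)) r u ≤ n := by
  refine (preAlign_le_iff hu).2 ⟨fun v hv hvu => ?_, fun u' hu' hlt => ?_⟩
  · rw [array_fst] at hv
    rw [h.array_snd, hv]
    refine h1 v hv hvu ?_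
    by_contra hcon
    exact h.not_lt (hv.trans (by rw [hu])) (_root_.not_lt.1 hcon) hvu
  · exact h2 u' hu' ((h.array_snd_lt_iff (Eq.trans hu' hu.symm)).1 hlt)

theorem lt_preAlign_upper (h : ChainFilling ρ C D) {r : ℕ} {u v : P} (hu : ρ u = r)
    (hv : ρ v = r + 1) (hvu : v < u) :
    rowCount D (r + 1) 0 (C v) < preAlign (array fun x => (ρ x, C x)) r u := by
  have := lt_preAlign_of_lt (A := array fun x => (ρ x, C x)) hu hv hvu
  rwa [h.array_snd, hv] at this

theorem preAlign_strictMono (h : ChainFilling ρ C D) {r : ℕ} {x y : P} (hxy : ρ x = ρ y)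
    (hr : ρ x = r ∨ ρ x = r + 1) (hlt : x < y) :
    preAlign (array fun x => (ρ x, C x)) r x < preAlign (array fun x => (ρ x, C x)) r y := by
  have hC := (h.lt_iff hxy).2 hlt
  rcases hr with hr | hr
  · exact preAlign_lt_preAlign (A := array fun x => (ρ x, C x)) (hxy.symm.trans hr) hr
      ((h.array_snd_lt_iff hxy).2 hC)
  · rw [h.preAlign_lower hr, h.preAlign_lower (hxy.symm.trans hr)]
    exact h.rowCount_lt hr hC

/-- If from column `E` on every initial segment has at least as many cells in row `r` as in row
`r + 1`, then in the pre-alignment every entry of row `r + 1` from there on shares its column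
with an entry of row `r`. -/
theorem exists_preAlign_eq (h : ChainFilling ρ C D) {r E : ℕ}
    (hlo : ∀ u, ρ u = r → C u < E →
      preAlign (array fun x => (ρ x, C x)) r u < rowCount D (r + 1) 0 E)
    (hhi : ∀ u, ρ u = r → E ≤ C u →
      rowCount D (r + 1) 0 E ≤ preAlign (array fun x => (ρ x, C x)) r u)
    (hcount : ∀ k, rowCount D (r + 1) E k ≤ rowCount D r E k) {v : P} (hv : ρ v = r + 1)
    (hE : E ≤ C v) : ∃ u, ρ u = r ∧ E ≤ C u ∧
      preAlign (array fun x => (ρ x, C x)) r u = rowCount D (r + 1) 0 (C v) := by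
  by_contra hcon
  push Not at hcon
  have hj := rowCount_add (D := D) (s := r + 1) (Nat.zero_le E) hE
  have key : ∀ n u, C u = n → ρ u = r → E ≤ C u → C u ≤ C v →
      preAlign (array fun x => (ρ x, C x)) r u < rowCount D (r + 1) 0 (C v) := by
    intro n
    induction n using Nat.strong_induction_on with
    | _ n ih =>
    intro u hn hu huE huv
    refine lt_of_le_of_ne (h.preAlign_upper_le hu (fun v' hv' _ hc => ?_) fun u' hu' hc => ?_)
      (hcon u hu huE)
    · exact h.rowCount_lt hv' (by omega)
    · by_cases hE' : E ≤ C u'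
      · exact ih _ (by omega) u' rfl hu' hE' (by omega)
      · have := hlo u' hu' (by omega)
        omega
  -- Pigeonhole: these entries of row `r` occupy distinct columns between those of `E` and of `v`.
  have hcard := Finset.card_le_card_of_injOn
    (s := Finset.univ.filter fun u => ρ u = r ∧ E ≤ C u ∧ C u < C v + 1)
    (t := Finset.Ico (rowCount D (r + 1) 0 E) (rowCount D (r + 1) 0 (C v)))
    (preAlign (array fun x => (ρ x, C x)) r)
    (fun u hu => by
      simp only [Finset.coe_filter, Finset.mem_univ, true_and, Set.mem_ofPred_eq] at hu
      simp only [Finset.coe_Ico, Set.mem_Ico]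
      exact ⟨hhi u hu.1 hu.2.1, key _ u rfl hu.1 hu.2.1 (by omega)⟩)
    (fun u hu u' hu' he => by
      simp only [Finset.coe_filter, Finset.mem_univ, true_and, Set.mem_ofPred_eq] at hu hu'
      have hr := hu.1.trans hu'.1.symm
      refine h.inj ?_ hr
      rcases lt_trichotomy (C u) (C u') with h1 | h1 | h1
      · exact absurd he (h.preAlign_strictMono hr (Or.inl hu.1) (h.lt hr h1)).ne
      · exact h1
      · exact absurd he (h.preAlign_strictMono hr.symm (Or.inl hu'.1) (h.lt hr.symm h1)).ne')
  rw [h.card_filter, Nat.card_Ico] at hcard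
  have h1 := hcount (C v + 1)
  have h2 := h.rowCount_succ_col hv hE
  omega

end ChainFilling

/-- A stage of the alignment process at which the entries of rows `r` and `r + 1` from column `E`
on are in columns from `q` on, the others are in columns before `q`, and each of the former in
row `r + 1` shares its column with an entry of row `r`. -/
structure TailShared (ρ C : P → ℕ) (r E q : ℕ) (C' : P → ℕ) : Prop where
  mono : ∀ {x y}, ρ x = ρ y → (ρ x = r ∨ ρ x = r + 1) → x < y → C' x < C' y
  head : ∀ {x}, (ρ x = r ∨ ρ x = r + 1) → C x < E → C' x < q
  tail : ∀ {x}, (ρ x = r ∨ ρ x = r + 1) → E ≤ C x → q ≤ C' x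
  shared : ∀ {v}, ρ v = r + 1 → E ≤ C v → ∃ u, ρ u = r ∧ E ≤ C u ∧ C' u = C' v

theorem TailShared.lt_of_lt {ρ C C' : P → ℕ} {D : Diagram} {r E q : ℕ}
    (h : ChainFilling ρ C D) (hs : TailShared ρ C r E q C') {x y : P} (hxy : ρ x = ρ y)
    (hr : ρ x = r ∨ ρ x = r + 1) (hlt : C' x < C' y) : x < y := by
  rcases lt_trichotomy (C x) (C y) with h1 | h1 | h1
  · exact h.lt hxy h1
  · rw [h.inj h1 hxy] at hlt
    exact absurd hlt (lt_irrefl _)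
  · have := hs.mono hxy.symm (hxy ▸ hr) (h.lt hxy.symm h1)
    omega

/-- The entries of rows `r` and `r + 1` in the columns from `c` to `e` that change rows under `e_r`:
the entry of row `r + 1` in column `c` is the one that moves in the diagram, and in the columns
after it up to `e` there are entries in both rows, each incomparable to the next along the zigzag
through the run, whereas the entries outside are comparable to those at its ends. -/
structure RaiseRun (ρ C : P → ℕ) (D : Diagram) (r c e : ℕ) : Prop where
  le : c ≤ e
  no_upper : ∀ {u}, ρ u = r → C u ≠ c
  exists_lower : ∀ {d}, c ≤ d → d ≤ e → ∃ v, ρ v = r + 1 ∧ C v = d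
  exists_upper : ∀ {d}, c < d → d ≤ e → ∃ u, ρ u = r ∧ C u = d
  left : ∀ i ≤ c, rowCount D r i c ≤ rowCount D (r + 1) i c
  right : ∀ k, rowCount D (r + 1) (c + 1) k ≤ rowCount D r (c + 1) k
  before : ∀ {u v}, ρ u = r → ρ v = r + 1 → C u < c → C v = c → u < v
  after_lower : ∀ {u v}, ρ u = r → ρ v = r + 1 → C v = e → e < C u → v < u
  after_upper : ∀ {u v}, ρ u = r → ρ v = r + 1 → c < C u → C u = e → e < C v → u < v
  same : ∀ {u v}, ρ u = r → ρ v = r + 1 → c < C u → C u ≤ e → C v = C u → ¬ u < v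
  next : ∀ {u v}, ρ u = r → ρ v = r + 1 → c < C u → C u ≤ e → C v + 1 = C u → ¬ v < u
  far : ∀ {u v}, ρ u = r → ρ v = r + 1 → c < C u → C u ≤ e → C v + 2 ≤ C u → v < u

theorem RaiseRun.rowCount_succ_eq {ρ C : P → ℕ} {D : Diagram} {r c e : ℕ} (h : RaiseRun ρ C D r c e)
    (hF : ChainFilling ρ C D) {d : ℕ}
    (h1 : c ≤ d) (h2 : d ≤ e) :
    rowCount D (r + 1) 0 (d + 1) = rowCount D (r + 1) 0 d + 1 := by
  obtain ⟨v, hv, rfl⟩ := h.exists_lower h1 h2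
  rw [rowCount_succ (Nat.zero_le _), if_pos (hv ▸ hF.mem v)]

theorem RaiseRun.right_end {ρ C : P → ℕ} {D : Diagram} {r c e : ℕ} (h : RaiseRun ρ C D r c e)
    (hF : ChainFilling ρ C D) (k : ℕ) :
    rowCount D (r + 1) (e + 1) k ≤ rowCount D r (e + 1) k := by
  rcases le_total k (e + 1) with hk | hk
  · have : rowCount D (r + 1) (e + 1) k ≤ k - (e + 1) := rowCount_le
    omega
  · have hce := h.le
    have h1 : rowCount D (r + 1) (c + 1) (e + 1) = e + 1 - (c + 1) :=
      rowCount_eq_of_forall fun d h1 h2 => by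
        obtain ⟨v, hv, rfl⟩ := h.exists_lower (d := d) (by omega) (by omega)
        exact hv ▸ hF.mem v
    have h2 : rowCount D r (c + 1) (e + 1) = e + 1 - (c + 1) :=
      rowCount_eq_of_forall fun d h1 h2 => by
        obtain ⟨u, hu, rfl⟩ := h.exists_upper (d := d) (by omega) (by omega)
        exact hu ▸ hF.mem u
    have h3 := rowCount_add (D := D) (s := r + 1) (show c + 1 ≤ e + 1 by omega) hk
    have h4 := rowCount_add (D := D) (s := r) (show c + 1 ≤ e + 1 by omega) hk
    have h5 := h.right k
    omega

variable [Fintype P]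

theorem TailShared.step {ρ C C' C'' : P → ℕ} {D : Diagram} {r E q : ℕ}
    (h : ChainFilling ρ C D) (hs : TailShared ρ C r E q C') {x : P}
    (hx : Movable (array fun x => (ρ x, C x)) r C' x) (hx1 : C'' x = C' x + 1)
    (hx2 : ∀ y, y ≠ x → C'' y = C' y) (hhead : C x < E → C' x + 1 < q) :
    TailShared ρ C r E q C'' := by
  obtain ⟨hxr, ⟨z, hzr, hz⟩, hno⟩ := hx
  change ρ x = r ∨ ρ x = r + 1 at hxr
  change ρ z = r ∨ ρ z = r + 1 at hzr
  -- The entry moves into a column without an entry of its own row.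
  have hdiff : ∀ y, (ρ y = r ∨ ρ y = r + 1) → C' y = C' x + 1 → ρ x ≠ ρ y := fun y hyr hy he =>
    hno y hyr hy (hs.lt_of_lt h he hxr (by omega))
  have hmv : E ≤ C x → ρ x = r + 1 ∧ ρ z = r ∧ E ≤ C z := by
    intro hxE
    have hq := hs.tail hxr hxE
    have hzE : E ≤ C z := by
      by_contra hcon
      have := hs.head hzr (not_le.1 hcon)
      omega
    have hzx := hdiff z hzr hz
    rcases hzr with hz0 | hz0
    · exact ⟨by omega, hz0, hzE⟩
    · obtain ⟨u, hu, huE, huz⟩ := hs.shared hz0 hzE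
      exact absurd (by omega) (hdiff u (Or.inl hu) (by omega))
  refine ⟨fun {a b} hab hr hlt => ?_, fun {a} hr ha => ?_, fun {a} hr ha => ?_,
    fun {v} hv hvE => ?_⟩
  · have h1 := hs.mono hab hr hlt
    by_cases hax : a = x
    · subst hax
      have h2 := hdiff b (hab ▸ hr)
      rw [hx1, hx2 b hlt.ne']
      by_contra hcon
      exact h2 (by omega) hab
    · rw [hx2 a hax]
      by_cases hbx : b = x
      · subst hbx
        omega
      · rwa [hx2 b hbx]
  · by_cases hax : a = x
    · subst hax
      rw [hx1]
      exact hhead ha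
    · rw [hx2 a hax]
      exact hs.head hr ha
  · by_cases hax : a = x
    · subst hax
      have := hs.tail hr ha
      omega
    · rw [hx2 a hax]
      exact hs.tail hr ha
  · by_cases hvx : v = x
    · subst hvx
      obtain ⟨-, h1, h2⟩ := hmv hvE
      exact ⟨z, h1, h2, by rw [hx2 z fun e => by rw [e] at h1; omega, hx1, hz]⟩
    · obtain ⟨u, hu, huE, huv⟩ := hs.shared hv hvE
      refine ⟨u, hu, huE, ?_⟩
      rw [hx2 v hvx, hx2 u, huv]
      rintro rfl
      have := (hmv huE).1
      omega

/-- If every initial segment of the columns has at least as many cells in row `r` as in row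
`r + 1`, then `e_r` kills the array. -/
theorem ChainFilling.arrayRaise_eq_none {ρ C : P → ℕ} {D : Diagram} {r : ℕ}
    (h : ChainFilling ρ C D) (hcount : ∀ k, rowCount D (r + 1) 0 k ≤ rowCount D r 0 k) :
    arrayRaise r (array fun x => (ρ x, C x)) = none := by
  have hs : TailShared ρ C r 0 0 (align (array fun x => (ρ x, C x)) r) := by
    refine align_induction ⟨fun hxy hr hlt => h.preAlign_strictMono hxy hr hlt,
      fun _ h0 => absurd h0 (Nat.not_lt_zero _), fun _ _ => Nat.zero_le _, fun {v} hv _ => ?_⟩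
      fun C' C'' x hs hx hx1 hx2 => hs.step h hx hx1 hx2 fun h0 => absurd h0 (Nat.not_lt_zero _)
    rw [h.preAlign_lower hv]
    exact h.exists_preAlign_eq (fun _ _ h0 => absurd h0 (Nat.not_lt_zero _))
      (fun _ _ _ => by simp [rowCount_self]) hcount hv (Nat.zero_le _)
  refine if_neg ?_
  rintro ⟨p, hp, hno⟩
  obtain ⟨u, hu, -, hup⟩ := hs.shared (v := p) hp (Nat.zero_le _)
  exact hno u hu hup

/-- A stage of the alignment process for the two rows of a `RaiseRun`.  The columns of the entries
of row `r + 1` up to column `e` are final.  In the run, an entry of row `r` is in the column of the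
entry of row `r + 1` with which it shared its column in the filling, or in the one before. -/
structure RunStage (ρ C : P → ℕ) (D : Diagram) (r c e : ℕ) (C' : P → ℕ) : Prop where
  tail : TailShared ρ C r (e + 1) (rowCount D (r + 1) 0 (e + 1)) C'
  lower : ∀ {v}, ρ v = r + 1 → C v ≤ e → C' v = rowCount D (r + 1) 0 (C v)
  before : ∀ {u}, ρ u = r → C u < c → C' u < rowCount D (r + 1) 0 c
  run : ∀ {u}, ρ u = r → c < C u → C u ≤ e →
    C' u = rowCount D (r + 1) 0 (C u) ∨ C' u + 1 = rowCount D (r + 1) 0 (C u)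

namespace RaiseRun

variable {ρ C : P → ℕ} {D : Diagram} {r c e : ℕ}

theorem preAlign_before (h : RaiseRun ρ C D r c e) (hF : ChainFilling ρ C D) {u : P}
    (hu : ρ u = r) (hc : C u < c) :
    preAlign (array fun x => (ρ x, C x)) r u < rowCount D (r + 1) 0 c := by
  suffices H : ∀ n u, C u = n → ρ u = r → C u < c →
      preAlign (array fun x => (ρ x, C x)) r u + rowCount D r (C u) c ≤
        rowCount D (r + 1) 0 c by
    have h1 := H _ u rfl hu hc
    have h2 : 0 < rowCount D r (C u) c := rowCount_pos_iff.2 ⟨C u, le_rfl, hc, hu ▸ hF.mem u⟩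
    omega
  intro n
  induction n using Nat.strong_induction_on with
  | _ n ih =>
  intro u hn hu hc
  have h1 := h.left (C u) hc.le
  have h2 := rowCount_add (D := D) (s := r + 1) (Nat.zero_le (C u)) hc.le
  refine Nat.add_le_of_le_sub (by omega) (hF.preAlign_upper_le hu (fun v hv _ hvu => ?_)
    fun u' hu' hlt => ?_)
  · have := hF.rowCount_lt hv hvu
    omega
  · have h3 := ih _ (by omega) u' rfl hu' (by omega)
    have h4 := rowCount_add (D := D) (s := r) hlt.le hc.le
    have h5 : 0 < rowCount D r (C u') (C u) :=
      rowCount_pos_iff.2 ⟨C u', le_rfl, hlt, hu' ▸ hF.mem u'⟩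
    omega

theorem preAlign_run (h : RaiseRun ρ C D r c e) (hF : ChainFilling ρ C D) {u : P}
    (hu : ρ u = r) (hc : c < C u) (he : C u ≤ e) :
    preAlign (array fun x => (ρ x, C x)) r u + 1 = rowCount D (r + 1) 0 (C u) := by
  suffices H : ∀ n u, C u = n → ρ u = r → c < C u → C u ≤ e →
      preAlign (array fun x => (ρ x, C x)) r u + 1 = rowCount D (r + 1) 0 (C u) from
    H _ u rfl hu hc he
  intro n
  induction n using Nat.strong_induction_on with
  | _ n ih =>
  intro u hn hu hc he
  obtain ⟨d, hd⟩ : ∃ d, C u = d + 1 := ⟨C u - 1, by omega⟩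
  have hsucc := h.rowCount_succ_eq hF (d := d) (by omega) (by omega)
  rw [hd, hsucc]
  congr 1
  refine le_antisymm (hF.preAlign_upper_le hu (fun v hv hvu hlt => ?_) fun u' hu' hlt => ?_) ?_
  · have hne : C v ≠ d := fun h1 => h.next hu hv hc he (by omega) hvu
    exact hF.rowCount_lt hv (by omega)
  · have hmono := rowCount_mono (D := D) (s := r + 1) (i := 0) (show c ≤ d by omega)
    rcases lt_trichotomy (C u') c with h1 | h1 | h1
    · have := h.preAlign_before hF hu' h1
      omega
    · exact absurd h1 (h.no_upper hu')
    · rw [ih _ (by omega) u' rfl hu' h1 (by omega)]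
      exact rowCount_mono (by omega)
  · -- The entries of row `r + 1` two or more columns to the left push `u` to the right.
    rcases Nat.eq_zero_or_pos (rowCount D (r + 1) 0 d) with h0 | h0
    · omega
    · obtain ⟨v, hv, hvd⟩ := h.exists_lower (d := d) (by omega) (by omega)
      have hA := hF.isPArray
      obtain ⟨w, hw, -⟩ := hA.exists_of_le (x := v) (k := rowCount D (r + 1) 0 d - 1)
        (by rw [hF.array_snd, hv, hvd]; omega)
      have hw1 : ρ w = r + 1 := by
        have := congrArg Prod.fst hw
        exact this.trans hv
      have hw2 : rowCount D (r + 1) 0 (C w) = rowCount D (r + 1) 0 d - 1 := by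
        have := congrArg Prod.snd hw
        rwa [hF.array_snd, hw1] at this
      have hwd : C w < d := by
        by_contra hcon
        have := rowCount_mono (D := D) (s := r + 1) (i := 0) (not_lt.1 hcon)
        omega
      have := hF.lt_preAlign_upper hu hw1 (h.far hu hw1 hc he (by omega))
      omega

theorem runStage_preAlign (h : RaiseRun ρ C D r c e) (hF : ChainFilling ρ C D) :
    RunStage ρ C D r c e (preAlign (array fun x => (ρ x, C x)) r) := by
  have hce := h.le
  have hsucc := h.rowCount_succ_eq hF (d := e) hce le_rfl
  have hmono := rowCount_mono (D := D) (s := r + 1) (i := 0) (show c ≤ e by omega)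
  have hlo : ∀ u, ρ u = r → C u < e + 1 →
      preAlign (array fun x => (ρ x, C x)) r u < rowCount D (r + 1) 0 (e + 1) := by
    intro u hu hlt
    rcases lt_trichotomy (C u) c with h1 | h1 | h1
    · have := h.preAlign_before hF hu h1
      omega
    · exact absurd h1 (h.no_upper hu)
    · have h2 := h.preAlign_run hF hu h1 (by omega)
      have h3 := rowCount_mono (D := D) (s := r + 1) (i := 0) hlt.le
      omega
  have hhi : ∀ u, ρ u = r → e + 1 ≤ C u →
      rowCount D (r + 1) 0 (e + 1) ≤ preAlign (array fun x => (ρ x, C x)) r u := by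
    intro u hu hlt
    obtain ⟨v, hv, hve⟩ := h.exists_lower hce le_rfl
    have := hF.lt_preAlign_upper hu hv (h.after_lower hu hv hve hlt)
    rw [hve] at this
    omega
  refine ⟨⟨fun hxy hr hlt => hF.preAlign_strictMono hxy hr hlt, ?_, ?_, ?_⟩, ?_, ?_, ?_⟩
  · rintro x (hx | hx) hlt
    · exact hlo x hx hlt
    · rw [hF.preAlign_lower hx]
      exact hF.rowCount_lt hx hlt
  · rintro x (hx | hx) hle
    · exact hhi x hx hle
    · rw [hF.preAlign_lower hx]
      exact rowCount_mono hle
  · intro v hv hvE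
    rw [hF.preAlign_lower hv]
    exact hF.exists_preAlign_eq hlo hhi (h.right_end hF) hv hvE
  · exact fun hv _ => hF.preAlign_lower hv
  · exact fun hu hc => h.preAlign_before hF hu hc
  · exact fun hu hc he => Or.inr (h.preAlign_run hF hu hc he)

theorem runStage_step (h : RaiseRun ρ C D r c e) (hF : ChainFilling ρ C D) {C' C'' : P → ℕ}
    (hs : RunStage ρ C D r c e C') {x : P} (hx : Movable (array fun x => (ρ x, C x)) r C' x)
    (hx1 : C'' x = C' x + 1) (hx2 : ∀ y, y ≠ x → C'' y = C' y) :
    RunStage ρ C D r c e C'' := by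
  have hce := h.le
  have hsucc := h.rowCount_succ_eq hF (d := e) hce le_rfl
  have hx' := hx
  obtain ⟨hxr, ⟨z, hzr, hz⟩, hno⟩ := hx'
  change ρ x = r ∨ ρ x = r + 1 at hxr
  change ρ z = r ∨ ρ z = r + 1 at hzr
  have hno' : ∀ y, (ρ y = r ∨ ρ y = r + 1) → C' y = C' x + 1 → ¬ x < y := hno
  have hzE : C' x + 1 = rowCount D (r + 1) 0 (e + 1) → e < C z := by
    intro h1
    by_contra hcon
    have := hs.tail.head hzr (show C z < e + 1 by omega)
    omega
  -- No entry of row `r + 1` up to column `e` can be shifted.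
  have hlow : ρ x = r + 1 → e < C x := by
    intro hxv
    by_contra hcon
    have h1 := hs.lower hxv (by omega)
    obtain ⟨v, hv, hve⟩ := h.exists_lower hce le_rfl
    rcases (show C x ≤ e by omega).eq_or_lt with h2 | h2
    · have hz' := hzE (by rw [h1, h2, hsucc])
      refine hno' z hzr hz ?_
      rcases hzr with hz0 | hz0
      · exact h.after_lower hz0 hxv h2 hz'
      · exact hF.lt (hxv.trans hz0.symm) (by omega)
    · obtain ⟨w, hw, -⟩ := hF.isPArray.exists_of_le (x := v)
        (k := rowCount D (r + 1) 0 (C x) + 1) (by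
          rw [hF.array_snd, hv, hve]
          exact hF.rowCount_lt hxv h2)
      have hw1 : ρ w = r + 1 := (congrArg Prod.fst hw).trans hv
      have hw2 : rowCount D (r + 1) 0 (C w) = rowCount D (r + 1) 0 (C x) + 1 := by
        have := congrArg Prod.snd hw
        rwa [hF.array_snd, hw1] at this
      have hwe : C w ≤ e := by
        by_contra hcon'
        have h3 := hF.rowCount_lt hxv h2
        have h4 := hF.rowCount_lt hv (show C v < C w by omega)
        rw [hve] at h4
        omega
      refine hno' w (Or.inr hw1) (by rw [hs.lower hw1 hwe]; omega)
        (hF.lt (hxv.trans hw1.symm) ?_)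
      by_contra hcon'
      have := rowCount_mono (D := D) (s := r + 1) (i := 0) (not_lt.1 hcon')
      omega
  have hbef : ρ x = r → C x < c → C' x + 1 < rowCount D (r + 1) 0 c := by
    intro hxu hxc
    have h1 := hs.before hxu hxc
    refine lt_of_le_of_ne h1 fun h2 => ?_
    obtain ⟨v, hv, hvc⟩ := h.exists_lower le_rfl hce
    exact hno' v (Or.inr hv) (by rw [hs.lower hv (by omega), hvc]; omega)
      (h.before hxu hv hxc hvc)
  have hrun : ρ x = r → c < C x → C x ≤ e → C' x + 1 = rowCount D (r + 1) 0 (C x) := by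
    intro hxu hxc hxe
    refine (hs.run hxu hxc hxe).resolve_left fun h1 => ?_
    have h2 := h.rowCount_succ_eq hF (d := C x) (by omega) hxe
    rcases hxe.eq_or_lt with h3 | h3
    · have hz' := hzE (by rw [h1, h3, hsucc])
      refine hno' z hzr hz ?_
      rcases hzr with hz0 | hz0
      · exact hF.lt (hxu.trans hz0.symm) (by omega)
      · exact h.after_upper hxu hz0 hxc h3 hz'
    · obtain ⟨u, hu, hux⟩ := h.exists_upper (d := C x + 1) (by omega) (by omega)
      have hlt : x < u := hF.lt (hxu.trans hu.symm) (by omega)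
      have h4 := hs.run hu (by omega) (by omega)
      have h5 := hs.tail.mono (hxu.trans hu.symm) (Or.inl hxu) hlt
      rw [hux] at h4
      exact hno' u (Or.inl hu) (by omega) hlt
  refine ⟨hs.tail.step hF hx hx1 hx2 fun hxE => ?_, fun {v} hv hve => ?_, fun {u} hu huc => ?_,
    fun {u} hu huc hue => ?_⟩
  · rcases hxr with hxu | hxv
    · have hmono := rowCount_mono (D := D) (s := r + 1) (i := 0) (show c ≤ e + 1 by omega)
      rcases lt_trichotomy (C x) c with h1 | h1 | h1
      · have := hbef hxu h1
        omega
      · exact absurd h1 (h.no_upper hxu)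
      · have h2 := hrun hxu h1 (by omega)
        have h3 := rowCount_mono (D := D) (s := r + 1) (i := 0) (show C x ≤ e by omega)
        omega
    · have := hlow hxv
      omega
  · rw [hx2 v, hs.lower hv hve]
    rintro rfl
    have := hlow hv
    omega
  · by_cases hux : u = x
    · subst hux
      rw [hx1]
      exact hbef hu huc
    · rw [hx2 u hux]
      exact hs.before hu huc
  · by_cases hux : u = x
    · subst hux
      rw [hx1]
      exact Or.inl (hrun hu huc hue)
    · rw [hx2 u hux]
      exact hs.run hu huc hue

/-- In the alignment the entries of the run in row `r` have been shifted to the columns of their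
companions in row `r + 1`. -/
theorem runStage_align (h : RaiseRun ρ C D r c e) (hF : ChainFilling ρ C D) :
    RunStage ρ C D r c e (align (array fun x => (ρ x, C x)) r) ∧
      ∀ u, ρ u = r → c < C u → C u ≤ e →
        align (array fun x => (ρ x, C x)) r u = rowCount D (r + 1) 0 (C u) := by
  have hs : RunStage ρ C D r c e (align (array fun x => (ρ x, C x)) r) :=
    align_induction (h.runStage_preAlign hF) fun _ _ _ hs hx hx1 hx2 =>
      h.runStage_step hF hs hx hx1 hx2
  refine ⟨hs, fun u hu hc he => ?_⟩
  obtain ⟨n, hn⟩ := Nat.exists_eq_add_of_le he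
  induction n using Nat.strong_induction_on generalizing u with
  | _ n ih =>
  refine (hs.run hu hc he).resolve_right fun h1 => ?_
  refine not_movable_align (array fun x => (ρ x, C x)) r u ⟨Or.inl hu, ?_, ?_⟩
  · obtain ⟨v, hv, hvu⟩ := h.exists_lower (d := C u) hc.le he
    exact ⟨v, Or.inr hv, by rw [hs.lower hv (by omega), hvu]; omega⟩
  · intro y hyr hy hlt
    change ρ y = r ∨ ρ y = r + 1 at hyr
    have hye : C y ≤ e := by
      by_contra hcon
      have h2 := hs.tail.tail hyr (show e + 1 ≤ C y by omega)
      have h3 := rowCount_mono (D := D) (s := r + 1) (i := 0) he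
      have h4 := h.rowCount_succ_eq hF (d := e) h.le le_rfl
      omega
    rcases hyr with hyu | hyv
    · have hc' := (hF.lt_iff (hu.trans hyu.symm)).2 hlt
      have h2 := ih (e - C y) (by omega) y hyu (by omega) hye (by omega)
      obtain ⟨v, hv, hvu⟩ := h.exists_lower (d := C u) hc.le he
      have h3 := hF.rowCount_lt hv (show C v < C y by omega)
      rw [hvu] at h3
      omega
    · have h2 := hs.lower hyv hye
      have h3 : C y = C u := by
        obtain ⟨v, hv, hvu⟩ := h.exists_lower (d := C u) hc.le he
        rcases lt_trichotomy (C y) (C u) with h4 | h4 | h4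
        · have := hF.rowCount_lt hyv h4
          omega
        · exact h4
        · have := hF.rowCount_lt hv (show C v < C y by omega)
          rw [hvu] at this
          omega
      exact h.same hu hyv hc he h3 hlt

/-- The operator `e_r` exchanges the two rows on the columns of the run. -/
theorem arrayRaise_eq (h : RaiseRun ρ C D r c e) (hF : ChainFilling ρ C D) {ρ' : P → ℕ}
    (hin : ∀ x, c ≤ C x → C x ≤ e → ρ x = r → ρ' x = r + 1)
    (hin' : ∀ x, c ≤ C x → C x ≤ e → ρ x = r + 1 → ρ' x = r)
    (hout : ∀ x, ¬ ((ρ x = r ∨ ρ x = r + 1) ∧ c ≤ C x ∧ C x ≤ e) → ρ' x = ρ x) :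
    arrayRaise r (array fun x => (ρ x, C x)) = some (ofRows ρ') := by
  classical
  have hce := h.le
  obtain ⟨hs, hrun⟩ := h.runStage_align hF
  set R := align (array fun x => (ρ x, C x)) r with hR
  have hA := hF.isPArray
  obtain ⟨p, hp, hpc⟩ := h.exists_lower le_rfl hce
  obtain ⟨q, hq, hqe⟩ := h.exists_lower hce le_rfl
  have hsucc := h.rowCount_succ_eq hF (d := e) hce le_rfl
  have hYlt : ∀ {d d'}, c ≤ d → d ≤ e → d < d' →
      rowCount D (r + 1) 0 d < rowCount D (r + 1) 0 d' := by
    intro d d' h1 h2 h3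
    obtain ⟨v, hv, rfl⟩ := h.exists_lower h1 h2
    exact hF.rowCount_lt hv h3
  have snd_le : ∀ {x y}, ρ x = ρ y → ((array (fun x => (ρ x, C x)) x).2 ≤
      (array (fun x => (ρ x, C x)) y).2 ↔ C x ≤ C y) := by
    intro x y hxy
    rw [← not_lt, ← not_lt, hF.array_snd_lt_iff hxy.symm]
  have hRtail : ∀ x, (ρ x = r ∨ ρ x = r + 1) → (e + 1 ≤ C x ↔ rowCount D (r + 1) 0 e < R x) := by
    intro x hx
    constructor
    · intro h1
      have := hs.tail.tail hx h1
      omega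
    · intro h1
      by_contra h2
      have := hs.tail.head hx (not_le.1 h2)
      omega
  have hunshared : Unshared (array fun x => (ρ x, C x)) r (r + 1) r p := by
    refine ⟨hp, fun u hu he => ?_⟩
    change ρ u = r at hu
    rw [← hR, hs.lower hp (by omega), hpc] at he
    rcases lt_trichotomy (C u) c with h1 | h1 | h1
    · have := hs.before hu h1
      omega
    · exact h.no_upper hu h1
    · have h2 := hYlt le_rfl hce h1
      by_cases h3 : C u ≤ e
      · rw [hrun u hu h1 h3] at he
        omega
      · have h4 := (hRtail u (Or.inl hu)).1 (by omega)
        have := rowCount_mono (D := D) (s := r + 1) (i := 0) hce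
        omega
  have hstart : ∀ w, RaiseStart (array fun x => (ρ x, C x)) r w ↔ w = p := by
    have hmax : ∀ w, Unshared (array fun x => (ρ x, C x)) r (r + 1) r w → C w ≤ C p := by
      rintro w ⟨hw, hw'⟩
      change ρ w = r + 1 at hw
      by_contra hcon
      by_cases h1 : C w ≤ e
      · obtain ⟨u, hu, huw⟩ := h.exists_upper (d := C w) (by omega) h1
        refine hw' u hu ?_
        rw [← hR, hrun u hu (by omega) (by omega), hs.lower hw h1, huw]
      · obtain ⟨u, hu, -, huw⟩ := hs.tail.shared hw (show e + 1 ≤ C w by omega)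
        exact hw' u hu huw
    intro w
    constructor
    · rintro ⟨hw, hw'⟩
      have hwr : ρ w = r + 1 := hw.1
      have h1 := (snd_le (hp.trans hwr.symm)).1 (hw' p hunshared)
      exact hF.inj (le_antisymm (hmax w hw) h1) (hwr.trans hp.symm)
    · rintro rfl
      exact ⟨hunshared, fun w' hw' =>
        (snd_le (Eq.trans (show ρ w' = r + 1 from hw'.1) hp.symm)).2 (hmax w' hw')⟩
  have hendq : RunEnd (array fun x => (ρ x, C x)) r (r + 1) r q := by
    refine ⟨hq, fun u hu he => ?_⟩
    change ρ u = r at hu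
    rw [← hR, hs.lower hq (by omega), hqe] at he
    have := (hRtail u (Or.inl hu)).2 (by omega)
    exact h.after_lower hu hq hqe this
  have hend : ∀ w, RunEnd (array fun x => (ρ x, C x)) r (r + 1) r w → c ≤ C w → e ≤ C w := by
    rintro w ⟨hw, hw'⟩ hcw
    change ρ w = r + 1 at hw
    by_contra hcon
    obtain ⟨u, hu, huw⟩ := h.exists_upper (d := C w + 1) (by omega) (by omega)
    refine h.next hu hw (by omega) (by omega) huw.symm (hw' u hu ?_)
    rw [← hR, hrun u hu (by omega) (by omega), hs.lower hw (by omega), huw,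
      h.rowCount_succ_eq hF hcw (by omega)]
  have hfirst : ∀ w, FirstRunEnd (array fun x => (ρ x, C x)) r (r + 1) r p w ↔ w = q := by
    intro w
    constructor
    · rintro ⟨hw, h1, h2⟩
      have hwr : ρ w = r + 1 := hw.1
      have h3 := (snd_le (hp.trans hwr.symm)).1 h1
      have h4 := (snd_le (hwr.trans hq.symm)).1
        (h2 q hendq ((snd_le (hp.trans hq.symm)).2 (by omega)))
      have h5 := hend w hw (by omega)
      exact hF.inj (by omega) (hwr.trans hq.symm)
    · rintro rfl
      refine ⟨hendq, (snd_le (hp.trans hq.symm)).2 (by omega), fun w' hw' h1 => ?_⟩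
      have hwr : ρ w' = r + 1 := hw'.1
      have h3 := (snd_le (hp.trans hwr.symm)).1 h1
      exact (snd_le (hq.trans hwr.symm)).2 (by have := hend w' hw' (by omega); omega)
  have hswap : ∀ x, InSwap (array fun x => (ρ x, C x)) r (r + 1) r p q x ↔
      (ρ x = r ∨ ρ x = r + 1) ∧ c ≤ C x ∧ C x ≤ e := by
    intro x
    constructor
    · rintro (⟨hx, h1, h2⟩ | ⟨hx, w, hw, h1, h2, h3⟩)
      · change ρ x = r + 1 at hx
        have h4 := (snd_le (hp.trans hx.symm)).1 h1
        have h5 := (snd_le (hx.trans hq.symm)).1 h2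
        exact ⟨Or.inr hx, by omega, by omega⟩
      · change ρ x = r at hx
        change ρ w = r + 1 at hw
        have h4 := (snd_le (hp.trans hw.symm)).1 h1
        have h5 := (snd_le (hw.trans hq.symm)).1 h2
        rw [← hR, hs.lower hw (by omega)] at h3
        refine ⟨Or.inl hx, ?_, ?_⟩
        · by_contra hcon
          have h6 := hs.before hx (not_le.1 hcon)
          have h7 := rowCount_mono (D := D) (s := r + 1) (i := 0) (show c ≤ C w by omega)
          omega
        · by_contra hcon
          have h6 := (hRtail x (Or.inl hx)).1 (by omega)
          have h7 := rowCount_mono (D := D) (s := r + 1) (i := 0) (show C w ≤ e by omega)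
          omega
    · rintro ⟨hx | hx, h1, h2⟩
      · have h3 : c < C x := lt_of_le_of_ne h1 (h.no_upper hx).symm
        obtain ⟨v, hv, hvx⟩ := h.exists_lower h1 h2
        refine Or.inr ⟨hx, v, hv, (snd_le (hp.trans hv.symm)).2 (by omega),
          (snd_le (hv.trans hq.symm)).2 (by omega), ?_⟩
        rw [← hR, hrun x hx h3 h2, hs.lower hv (by omega), hvx]
      · exact Or.inl ⟨hx, (snd_le (hp.trans hx.symm)).2 (by omega),
          (snd_le (hx.trans hq.symm)).2 (by omega)⟩
  have hiff : ∀ x, (∃ p z, RaiseStart (array fun x => (ρ x, C x)) r p ∧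
      FirstRunEnd (array fun x => (ρ x, C x)) r (r + 1) r p z ∧
      InSwap (array fun x => (ρ x, C x)) r (r + 1) r p z x) ↔
      (ρ x = r ∨ ρ x = r + 1) ∧ c ≤ C x ∧ C x ≤ e := by
    intro x
    rw [← hswap x]
    constructor
    · rintro ⟨p', z, h1, h2, h3⟩
      obtain rfl := (hstart p').1 h1
      obtain rfl := (hfirst z).1 h2
      exact h3
    · exact fun h3 => ⟨p, q, (hstart p).2 rfl, (hfirst q).2 rfl, h3⟩
  unfold arrayRaise
  rw [if_pos ⟨p, hunshared⟩]
  congr 2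
  funext x
  by_cases hx : (ρ x = r ∨ ρ x = r + 1) ∧ c ≤ C x ∧ C x ≤ e
  · rw [if_pos ((hiff x).2 hx)]
    obtain ⟨hr | hr, h1, h2⟩ := hx
    · exact (if_pos hr).trans (hin x h1 h2 hr).symm
    · exact (if_neg (by rw [array_fst]; omega)).trans (hin' x h1 h2 hr).symm
  · rw [if_neg (mt (hiff x).1 hx), hout x hx]
    rfl

end RaiseRun

end Chains

section Crystals

variable {P : Type*} [PartialOrder P] [Fintype P]

/-! ### Raising operators on diagrams and on arrays of fillings -/

theorem Compatible.chainFilling {T : P → ℕ × ℕ} {D : Diagram} (hD : Compatible T D)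
    (hT : TableauAlignment T (align T 0)) (hP : SumFree 3 1 P) :
    ChainFilling (rowOf T D) (align T 0) D where
  mem := rowOf_mem hT hD
  inj := rowOf_injective hT hD
  surj h := (exists_rowOf_eq hT hD h).imp fun _ hx => hx.symm
  lt := lt_of_rowOf_eq hT hP hD
  not_lt := not_lt_of_rowOf_eq_succ hT hP hD

/-- From column `c` through column `e`, the entry of the first row of `T` sits in row `r + 1`, that
of the second row (after column `c`) sits in row `r`, and consecutive columns are linked by
looseness.  These are the columns in which moving the cell `(r + 1, c)` up exchanges the two
entries. -/
def RunTo (T : P → ℕ × ℕ) (D : Diagram) (r c e : ℕ) : Prop :=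
  c ≤ e ∧ (c < e → upperRow T D c = r + 1) ∧
    ∀ i, c < i → i ≤ e → LooseAt T (align T 0) i ∧ (r, i) ∈ D ∧ upperRow T D i = r + 1

theorem exists_maximal_runTo (T : P → ℕ × ℕ) (D : Diagram) (r c : ℕ) :
    ∃ e, RunTo T D r c e ∧ ¬ RunTo T D r c (e + 1) := by
  by_contra hcon
  push Not at hcon
  have hall : ∀ n, RunTo T D r c (c + n) := by
    intro n
    induction n with
    | zero => exact ⟨le_rfl, fun h => absurd h (lt_irrefl _), fun i h1 h2 => by omega⟩
    | succ n ih => exact hcon _ ih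
  have h1 := ((hall (D.sup Prod.snd + 1)).2.2 (c + (D.sup Prod.snd + 1)) (by omega) le_rfl).2.1
  have h2 : c + (D.sup Prod.snd + 1) ≤ D.sup Prod.snd := Finset.le_sup (f := Prod.snd) h1
  omega

theorem RunTo.raiseRun {T : P → ℕ × ℕ} {D E : Diagram} {r c e : ℕ} (hR : RunTo T D r c e)
    (hmax : ¬ RunTo T D r c (e + 1)) (hT : TableauAlignment T (align T 0))
    (hP : SumFree 3 1 P) (hD : Compatible T D) (hM : CrystalMove E D r c)
    (hgood : ∀ i, i + 1 = c → LooseAt T (align T 0) c → upperRow T D i ≠ r) :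
    RaiseRun (rowOf T D) (align T 0) D r c e := by
  obtain ⟨hce, hc, hrun⟩ := hR
  have hF := hD.chainFilling hT hP
  have hno : (r, c) ∉ D := fun h => by simpa using (hM.eq _).1 h
  have hmem : (r + 1, c) ∈ D := (hM.eq _).2 (Or.inl rfl)
  have hupper : ∀ {u}, rowOf T D u = r → c < align T 0 u → align T 0 u ≤ e → (T u).1 = 1 := by
    intro u hu h1 h2
    refine (hT.cases u).resolve_left fun h3 => ?_
    have := (hrun _ h1 h2).2.2
    rw [rowOf_upper h3] at hu
    omega
  have hlower : ∀ {v}, rowOf T D v = r + 1 → c ≤ align T 0 v → align T 0 v ≤ e → c < e →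
      (T v).1 = 0 := by
    intro v hv h1 h2 h3
    refine (hT.cases v).resolve_right fun h4 => ?_
    obtain ⟨a, ha, hav⟩ := hT.exists_upper v _ le_rfl
    have h5 : upperRow T D (align T 0 v) = r + 1 := by
      rcases h1.eq_or_lt with h6 | h6
      · rw [← h6]
        exact hc h3
      · exact (hrun _ h6 h2).2.2
    refine ne_of_row ha h4 (rowOf_injective hT hD hav ?_)
    rw [rowOf_upper ha, hav, h5, hv]
  refine
    { le := hce
      no_upper := fun {u} hu hc' => hno (hu ▸ hc' ▸ rowOf_mem hT hD u)
      exists_lower := fun {d} h1 h2 => ?_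
      exists_upper := fun {d} h1 h2 => hF.surj (hrun d h1 h2).2.1
      left := fun i hi => ?_
      right := fun k => ?_
      before := fun {u v} hu hv huc hvc => ?_
      after_lower := fun {u v} hu hv hve hue => ?_
      after_upper := fun {u v} hu hv huc hue hve => ?_
      same := fun {u v} hu hv huc hue huv => ?_
      next := fun {u v} hu hv huc hue huv => ?_
      far := fun {u v} hu hv huc hue huv => ?_ }
  · rcases h1.eq_or_lt with h3 | h3
    · exact hF.surj (h3 ▸ hmem)
    · obtain ⟨⟨a, b, ha, hb, h4, h5, -⟩, -, h6⟩ := hrun d h3 h2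
      obtain ⟨a', ha', hab⟩ := hT.exists_upper b d h5.ge
      exact ⟨a', by rw [rowOf_upper ha', hab, h6], hab⟩
  · rw [hM.rowCount_left le_rfl, hM.rowCount_left le_rfl]
    exact hM.left i hi
  · rw [hM.rowCount_right (Nat.lt_succ_self c), hM.rowCount_right (Nat.lt_succ_self c)]
    exact hM.right k
  · obtain h | ⟨h1, -, h2, h3⟩ := lt_or_looseAt hT hP hD (u := u) (v := v) (by omega) (by omega)
    · exact h
    · rw [hvc] at h2 h3
      rw [rowOf_upper h1] at hu
      exact absurd hu (hgood _ h2.symm h3)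
  · by_contra hlt
    obtain ⟨h1, -, h2, h3, h4⟩ | ⟨h1, h2⟩ :=
      looseAt_of_not_lt hT hP hD (u := u) (v := v) (by omega) (by omega) hlt
    · refine hmax ⟨by omega, fun _ => ?_, fun i hi hie => ?_⟩
      · rcases hce.eq_or_lt with h5 | h5
        · rw [rowOf_upper h1, hve] at hv
          rwa [h5]
        · exact hc h5
      · rcases hie.eq_or_lt with h5 | h5
        · have h6 : i = align T 0 u := by omega
          rw [h6]
          exact ⟨h3, hu ▸ rowOf_mem hT hD u, by omega⟩
        · exact hrun i hi (by omega)
    · rw [hu, hve] at h2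
      rcases hce.eq_or_lt with h5 | h5
      · exact hno (h5 ▸ h2)
      · have := hlower hv (by omega) (by omega) h5
        omega
  · have h1 := hupper hu huc hue.le
    obtain h | ⟨h2, -⟩ := lt_or_looseAt hT hP hD (u := u) (v := v) (by omega) (by omega)
    · exact h
    · omega
  · exact hT.not_lt u v (hupper hu huc hue) (hlower hv (by omega) (by omega) (by omega)) huv.le
  · have h1 := hupper hu huc hue
    have h2 := hlower hv (by omega) (by omega) (by omega)
    obtain ⟨⟨a, b, ha, hb, h4, h5, h6⟩, -⟩ := hrun _ huc hue
    rwa [hT.inj a v (ha.trans h2.symm) (by omega), hT.inj b u (hb.trans h1.symm) h5] at h6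
  · have h1 := hupper hu huc hue
    rcases hT.cases v with h2 | h2
    · exact hT.lt_of_add_two_le hP h2 h1 huv
    · exact (hT.lt_iff v u (h2.trans h1.symm)).1 (by omega)

theorem CrystalMove.topRow_eq {D E : Diagram} {r c i : ℕ} (hM : CrystalMove D E r c)
    (hi : i ≠ c) : topRow E i = topRow D i := by
  simp only [topRow, hM.mem_iff_of_ne hi]

theorem CrystalMove.rowAbove_eq {D E : Diagram} {r c i t : ℕ} (hM : CrystalMove D E r c)
    (hi : i ≠ c) : rowAbove E i t = rowAbove D i t := by
  simp only [rowAbove, hM.mem_iff_of_ne hi]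

/-- In the column of the moved cell, the entry of the first row of `T` moves if and only if it is
in the moved cell. -/
theorem upperRow_raise_self {T : P → ℕ × ℕ} {D E : Diagram} {r c : ℕ}
    (hT : TableauAlignment T (align T 0)) (hD : Compatible T D) (hM : CrystalMove E D r c)
    (hgood : ∀ i, i + 1 = c → LooseAt T (align T 0) c → upperRow T D i ≠ r)
    (hprev : ∀ i, i + 1 = c → upperRow T E i = upperRow T D i) {x : P} (hx : align T 0 x = c) :
    upperRow T E c = if upperRow T D c = r + 1 then r else upperRow T D c := by
  have hno : (r, c) ∉ D := fun h => by simpa using (hM.eq _).1 h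
  have hmem : (r + 1, c) ∈ D := (hM.eq _).2 (Or.inl rfl)
  have hE : ∀ s, (s, c) ∈ E ↔ s = r ∨ (s, c) ∈ D ∧ s ≠ r + 1 := fun s => by
    rw [hM.mem_iff]
    simp
  obtain ⟨a, ha, hac⟩ := hT.exists_upper x c hx.ge
  rcases hT.column_cases ha with h1 | ⟨b, hb, hba, h1⟩
  · obtain ⟨s, hs⟩ := hD.exists_oneCell h1
    rw [hac] at hs h1
    have hs' := (hs _).1 hmem
    have hEs : OneCell E c r := fun s' => by
      rw [hE, hs]
      omega
    have hl : ¬ LooseAt T (align T 0) c := by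
      rintro ⟨a', b, ha', hb, h2, h3, h4⟩
      exact ne_of_row ha hb (h1 b h3).symm
    rw [upperRow_of_not_looseAt hl, upperRow_of_not_looseAt hl, hEs.topRow_eq, hs.topRow_eq,
      if_pos hs'.symm]
  · obtain ⟨s, t, hs⟩ := hD.exists_twoCells (ne_of_row ha hb) hba h1
    rw [hac] at hs
    have hst := hs.1
    have hno' := mt (hs.2 r).2 hno
    push Not at hno'
    -- The two cells of column `c` keep their vertical order.
    obtain ⟨s₁, t₁, hEs, hst'⟩ : ∃ s₁ t₁, TwoCells E c s₁ t₁ ∧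
        (s = r + 1 ∧ s₁ = r ∧ t₁ = t ∨ t = r + 1 ∧ t₁ = r ∧ s₁ = s) := by
      rcases (hs.2 _).1 hmem with h2 | h2
      · refine ⟨r, t, ⟨by omega, fun s' => ?_⟩, Or.inl ⟨h2.symm, rfl, rfl⟩⟩
        rw [hE, hs.2]
        omega
      · refine ⟨s, r, ⟨by omega, fun s' => ?_⟩, Or.inr ⟨h2.symm, rfl, rfl⟩⟩
        rw [hE, hs.2]
        omega
    have hst₁ := hEs.1
    by_cases hl : LooseAt T (align T 0) c
    · obtain ⟨j, rfl⟩ : ∃ j, c = j + 1 := by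
        obtain ⟨_, _, _, _, h2, _⟩ := hl
        exact ⟨_, h2.symm⟩
      have hg := hgood j rfl hl
      obtain ⟨a', ha', haj⟩ := hT.exists_upper x j (by omega)
      have hm := upperRow_mem hT hD ha'
      rw [haj] at hm
      have hle := hs.le_of_noLongDescent hD.noLongDescent hm
      rw [upperRow_of_looseAt hl, upperRow_of_looseAt hl, hprev j rfl, hs.rowAbove_eq hle,
        hEs.rowAbove_eq (by omega)]
      split_ifs <;> omega
    · rw [upperRow_of_not_looseAt hl, upperRow_of_not_looseAt hl, hEs.topRow_eq, hs.topRow_eq]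
      split_ifs <;> omega

/-- When `e_r` moves the cell `(r + 1, c)`, the entries of the first row of `T` in row `r + 1` from
column `c` to the end of the run move to row `r`, and the others stay. -/
theorem upperRow_raise {T : P → ℕ × ℕ} {D E : Diagram} {r c e : ℕ} (hR : RunTo T D r c e)
    (hmax : ¬ RunTo T D r c (e + 1)) (hT : TableauAlignment T (align T 0))
    (hP : SumFree 3 1 P) (hD : Compatible T D) (hM : CrystalMove E D r c)
    (hgood : ∀ i, i + 1 = c → LooseAt T (align T 0) c → upperRow T D i ≠ r) (x : P) :
    upperRow T E (align T 0 x) =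
      if c ≤ align T 0 x ∧ align T 0 x ≤ e ∧ upperRow T D (align T 0 x) = r + 1 then r
      else upperRow T D (align T 0 x) := by
  have hF := hD.chainFilling hT hP
  have hrr := hR.raiseRun hmax hT hP hD hM hgood
  obtain ⟨hce, hc, hrun⟩ := hR
  suffices H : ∀ i x, align T 0 x = i → upperRow T E i =
      if c ≤ i ∧ i ≤ e ∧ upperRow T D i = r + 1 then r else upperRow T D i from H _ x rfl
  clear x
  intro i
  induction i using Nat.strong_induction_on with
  | _ i ih =>
  intro x hx
  by_cases hic : i = c
  · subst hic
    rw [upperRow_raise_self hT hD hM hgood (fun j hj => ?_) hx]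
    · simp [hce]
    · obtain ⟨a, ha, haj⟩ := hT.exists_upper x j (by omega)
      rw [ih j (by omega) a haj, if_neg (by omega)]
  by_cases hl : LooseAt T (align T 0) i
  swap
  · rw [upperRow_of_not_looseAt hl, upperRow_of_not_looseAt hl, hM.topRow_eq hic, if_neg]
    rintro ⟨h1, h2, -⟩
    exact hl (hrun i (by omega) h2).1
  obtain ⟨j, rfl⟩ : ∃ j, i = j + 1 := by
    obtain ⟨_, _, _, _, h2, _⟩ := hl
    exact ⟨_, h2.symm⟩
  obtain ⟨a', ha', haj⟩ := hT.exists_upper x j (by omega)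
  have hj := ih j (by omega) a' haj
  have hm := upperRow_mem hT hD ha'
  rw [haj] at hm
  obtain ⟨s, t, hs⟩ : ∃ s t, TwoCells D (j + 1) s t := by
    obtain ⟨a₁, b, -, hb, -, hbj, -⟩ := hl
    obtain ⟨a, ha, hab⟩ := hT.exists_upper b _ le_rfl
    obtain ⟨s, t, hs, -⟩ := exists_twoCells_rowOf hT hD ha hb hab
    exact ⟨s, t, hbj ▸ hs⟩
  have hst := hs.1
  have hle := hs.le_of_noLongDescent hD.noLongDescent hm
  have hup := upperRow_of_looseAt (D := D) hl
  rw [upperRow_of_looseAt hl, ← hM.rowAbove_eq hic]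
  rcases lt_trichotomy j e with hje | hje | hje
  · by_cases hjc : c ≤ j
    · -- Inside the run, the entry of the first row of `T` follows its predecessor to row `r`.
      obtain ⟨-, hrj, h2⟩ := hrun (j + 1) (by omega) (by omega)
      have h3 : upperRow T D j = r + 1 := by
        rcases hjc.eq_or_lt with h4 | h4
        · exact h4 ▸ hc (by omega)
        · exact (hrun j h4 (by omega)).2.2
      rw [if_pos ⟨hjc, hje.le, h3⟩] at hj
      have h4 := (hs.2 r).1 hrj
      rw [if_pos ⟨by omega, by omega, h2⟩, hj, hs.rowAbove_eq (by omega)]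
      split_ifs <;> omega
    · rw [if_neg (by omega)] at hj
      rw [hj, if_neg (by omega), ← hup]
  · -- The column after the run has no cell in row `r + 1`.
    subst hje
    rw [if_neg (by omega)]
    by_cases h3 : upperRow T D j = r + 1
    · rw [if_pos ⟨hce, le_rfl, h3⟩] at hj
      have hnot : (r + 1, j + 1) ∉ D := by
        intro h4
        obtain ⟨k, hk1, hk2, h5⟩ := rowCount_pos_iff.1 (lt_of_lt_of_le
          (rowCount_pos_iff.2 ⟨j + 1, le_rfl, Nat.lt_succ_self _, h4⟩)
          (hrr.right_end hF (j + 2)))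
        obtain rfl : k = j + 1 := by omega
        have h6 := (hs.2 _).1 h4
        have h7 := (hs.2 _).1 h5
        rw [h3, hs.rowAbove_eq (by omega), if_pos (by omega)] at hup
        refine hmax ⟨by omega, fun _ => ?_, fun i hi hie => ?_⟩
        · rcases hce.eq_or_lt with h8 | h8
          · rwa [h8]
          · exact hc h8
        · rcases hie.eq_or_lt with h8 | h8
          · rw [h8]
            exact ⟨hl, h5, by omega⟩
          · exact hrun i hi (by omega)
      have h4 := mt (hs.2 _).2 hnot
      push Not at h4
      rw [hup, hj, h3, hs.rowAbove_eq (by omega), hs.rowAbove_eq (by omega)]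
      split_ifs <;> omega
    · rw [if_neg (by tauto)] at hj
      rw [hj, ← hup]
  · rw [if_neg (by omega)] at hj
    rw [hj, if_neg (by omega), ← hup]

/-- If `e_r` moves the cell `(r + 1, c)` of `D`, then `e_r` maps the array of the filling of `D` to
that of the filling of the new diagram, except when column `c` is loose and the entry of the first
row of `T` in the column before is in row `r`: then that entry draws its successor in the first row
into the new cell. -/
theorem arrayRaise_filling {T : P → ℕ × ℕ} {D E : Diagram} {r c : ℕ}
    (hT : TableauAlignment T (align T 0)) (hP : SumFree 3 1 P) (hD : Compatible T D)
    (hE : Compatible T E) (hM : CrystalMove E D r c)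
    (hgood : ∀ i, i + 1 = c → LooseAt T (align T 0) c → upperRow T D i ≠ r) :
    arrayRaise r (array (filling T D)) = some (array (filling T E)) := by
  obtain ⟨e, hR, hmax⟩ := exists_maximal_runTo T D r c
  have hrr := hR.raiseRun hmax hT hP hD hM hgood
  have hF := hD.chainFilling hT hP
  have hup := upperRow_raise hR hmax hT hP hD hM hgood
  obtain ⟨hce, hc, hrun⟩ := hR
  -- The exchange of the two rows on the run.
  obtain ⟨κ, hκr, hκs, hκo⟩ : ∃ κ : P → ℕ,
      (∀ x, c ≤ align T 0 x → align T 0 x ≤ e → rowOf T D x = r → κ x = r + 1) ∧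
      (∀ x, c ≤ align T 0 x → align T 0 x ≤ e → rowOf T D x = r + 1 → κ x = r) ∧
      ∀ x, ¬ ((rowOf T D x = r ∨ rowOf T D x = r + 1) ∧ c ≤ align T 0 x ∧ align T 0 x ≤ e) →
        κ x = rowOf T D x := by
    classical
    refine ⟨fun x => if (rowOf T D x = r ∨ rowOf T D x = r + 1) ∧ c ≤ align T 0 x ∧
      align T 0 x ≤ e then (if rowOf T D x = r then r + 1 else r) else rowOf T D x,
      fun x h1 h2 h3 => ?_, fun x h1 h2 h3 => ?_, fun x hx => if_neg hx⟩
    · simp [h1, h2, h3]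
    · simp [h1, h2, h3]
  have hcase : ∀ x, (c ≤ align T 0 x ∧ align T 0 x ≤ e ∧ rowOf T D x = r ∧ κ x = r + 1) ∨
      (c ≤ align T 0 x ∧ align T 0 x ≤ e ∧ rowOf T D x = r + 1 ∧ κ x = r) ∨
      (¬ ((rowOf T D x = r ∨ rowOf T D x = r + 1) ∧ c ≤ align T 0 x ∧ align T 0 x ≤ e) ∧
        κ x = rowOf T D x) := by
    intro x
    by_cases hx : (rowOf T D x = r ∨ rowOf T D x = r + 1) ∧ c ≤ align T 0 x ∧ align T 0 x ≤ e
    · obtain ⟨h1 | h1, h2, h3⟩ := hx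
      · exact Or.inl ⟨h2, h3, h1, hκr x h2 h3 h1⟩
      · exact Or.inr (Or.inl ⟨h2, h3, h1, hκs x h2 h3 h1⟩)
    · exact Or.inr (Or.inr ⟨hx, hκo x hx⟩)
  have hmem : ∀ x, (κ x, align T 0 x) ∈ E := by
    intro x
    have hx := rowOf_mem hT hD x
    rcases hcase x with ⟨h1, h2, h3, h4⟩ | ⟨h1, h2, h3, h4⟩ | ⟨h1, h2⟩
    · have h5 : c < align T 0 x := lt_of_le_of_ne h1 (hrr.no_upper h3).symm
      obtain ⟨v, hv, hvx⟩ := hrr.exists_lower h1 h2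
      have := rowOf_mem hT hD v
      rw [h4, ← hM.mem_iff_of_ne (by omega), ← hvx, ← hv]
      exact this
    · rw [h4]
      rcases h1.eq_or_lt with h5 | h5
      · rw [← h5]
        exact hM.mem
      · rw [← hM.mem_iff_of_ne (by omega)]
        exact (hrun _ h5 h2).2.1
    · rw [h2, hM.mem_iff]
      refine Or.inr ⟨hx, fun h3 => h1 ?_⟩
      simp only [Prod.mk.injEq] at h3
      omega
  have hinj : ∀ x y, align T 0 x = align T 0 y → κ x = κ y → x = y := by
    intro x y hxy hk
    refine rowOf_injective hT hD hxy ?_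
    rcases hcase x with h1 | h1 | h1 <;> rcases hcase y with h2 | h2 | h2 <;> omega
  have hκa : ∀ a, (T a).1 = 0 → rowOf T E a = κ a := by
    intro a ha
    have h1 := hup a
    have h2 := rowOf_upper (D := D) ha
    rw [rowOf_upper ha, h1]
    split_ifs with h3
    · exact (hκs a h3.1 h3.2.1 (by omega)).symm
    · rw [← h2]
      rcases hcase a with h4 | h4 | h4
      · exfalso
        have h5 : c < align T 0 a := lt_of_le_of_ne h4.1 (hrr.no_upper h4.2.2.1).symm
        have := (hrun _ h5 h4.2.1).2.2
        omega
      · omega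
      · exact h4.2.symm
  have hκ : rowOf T E = κ := by
    funext x
    rcases hT.cases x with hx | hx
    · exact hκa x hx
    · obtain ⟨a, ha, hax⟩ := hT.exists_upper x _ le_rfl
      obtain ⟨s, t, hs, -⟩ := exists_twoCells_rowOf hT hE ha hx hax
      have h1 := (hs.2 _).1 (rowOf_mem hT hE x)
      have h2 := (hs.2 _).1 (hmem x)
      have h3 := (hs.2 _).1 (hax ▸ hmem a)
      have h4 : rowOf T E x ≠ κ a := fun h => ne_of_row ha hx
        (rowOf_injective hT hE hax ((hκa a ha).trans h.symm))
      have h5 : κ x ≠ κ a := fun h => ne_of_row ha hx (hinj a x hax h.symm)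
      omega
  rw [filling_eq hT hP hD, filling_eq hT hP hE, (hE.chainFilling hT hP).array_eq_ofRows, hκ]
  exact hrr.arrayRaise_eq hF hκr hκs hκo

theorem arrayRaise_filling_eq_none {T : P → ℕ × ℕ} {D : Diagram} {r : ℕ}
    (hT : TableauAlignment T (align T 0)) (hP : SumFree 3 1 P) (hD : Compatible T D)
    (h : diagramRaise r D = none) : arrayRaise r (array (filling T D)) = none := by
  rw [filling_eq hT hP hD]
  exact (hD.chainFilling hT hP).arrayRaise_eq_none (rowCount_le_of_diagramRaise_eq_none h)

/-! ### The component of the diagram of a tableau -/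

theorem CrystalMove.compatible {T : P → ℕ × ℕ} {D E : Diagram} {r c : ℕ}
    (hM : CrystalMove D E r c) : Compatible T D ↔ Compatible T E := by
  constructor
  · exact fun h => ⟨fun d => (hM.colCard_eq d).trans (h.colCard_eq d),
      hM.noLongDescent h.noLongDescent, fun m hm => hM.hasPath (h.hasPath m hm)⟩
  · exact fun h => ⟨fun d => (hM.colCard_eq d).symm.trans (h.colCard_eq d),
      hM.noLongDescent_symm h.noLongDescent, fun m hm => hM.hasPath_symm (h.hasPath m hm)⟩

theorem mem_tableauDiagram {T : P → ℕ × ℕ} {s c : ℕ} :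
    (s, c) ∈ tableauDiagram T ↔ ∃ x, (T x).1 = s ∧ align T 0 x = c := by
  simp [tableauDiagram]

theorem compatible_tableauDiagram {T : P → ℕ × ℕ} (hT : TableauAlignment T (align T 0)) :
    Compatible T (tableauDiagram T) := by
  classical
  refine ⟨fun c => ?_, ?_, fun m hm => ⟨fun _ => 0, antitone_const, fun c hc => ?_⟩⟩
  · rw [Nat.card_eq_fintype_card, Fintype.card_subtype, colCard, tableauDiagram,
      Finset.filter_image, Finset.card_image_of_injective]
    · intro x y hxy
      simp only [Prod.mk.injEq] at hxy
      exact hT.inj x y hxy.1 hxy.2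
  · intro r₁ r₂ r₃ c₁ c₂ c₃ _ _ h3 h12 h23 _ _
    obtain ⟨x, hx, -⟩ := mem_tableauDiagram.1 h3
    have := hT.row_le x
    omega
  · obtain ⟨x, hx⟩ := hm c hc
    obtain ⟨a, ha, hac⟩ := hT.exists_upper x c hx.ge
    exact mem_tableauDiagram.2 ⟨a, ha, hac⟩

theorem exists_crystalMove_of_adj {D E : Diagram} (h : diagramCrystal.Adj D E) :
    ∃ r c, CrystalMove D E r c ∨ CrystalMove E D r c := by
  rw [diagramCrystal, SimpleGraph.fromRel_adj] at h
  obtain ⟨-, ⟨r, h | h⟩ | ⟨r, h | h⟩⟩ := h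
  · exact (crystalMove_of_diagramLower h).elim fun c hc => ⟨r, c, Or.inl hc⟩
  · exact (crystalMove_of_diagramRaise h).elim fun c hc => ⟨r, c, Or.inr hc⟩
  · exact (crystalMove_of_diagramLower h).elim fun c hc => ⟨r, c, Or.inr hc⟩
  · exact (crystalMove_of_diagramRaise h).elim fun c hc => ⟨r, c, Or.inl hc⟩

theorem compatible_of_mem {T : P → ℕ × ℕ} {D : Diagram} (hT : TableauAlignment T (align T 0))
    (hD : D ∈ componentDiagrams T) : Compatible T D := by
  have h : Relation.ReflTransGen diagramCrystal.Adj (tableauDiagram T) D :=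
    (SimpleGraph.reachable_iff_reflTransGen _ _).1 hD
  induction h with
  | refl => exact compatible_tableauDiagram hT
  | tail hab hbc ih =>
    have ih' := ih ((SimpleGraph.reachable_iff_reflTransGen _ _).2 hab)
    obtain ⟨r, c, hM | hM⟩ := exists_crystalMove_of_adj hbc
    · exact hM.compatible.1 ih'
    · exact hM.compatible.2 ih'

theorem mem_componentDiagrams_raise {T : P → ℕ × ℕ} {D E : Diagram} {r : ℕ}
    (hD : D ∈ componentDiagrams T) (h : diagramRaise r D = some E) :
    E ∈ componentDiagrams T := by
  obtain ⟨c, hM⟩ := crystalMove_of_diagramRaise h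
  have hadj : diagramCrystal.Adj D E := by
    rw [diagramCrystal, SimpleGraph.fromRel_adj]
    refine ⟨fun e => ?_, Or.inl ⟨r, Or.inr h⟩⟩
    have h1 := hM.mem
    rw [← e, hM.eq] at h1
    simp at h1
  exact SimpleGraph.Reachable.trans hD hadj.reachable

/-- The only diagram in the component that no raising operator applies to is that of `T`: it has
no cell below row `1` because there are no long descents, and the path through all columns,
once it has reached row `0`, stays there, while the cells of row `1` before are
outnumbered by those of row `0`. -/
theorem eq_tableauDiagram {T : P → ℕ × ℕ} {D : Diagram} (hT : TableauAlignment T (align T 0))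
    (hD : Compatible T D) (h : ∀ r, diagramRaise r D = none) : D = tableauDiagram T := by
  have above : ∀ {s c}, (s + 1, c) ∈ D → ∃ c' ≤ c, (s, c') ∈ D := by
    intro s c hs
    obtain ⟨c', -, h2, h3⟩ := rowCount_pos_iff.1 (lt_of_lt_of_le
      (rowCount_pos_iff.2 ⟨c, Nat.zero_le _, Nat.lt_succ_self c, hs⟩)
      (rowCount_le_of_diagramRaise_eq_none (h s) (c + 1)))
    exact ⟨c', by omega, h3⟩
  have hle : ∀ {s c}, (s, c) ∈ D → s ≤ 1 := by
    intro s c hs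
    by_contra hcon
    obtain ⟨n, rfl⟩ : ∃ n, s = n + 1 + 1 := ⟨s - 2, by omega⟩
    obtain ⟨c', h1, h2⟩ := above hs
    obtain ⟨c'', h3, h4⟩ := above h2
    exact hD.noLongDescent _ _ _ _ _ _ h4 h2 hs (by omega) (by omega) h3 h1
  have hzero : ∀ x, (0, align T 0 x) ∈ D := by
    intro x
    obtain ⟨π, hπ, hmem⟩ := hD.hasPath (align T 0 x + 1) fun c hc =>
      (hT.exists_upper x c (by omega)).imp fun a ha => ha.2
    have h1 := hmem (align T 0 x) (by omega)
    have h2 := hle h1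
    rcases (show π (align T 0 x) = 0 ∨ π (align T 0 x) = 1 by omega) with h3 | h3
    · rwa [h3] at h1
    · have h4 : rowCount D 1 0 (align T 0 x + 1) = align T 0 x + 1 - 0 :=
        rowCount_eq_of_forall fun c _ hc => by
          have h5 := hmem c hc
          have h6 := hle h5
          have h7 := hπ (show c ≤ align T 0 x by omega)
          rwa [show π c = 1 by omega] at h5
      exact mem_of_rowCount_eq (h4 ▸ rowCount_le_of_diagramRaise_eq_none (h 0) _)
        (Nat.zero_le _) (by omega)
  ext ⟨s, c⟩
  rw [mem_tableauDiagram]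
  constructor
  · intro hs
    obtain ⟨x, rfl, -⟩ := exists_rowOf_eq hT hD hs
    obtain ⟨a, ha, hax⟩ := hT.exists_upper x _ le_rfl
    have hs1 := hle hs
    rcases (show s = 0 ∨ s = 1 by omega) with rfl | rfl
    · exact ⟨a, ha, hax⟩
    · rcases hT.column_cases ha with h1 | ⟨b, hb, hba, -⟩
      · obtain ⟨t, ht⟩ := hD.exists_oneCell h1
        have h2 := (ht 0).1 (hzero a)
        have h3 := (ht 1).1 (hax ▸ hs)
        omega
      · exact ⟨b, hb, hba.trans hax⟩
  · rintro ⟨x, rfl, rfl⟩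
    rcases hT.cases x with hx | hx
    · rw [hx]
      exact hzero x
    · obtain ⟨a, ha, hax⟩ := hT.exists_upper x _ le_rfl
      obtain ⟨s, t, hs, -⟩ := exists_twoCells_rowOf hT hD ha hx hax
      have h1 := hs.1
      have h2 := hle ((hs.2 t).2 (Or.inr rfl))
      rw [hx]
      exact (hs.2 1).2 (by omega)

theorem IsPArray.eq_ofRows {A : P → ℕ × ℕ} (hA : IsPArray A) : ofRows (fun x => (A x).1) = A := by
  classical
  funext x
  refine Prod.ext rfl ?_
  have h : (Finset.univ.filter fun y => (A y).1 = (A x).1 ∧ y < x).card =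
      (Finset.range (A x).2).card := by
    refine Finset.card_bij (fun y _ => (A y).2) ?_ ?_ ?_
    · intro y hy
      simp only [Finset.mem_filter, Finset.mem_univ, true_and] at hy
      exact Finset.mem_range.2 ((hA.lt_iff hy.1).2 hy.2)
    · intro y hy z hz hyz
      simp only [Finset.mem_filter, Finset.mem_univ, true_and] at hy hz
      exact hA.1 (Prod.ext (hy.1.trans hz.1.symm) hyz)
    · intro k hk
      rw [Finset.mem_range] at hk
      obtain ⟨y, hy, -⟩ := hA.exists_of_le hk.le
      have h1 : (A y).1 = (A x).1 := by rw [hy]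
      have h2 : (A y).2 = k := by rw [hy]
      refine ⟨y, ?_, h2⟩
      simp only [Finset.mem_filter, Finset.mem_univ, true_and]
      exact ⟨h1, hA.lt_of_lt h1 (by omega)⟩
  rw [Finset.card_range] at h
  rw [← h]
  simp only [ofRows]

theorem array_filling_tableauDiagram {T : P → ℕ × ℕ} (h : IsTwoRowTableau T)
    (hP : SumFree 3 1 P) : array (filling T (tableauDiagram T)) = T := by
  have hT := h.tableauAlignment
  have hD := compatible_tableauDiagram hT
  have hzero : ∀ i x, align T 0 x = i → upperRow T (tableauDiagram T) i = 0 := by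
    intro i
    induction i with
    | zero =>
      intro x hx
      obtain ⟨a, ha, hax⟩ := hT.exists_upper x 0 (Nat.zero_le _)
      exact Nat.sInf_eq_zero.2 (Or.inl (mem_tableauDiagram.2 ⟨a, ha, hax⟩))
    | succ i ih =>
      intro x hx
      by_cases hl : LooseAt T (align T 0) (i + 1)
      · obtain ⟨a, ha, hax⟩ := hT.exists_upper x i (by omega)
        have h1 := (upperRow_le_of_looseAt hT hD hl).1
        rw [ih a hax] at h1
        omega
      · obtain ⟨a, ha, hax⟩ := hT.exists_upper x (i + 1) hx.ge
        rw [upperRow_of_not_looseAt hl]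
        exact Nat.sInf_eq_zero.2 (Or.inl (mem_tableauDiagram.2 ⟨a, ha, hax⟩))
  have hrow : rowOf T (tableauDiagram T) = fun x => (T x).1 := by
    funext x
    rcases hT.cases x with hx | hx
    · rw [rowOf_upper hx, hzero _ x rfl, hx]
    · obtain ⟨a, ha, hax⟩ := hT.exists_upper x _ le_rfl
      have h1 : rowOf T (tableauDiagram T) a = 0 := by rw [rowOf_upper ha, hzero _ a rfl]
      have h2 : rowOf T (tableauDiagram T) x ≠ 0 := fun h2 =>
        ne_of_row ha hx (rowOf_injective hT hD hax (h1.trans h2.symm))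
      obtain ⟨y, hy, -⟩ := mem_tableauDiagram.1 (rowOf_mem hT hD x)
      have := hT.row_le y
      omega
  rw [filling_eq hT hP hD, (hD.chainFilling hT hP).array_eq_ofRows, hrow, h.1.1.eq_ofRows]

/-! ### Raising to the diagram of the tableau -/

/-- The first raising operator that applies to a diagram of the component commutes with the
passage to arrays. -/
theorem arrayRaise_filling_of_first {T : P → ℕ × ℕ} {D E : Diagram} {r : ℕ}
    (h : IsTwoRowTableau T) (hP : SumFree 3 1 P) (hD : D ∈ componentDiagrams T)
    (hr : diagramRaise r D = some E) (hlt : ∀ r' < r, diagramRaise r' D = none) :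
    arrayRaise r (array (filling T D)) = some (array (filling T E)) := by
  have hT := h.tableauAlignment
  have hD' := compatible_of_mem hT hD
  have hE' := compatible_of_mem hT (mem_componentDiagrams_raise hD hr)
  obtain ⟨c, hM⟩ := crystalMove_of_diagramRaise hr
  refine arrayRaise_filling hT hP hD' hE' hM ?_
  rintro i rfl hl hi
  have hno : (r, i + 1) ∉ D := fun h => by simpa using (hM.eq _).1 h
  have hmem : (r + 1, i + 1) ∈ D := (hM.eq _).2 (Or.inl rfl)
  obtain ⟨x, -, hx⟩ := hE'.chainFilling hT hP |>.surj hM.mem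
  obtain ⟨a, ha, hai⟩ := hT.exists_upper x i (by omega)
  obtain ⟨a₁, ha₁, hai₁⟩ := hT.exists_upper x (i + 1) hx.ge
  have h1 := upperRow_mem hT hD' ha
  have h2 := upperRow_mem hT hD' ha₁
  rw [hai, hi] at h1
  rw [hai₁] at h2
  cases r with
  | zero =>
    have h3 := (upperRow_le_of_looseAt hT hD' hl).1
    rw [hi, Nat.le_zero] at h3
    exact hno (h3 ▸ h2)
  | succ r =>
    -- A cell of row `r` to the left would complete a long descent.
    obtain ⟨j, -, h4, h5⟩ := rowCount_pos_iff.1 (lt_of_lt_of_le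
      (rowCount_pos_iff.2 ⟨i, Nat.zero_le _, Nat.lt_succ_self i, h1⟩)
      (rowCount_le_of_diagramRaise_eq_none (hlt r (Nat.lt_succ_self r)) (i + 1)))
    exact hD'.noLongDescent _ _ _ _ _ _ h5 h1 hmem (by omega) (by omega) (by omega) (by omega)

/-- The sum of the rows of the cells. -/
def rowSum (D : Diagram) : ℕ := ∑ z ∈ D, z.1

theorem CrystalMove.rowSum_eq {D E : Diagram} {r c : ℕ} (h : CrystalMove D E r c) :
    rowSum E = rowSum D + 1 := by
  have hE : E = insert (r + 1, c) (D.erase (r, c)) := by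
    ext z
    rw [h.eq]
    simp [and_comm]
  have h1 := Finset.add_sum_erase D Prod.fst h.mem
  rw [rowSum, rowSum, hE, Finset.sum_insert (by simp [h.notMem])]
  simp only at h1 ⊢
  omega

/-- Induction from the diagram of `T` along the first applicable raising operators. -/
theorem componentDiagrams_induction {T : P → ℕ × ℕ} (h : IsTwoRowTableau T)
    (hP : SumFree 3 1 P) {motive : Diagram → Prop}
    (top : (∀ r, diagramRaise r (tableauDiagram T) = none) → motive (tableauDiagram T))
    (step : ∀ D ∈ componentDiagrams T, ∀ E ∈ componentDiagrams T, ∀ r,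
      (∀ r' < r, arrayRaise r' (array (filling T D)) = none) →
      arrayRaise r (array (filling T D)) = some (array (filling T E)) → D ≠ E →
      motive E → motive D) {D : Diagram} (hD : D ∈ componentDiagrams T) : motive D := by
  suffices H : ∀ n D, D ∈ componentDiagrams T → rowSum D = n → motive D from H _ D hD rfl
  clear hD D
  intro n
  induction n using Nat.strong_induction_on with
  | _ n ih =>
  intro D hD hn
  have hT := h.tableauAlignment
  have hD' := compatible_of_mem hT hD
  by_cases hall : ∀ r, diagramRaise r D = none
  · obtain rfl := eq_tableauDiagram hT hD' hall
    exact top hall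
  · classical
    push Not at hall
    have hlt : ∀ r' < Nat.find hall, diagramRaise r' D = none := fun r' hr' =>
      not_not.1 (Nat.find_min hall hr')
    obtain ⟨E, hE⟩ := Option.ne_none_iff_exists'.1 (Nat.find_spec hall)
    have hEm := mem_componentDiagrams_raise hD hE
    obtain ⟨c, hM⟩ := crystalMove_of_diagramRaise hE
    have hsum := hM.rowSum_eq
    exact step D hD E hEm _ (fun r' hr' => arrayRaise_filling_eq_none hT hP hD' (hlt r' hr'))
      (arrayRaise_filling_of_first h hP hD hE hlt) (fun e => by rw [e] at hsum; omega)
      (ih _ (by omega) E hEm rfl)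

theorem eq_of_array_filling_eq_same {T : P → ℕ × ℕ} (h : IsTwoRowTableau T)
    (hP : SumFree 3 1 P) {D E : Diagram} (hD : D ∈ componentDiagrams T)
    (hE : E ∈ componentDiagrams T) (he : array (filling T D) = array (filling T E)) : D = E := by
  have hT := h.tableauAlignment
  have hD' := compatible_of_mem hT hD
  have hE' := compatible_of_mem hT hE
  rw [filling_eq hT hP hD', filling_eq hT hP hE'] at he
  have hrow : rowOf T D = rowOf T E := funext fun x => congrArg Prod.fst (congrFun he x)
  rw [← (hD'.chainFilling hT hP).image_eq, ← (hE'.chainFilling hT hP).image_eq, hrow]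

/-- The tableau can be read off the array of a filling, by applying raising operators to the array
as long as there is one that does not give `0`. -/
theorem tableau_eq_of_array_filling_eq {T T' : P → ℕ × ℕ} (h : IsTwoRowTableau T)
    (h' : IsTwoRowTableau T') (hP : SumFree 3 1 P) {D D' : Diagram}
    (hD : D ∈ componentDiagrams T) (hD' : D' ∈ componentDiagrams T')
    (he : array (filling T D) = array (filling T' D')) : T = T' := by
  have htop : ∀ {S : P → ℕ × ℕ}, IsTwoRowTableau S →
      (∀ r, diagramRaise r (tableauDiagram S) = none) → ∀ r, arrayRaise r S = none := by
    intro S hS hnone r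
    have h1 := arrayRaise_filling_eq_none hS.tableauAlignment hP
      (compatible_tableauDiagram hS.tableauAlignment) (hnone r)
    rwa [array_filling_tableauDiagram hS hP] at h1
  suffices H : ∀ D', D' ∈ componentDiagrams T' → array (filling T D) = array (filling T' D') →
      T = T' from H D' hD' he
  clear he hD' D'
  refine componentDiagrams_induction h hP (motive := fun D => ∀ D',
    D' ∈ componentDiagrams T' → array (filling T D) = array (filling T' D') → T = T')
    ?_ ?_ hD
  · intro hnone D' hD'
    refine componentDiagrams_induction h' hP (motive := fun D' =>
      array (filling T (tableauDiagram T)) = array (filling T' D') → T = T') ?_ ?_ hD'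
    · intro _ he
      rwa [array_filling_tableauDiagram h hP, array_filling_tableauDiagram h' hP] at he
    · intro D' _ E' _ r _ hr _ _ he
      rw [array_filling_tableauDiagram h hP] at he
      rw [← he, htop h hnone r] at hr
      simp at hr
  · intro D hD E hE r hlt hr _ ih D' hD'
    refine componentDiagrams_induction h' hP (motive := fun D' =>
      array (filling T D) = array (filling T' D') → T = T') ?_ ?_ hD'
    · intro hnone he
      rw [array_filling_tableauDiagram h' hP] at he
      rw [he, htop h' hnone r] at hr
      simp at hr
    · intro D' _ E' hE' r' hlt' hr' _ _ he
      rw [he] at hlt hr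
      obtain hrr | rfl | hrr := lt_trichotomy r r'
      · rw [hlt' r hrr] at hr
        simp at hr
      · rw [hr'] at hr
        exact ih E' hE' (Option.some.inj hr).symm
      · rw [hlt r' hrr] at hr'
        simp at hr'

end Crystals

theorem mainTheorem4 {P : Type*} [PartialOrder P] [Fintype P] (hP : SumFree 3 1 P) :
    (∀ T : P → ℕ × ℕ, IsTwoRowTableau T → ∀ D ∈ componentDiagrams T,
      Set.BijOn (filling T D) Set.univ (D : Set (ℕ × ℕ)) ∧
      IsPArray (array (filling T D)) ∧
      ∀ i, diagramWt D i = arrayWt (array (filling T D)) i) ∧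
    Set.BijOn (fun q : (P → ℕ × ℕ) × Diagram => array (filling q.1 q.2))
      {q | IsTwoRowTableau q.1 ∧ q.2 ∈ componentDiagrams q.1} (fillingArrays P) ∧
    ∀ T : P → ℕ × ℕ, IsTwoRowTableau T →
      ((arrayCrystal P).induce {A | A.1 ∈ fillingArraysOf T}).Connected := by
  have main : ∀ T : P → ℕ × ℕ, IsTwoRowTableau T → ∀ D ∈ componentDiagrams T,
      Set.BijOn (filling T D) Set.univ (D : Set (ℕ × ℕ)) ∧
      IsPArray (array (filling T D)) ∧
      ∀ i, diagramWt D i = arrayWt (array (filling T D)) i := by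
    intro T h D hD
    have hT := h.tableauAlignment
    have hD' := compatible_of_mem hT hD
    have hF := hD'.chainFilling hT hP
    rw [filling_eq hT hP hD']
    refine ⟨⟨fun x _ => hF.mem x, fun x _ y _ hxy => ?_, ?_⟩, hF.isPArray, hF.diagramWt_eq⟩
    · simp only [Prod.mk.injEq] at hxy
      exact hF.inj hxy.2 hxy.1
    · rintro ⟨s, c⟩ hz
      obtain ⟨x, hx, hxc⟩ := hF.surj hz
      exact ⟨x, trivial, by rw [← hx, ← hxc]⟩
  refine ⟨main, ⟨?_, ?_, ?_⟩, fun T h => ?_⟩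
  · rintro ⟨T, D⟩ ⟨h, hD⟩
    exact ⟨filling T D, ⟨T, h, D, hD, rfl⟩, rfl⟩
  · rintro ⟨T, D⟩ ⟨h, hD⟩ ⟨T', D'⟩ ⟨h', hD'⟩ he
    obtain rfl : T = T' := tableau_eq_of_array_filling_eq h h' hP hD hD' he
    obtain rfl : D = D' := eq_of_array_filling_eq_same h hP hD hD' he
    rfl
  · rintro _ ⟨_, ⟨T, h, D, hD, rfl⟩, rfl⟩
    exact ⟨(T, D), ⟨h, hD⟩, rfl⟩
  · have hmem : ∀ D ∈ componentDiagrams T, array (filling T D) ∈ fillingArraysOf T :=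
      fun D hD => ⟨_, ⟨D, hD, rfl⟩, rfl⟩
    have htop : tableauDiagram T ∈ componentDiagrams T := SimpleGraph.Reachable.refl _
    let V : ∀ D, D ∈ componentDiagrams T →
        {A : {A : P → ℕ × ℕ // IsPArray A} | A.1 ∈ fillingArraysOf T} :=
      fun D hD => ⟨⟨array (filling T D), (main T h D hD).2.1⟩, hmem D hD⟩
    have hreach : ∀ D (hD : D ∈ componentDiagrams T),
        ((arrayCrystal P).induce {A | A.1 ∈ fillingArraysOf T}).Reachable
          (V D hD) (V _ htop) := by
      intro D hD
      refine componentDiagrams_induction h hP (motive := fun D => ∀ hD : D ∈ componentDiagrams T,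
        ((arrayCrystal P).induce {A | A.1 ∈ fillingArraysOf T}).Reachable
          (V D hD) (V _ htop)) (fun _ _ => SimpleGraph.Reachable.refl _) ?_ hD hD
      intro D hD E hE r _ hr hne ih hD
      refine SimpleGraph.Reachable.trans (SimpleGraph.Adj.reachable ?_) (ih hE)
      rw [SimpleGraph.induce_adj, arrayCrystal, SimpleGraph.fromRel_adj]
      refine ⟨fun e => hne (eq_of_array_filling_eq_same h hP hD hE (congrArg Subtype.val e)),
        Or.inl ⟨r, Or.inr hr⟩⟩
    have : Nonempty {A : {A : P → ℕ × ℕ // IsPArray A} | A.1 ∈ fillingArraysOf T} :=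
      ⟨V _ htop⟩
    have hV : ∀ A : {A : {A : P → ℕ × ℕ // IsPArray A} | A.1 ∈ fillingArraysOf T},
        ∃ D, ∃ hD : D ∈ componentDiagrams T, A = V D hD := by
      intro A
      obtain ⟨_, ⟨D, hD, rfl⟩, he⟩ := A.2
      exact ⟨D, hD, Subtype.ext (Subtype.ext he.symm)⟩
    refine ⟨fun A B => ?_⟩
    obtain ⟨D, hD, rfl⟩ := hV A
    obtain ⟨E, hE, rfl⟩ := hV B
    exact (hreach D hD).trans (hreach E hE).symm
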